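/- Let $N\ge 1$ be an integer, let $2^*=\frac{2N}{(N-2)_+}$ (so $2^*=\infty$ if $N=1,2$), let $2<p,q<2^*$ and $\lambda\in\mathbb R$. Let $\Sigma$ be the Hilbert space of all $u\in L^2(\mathbb R^N;\mathbb C)$ with $\nabla u\in L^2$ (weak gradient) and $|x|u\in L^2$, with norm $\|u\|_\Sigma^2=\int_{\mathbb R^N}\big((1+|x|^2)|u|^2+|\nabla u|^2\big)dx$. For $u\in\Sigma$ put $$F(u)=\tfrac12\int|\nabla u|^2+\tfrac12\int|x|^2|u|^2+\tfrac{\lambda}{2}\int|u|^2,\qquad G(u)=F(u)+\tfrac1q\int|u|^q,$$ and let $B_p=\{\phi\in\Sigma:\ \frac1p\int|\phi|^p=1\}$. For $a,b\in\mathbb R$, a solution $u\in\Sigma$ of $-\Delta u+|x|^2u+\lambda u-a|u|^{p-2}u+b|u|^{q-2}u=0$ is a critical point on $\Sigma$ of the functional $u\mapsto F(u)-\frac ap\int|u|^p+\frac bq\int|u|^q$ (its real Fréchet derivative at $u$ exists and is zero) that also satisfies the equation in the sense of distributions on $\mathbb R^N$. 1. If $\lambda>-N$, then there is a solution $u\in\Sigma\setminus\{0\}$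 of $-\Delta u+|x|^2u+\lambda u=|u|^{p-2}u$. It can be taken of the form $u=cv$, where $c>0$ and $v$ is a minimizer of $F$ on $B_p$. 2. If $\lambda<-N$, then there is a solution $u\in\Sigma\setminus\{0\}$ of $-\Delta u+|x|^2u+\lambda u=-|u|^{p-2}u$. It can be taken of the form $u=cv$, where $c>0$ and $v$ is a minimizer of $F$ on $B_p$. 3. If $\lambda>-N$, then there are $\mu>0$ and a solution $u\in\Sigma\setminus\{0\}$ of $-\Delta u+|x|^2u+\lambda u-\mu|u|^{p-2}u+|u|^{q-2}u=0$. It can be taken to be a minimizer of $G$ on $B_p$. -/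

import Mathlib

open MeasureTheory Laplacian
open scoped ENNReal ContDiff

namespace HarmonicNLS

noncomputable section

/-- The physical space `ℝ^N`, with the Euclidean norm and Lebesgue measure. -/
abbrev Space (N : ℕ) : Type := EuclideanSpace ℝ (Fin N)

/-- The value space `ℂ^N` of gradients of complex-valued functions, with its Hermitian norm. -/
abbrev Grad (N : ℕ) : Type := EuclideanSpace ℂ (Fin N)

/-- The space `L²(ℝ^N; ℂ) × L²(ℝ^N; ℂ^N) × L²(ℝ^N; ℂ)` with the Hilbert norm
`‖(u, g, w)‖² = ‖u‖² + ‖g‖² + ‖w‖²`. -/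
abbrev Triple (N : ℕ) : Type :=
  WithLp 2 (Lp ℂ 2 (volume : Measure (Space N)) ×
    WithLp 2 (Lp (Grad N) 2 (volume : Measure (Space N)) ×
      Lp ℂ 2 (volume : Measure (Space N))))

/-- `g` is the weak (distributional) gradient of `u`: for every test function `φ ∈ C_c^∞(ℝ^N)` and
every `i`, `∫ u ∂_i φ = - ∫ g_i φ`. -/
def IsWeakGradient {N : ℕ} (u : Space N → ℂ) (g : Space N → Grad N) : Prop :=
  ∀ φ : Space N → ℝ, ContDiff ℝ ∞ φ → HasCompactSupport φ → ∀ i : Fin N,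
    ∫ x, fderiv ℝ φ x (EuclideanSpace.single i 1) • u x = - ∫ x, φ x • g x i

theorem integrable_test_smul {N : ℕ} {F : Type*} [NormedAddCommGroup F] [NormedSpace ℝ F]
    {φ : Space N → ℝ} (hφ : Continuous φ) (hc : HasCompactSupport φ) {u : Space N → F}
    (hu : MemLp u 2 (volume : Measure (Space N))) : Integrable (fun x => φ x • u x) :=
  (hu.locallyIntegrable (by norm_num)).integrable_smul_left_of_hasCompactSupport hφ hc

theorem memLp_coord {N : ℕ} {g : Space N → Grad N}
    (hg : MemLp g 2 (volume : Measure (Space N))) (i : Fin N) :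
    MemLp (fun x => g x i) 2 (volume : Measure (Space N)) :=
  (EuclideanSpace.proj (𝕜 := ℂ) i).comp_memLp' hg

theorem continuous_partial {N : ℕ} {φ : Space N → ℝ} (hφ : ContDiff ℝ ∞ φ) (v : Space N) :
    Continuous (fun x => fderiv ℝ φ x v) :=
  (hφ.continuous_fderiv (by simp)).clm_apply continuous_const

theorem IsWeakGradient.add {N : ℕ} {u v : Space N → ℂ} {g h : Space N → Grad N}
    (hu : MemLp u 2 (volume : Measure (Space N))) (hv : MemLp v 2 (volume : Measure (Space N)))
    (hg : MemLp g 2 (volume : Measure (Space N))) (hh : MemLp h 2 (volume : Measure (Space N)))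
    (h₁ : IsWeakGradient u g) (h₂ : IsWeakGradient v h) : IsWeakGradient (u + v) (g + h) := by
  intro φ hφ hc i
  have hd := continuous_partial hφ (EuclideanSpace.single i 1)
  have hdc : HasCompactSupport (fun x => fderiv ℝ φ x (EuclideanSpace.single i (1 : ℝ))) :=
    hc.fderiv_apply ℝ _
  simp only [Pi.add_apply, smul_add, PiLp.add_apply]
  rw [integral_add (integrable_test_smul hd hdc hu) (integrable_test_smul hd hdc hv),
    integral_add (integrable_test_smul hφ.continuous hc (memLp_coord hg i))
      (integrable_test_smul hφ.continuous hc (memLp_coord hh i)),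
    h₁ φ hφ hc i, h₂ φ hφ hc i, neg_add]

theorem IsWeakGradient.smul {N : ℕ} {u : Space N → ℂ} {g : Space N → Grad N} (c : ℂ)
    (h : IsWeakGradient u g) : IsWeakGradient (c • u) (c • g) := by
  intro φ hφ hc i
  have h1 : ∀ x, fderiv ℝ φ x (EuclideanSpace.single i (1 : ℝ)) • (c • u) x
      = c • (fderiv ℝ φ x (EuclideanSpace.single i (1 : ℝ)) • u x) := fun x => by
    simp only [Pi.smul_apply]; rw [smul_comm]
  have h2 : ∀ x, φ x • (c • g) x i = c • (φ x • g x i) := fun x => by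
    simp only [Pi.smul_apply, PiLp.smul_apply]; rw [smul_comm]
  simp only [h1, h2]
  rw [integral_smul, integral_smul, h φ hφ hc i, smul_neg]

theorem IsWeakGradient.congr {N : ℕ} {u v : Space N → ℂ} {g h : Space N → Grad N}
    (hu : u =ᵐ[volume] v) (hg : g =ᵐ[volume] h) (H : IsWeakGradient u g) :
    IsWeakGradient v h := by
  intro φ hφ hc i
  have h1 : ∫ x, fderiv ℝ φ x (EuclideanSpace.single i 1) • v x
      = ∫ x, fderiv ℝ φ x (EuclideanSpace.single i 1) • u x :=
    integral_congr_ae (by filter_upwards [hu] with x hx; rw [hx])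
  have h2 : ∫ x, φ x • h x i = ∫ x, φ x • g x i :=
    integral_congr_ae (by filter_upwards [hg] with x hx; rw [hx])
  rw [h1, h2]
  exact H φ hφ hc i

/-- The energy space `Σ = H¹ ∩ 𝓕(H¹)` of the harmonic oscillator: the functions `u ∈ L²(ℝ^N; ℂ)`
with weak gradient `∇u ∈ L²` and `|x| u ∈ L²`. It is realised as the subspace of the triples
`(u, ∇u, |x| u)`, so that it inherits precisely the Hilbert norm
`‖u‖_Σ² = ‖u‖² + ‖∇u‖² + ‖x u‖²`. The last two entries of a triple are determined by `u`. -/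
def SigmaSpace (N : ℕ) : Submodule ℂ (Triple N) where
  carrier := {z | IsWeakGradient z.fst z.snd.fst ∧
    ∀ᵐ x : Space N, z.snd.snd x = (‖x‖ : ℂ) * z.fst x}
  add_mem' := by
    rintro a b ⟨ha, ha'⟩ ⟨hb, hb'⟩
    refine ⟨(IsWeakGradient.add (Lp.memLp _) (Lp.memLp _) (Lp.memLp _) (Lp.memLp _) ha hb).congr
      (Lp.coeFn_add a.fst b.fst).symm (Lp.coeFn_add a.snd.fst b.snd.fst).symm, ?_⟩
    filter_upwards [ha', hb', Lp.coeFn_add a.fst b.fst, Lp.coeFn_add a.snd.snd b.snd.snd]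
      with x h1 h2 h3 h4
    simp only [WithLp.add_fst, WithLp.add_snd]
    rw [h3, h4, Pi.add_apply, Pi.add_apply, h1, h2, mul_add]
  zero_mem' := by
    have h0 : IsWeakGradient (N := N) 0 0 := by
      intro φ _ _ i
      simp
    refine ⟨h0.congr (Lp.coeFn_zero ℂ 2 volume).symm (Lp.coeFn_zero (Grad N) 2 volume).symm, ?_⟩
    filter_upwards [Lp.coeFn_zero ℂ 2 (volume : Measure (Space N))] with x h1
    simp only [WithLp.zero_fst, WithLp.zero_snd]
    rw [h1]
    simp
  smul_mem' := by
    rintro c a ⟨ha, ha'⟩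
    refine ⟨(ha.smul c).congr (Lp.coeFn_smul c a.fst).symm (Lp.coeFn_smul c a.snd.fst).symm, ?_⟩
    filter_upwards [ha', Lp.coeFn_smul c a.fst, Lp.coeFn_smul c a.snd.snd] with x h1 h3 h4
    simp only [WithLp.smul_fst, WithLp.smul_snd]
    rw [h3, h4, Pi.smul_apply, Pi.smul_apply, h1, smul_eq_mul, smul_eq_mul]
    ring

variable {N : ℕ}

/-- The function `u : ℝ^N → ℂ` underlying an element of `Σ`. -/
def sigmaFn (u : SigmaSpace N) : Space N → ℂ := u.1.fst

/-- The weak gradient `∇u : ℝ^N → ℂ^N` of an element of `Σ`. -/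
def sigmaGrad (u : SigmaSpace N) : Space N → Grad N := u.1.snd.fst

/-- The critical Sobolev exponent `2^* = 2N / (N-2)_+` as an extended nonnegative number. Here
subtraction in `ℝ≥0∞` is truncated, which gives the positive part, and `2^* = ∞` for
`N = 1, 2`. -/
def critExp (N : ℕ) : ℝ≥0∞ := 2 * N / (N - 2)

/-- `F(u) = ½ ∫ |∇u|² + ½ ∫ |x|² |u|² + (λ/2) ∫ |u|²`, that is, `½ ⟨(-Δ + |x|²) u, u⟩ + (λ/2) ‖u‖²`
in the form sense. -/
def quadEnergy (lam : ℝ) (u : SigmaSpace N) : ℝ :=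
  (1 / 2) * (∫ x, ‖sigmaGrad u x‖ ^ 2) + (1 / 2) * (∫ x, ‖x‖ ^ 2 * ‖sigmaFn u x‖ ^ 2)
    + (lam / 2) * ∫ x, ‖sigmaFn u x‖ ^ 2

/-- `∫ |u|^r`. -/
def powInt (r : ℝ) (u : SigmaSpace N) : ℝ := ∫ x, ‖sigmaFn u x‖ ^ r

/-- The action
`½ ∫ |∇u|² + ½ ∫ |x|² |u|² + (λ/2) ∫ |u|² - (a/p) ∫ |u|^p + (b/q) ∫ |u|^q` of the equation
`-Δu + |x|² u + λ u - a |u|^{p-2} u + b |u|^{q-2} u = 0`. -/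
def action (lam a p b q : ℝ) (u : SigmaSpace N) : ℝ :=
  quadEnergy lam u - a / p * powInt p u + b / q * powInt q u

/-- The nonlinearity `a |z|^{p-2} z - b |z|^{q-2} z`. -/
def nonlin (a p b q : ℝ) (z : ℂ) : ℂ :=
  (a * ‖z‖ ^ (p - 2)) • z - (b * ‖z‖ ^ (q - 2)) • z

/-- The equation `-Δu + |x|² u + λ u = f(u)` in the sense of distributions on `ℝ^N`. -/
def SolvesInDistributions (lam : ℝ) (f : ℂ → ℂ) (u : Space N → ℂ) : Prop :=
  LocallyIntegrable u ∧ LocallyIntegrable (fun x => f (u x)) ∧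
    ∀ φ : Space N → ℝ, ContDiff ℝ ∞ φ → HasCompactSupport φ →
      ∫ x, (-(Δ φ x) + ‖x‖ ^ 2 * φ x + lam * φ x) • u x = ∫ x, φ x • f (u x)

/-- `u ∈ Σ` is a weak solution of
`-Δu + |x|² u + λ u - a |u|^{p-2} u + b |u|^{q-2} u = 0`: it is a critical point of the action
on `Σ` (its real Fréchet derivative, for the norm of `Σ`, exists and vanishes at `u`), and the
equation holds in the sense of distributions. -/
structure IsWeakSolution (lam a p b q : ℝ) (u : SigmaSpace N) : Prop where
  critical : HasFDerivAt (action lam a p b q) (0 : SigmaSpace N →L[ℝ] ℝ) u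
  distributional : SolvesInDistributions lam (nonlin a p b q) (sigmaFn u)

/-- The `L^p` sphere `{φ ∈ Σ : (1/p) ‖φ‖_{L^p}^p = 1}`. -/
def lpSphere (N : ℕ) (p : ℝ) : Set (SigmaSpace N) := {φ | 1 / p * powInt p φ = 1}

end

end HarmonicNLS

open MeasureTheory Laplacian
open scoped ENNReal ContDiff

namespace HarmonicNLS

noncomputable section

variable {N : ℕ}

/-! All three solutions come from minimizing on the sphere `B_p`, and a minimizer exists for every
real `λ`. Write `F(u) = ½‖u‖_Σ² + ((λ-1)/2)‖u‖_{L²}²`. The second term may be negative, but on `B_p`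
it is harmless: inside a ball `|u|² ≤ 1 + |u|^p`, whose integral is bounded there, and outside a
large ball `|u|² ≤ ε|x|²|u|²`. Hence `F` is coercive on `B_p`, and so is `G` (`exists_l2_bound`).

Compactness comes from averages over cubes of side `s`. A function of `Σ` is within `O(s)‖u‖_Σ` of
its cube average in `L²`, because a weak derivative in `L²` controls translations. The confinement
`|x|u ∈ L²` lets one keep only finitely many cubes, so `Σ → L²` is a norm limit of finite rank
operators (`isCompactOperator_l2Emb`). The same averages at dyadic scales, telescoped, give `Σ →
L^r` for subcritical `r` (`sobolev_embedding`), and interpolation with a slightly larger subcritical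
exponent makes this embedding compact too (`cauchySeq_lrEmb`). The direct method then needs no weak
topology: by the parallelogram law, a minimizing sequence whose lower order terms converge is Cauchy
in `Σ` (`exists_minimizer`).

At a minimizer the Lagrange rule gives `E'(v) = m J'(v)` with `J = ∫|·|^p`, and testing with `v`
itself shows that `m` has the sign of `E'(v)v`. For `E = F` this is `2F(v)`, whose sign is decided
by the bottom `N` of the spectrum of `-Δ + |x|²`. The commutator `[∂_i, x_i] = 1` gives `F > 0` off
zero when `λ > -N` (`spectral_bound`), while the Gaussian saturates the bound and makes the minimum
negative when `λ < -N`. Since `F` has degree 2 and `J` degree `p ≠ 2`, a dilation `u = cv`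
normalizes the multiplier to `±1`. For `G` the degrees 2 and `q` cannot be normalized together in
this way, so `μ` stays; it is positive because `G'(v)v = 2F(v) + ∫|v|^q`.

Finally `∫|u|^r` is differentiable on `L^r` by a second order Taylor bound, and testing a critical
point with `φz`, `φ ∈ C_c^∞`, `z ∈ ℂ`, yields the equation in distributions. -/

/-! ### Translations on `L²` and weak derivatives -/

/-- `w` is the weak derivative of `u` in the direction `h`. -/
def IsWeakDeriv (h : Space N) (u w : Space N → ℂ) : Prop :=
  ∀ φ : Space N → ℝ, ContDiff ℝ ∞ φ → HasCompactSupport φ →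
    ∫ x, fderiv ℝ φ x h • u x = - ∫ x, φ x • w x

/-- Translation `u ↦ u (· + h)` on `L²`. -/
def trans (h : Space N) : Lp ℂ 2 (volume : Measure (Space N)) →ₗᵢ[ℂ]
    Lp ℂ 2 (volume : Measure (Space N)) :=
  Lp.compMeasurePreservingₗᵢ ℂ (fun x => x + h) (measurePreserving_add_right volume h)

theorem trans_coe (h : Space N) (u : Lp ℂ 2 (volume : Measure (Space N))) :
    trans h u =ᵐ[volume] fun x => u (x + h) :=
  Lp.coeFn_compMeasurePreserving u (measurePreserving_add_right volume h)

theorem trans_trans (h k : Space N) (u : Lp ℂ 2 (volume : Measure (Space N))) :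
    trans h (trans k u) = trans (h + k) u := by
  apply Lp.ext
  have h1 := (measurePreserving_add_right volume h).quasiMeasurePreserving.ae_eq_comp
    (trans_coe k u)
  filter_upwards [trans_coe h (trans k u), h1, trans_coe (h + k) u] with x hx hx1 hx2
  rw [hx, hx2]
  simpa [Function.comp_def, add_assoc] using hx1

theorem trans_zero (u : Lp ℂ 2 (volume : Measure (Space N))) : trans 0 u = u := by
  apply Lp.ext
  filter_upwards [trans_coe 0 u] with x hx
  rw [hx, add_zero]

theorem continuous_trans (u : Lp ℂ 2 (volume : Measure (Space N))) :
    Continuous fun h : Space N => trans h u := by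
  have hc : Continuous fun h : Space N => (⟨fun x => x + h, by fun_prop⟩ : C(Space N, Space N)) :=
    ContinuousMap.continuous_of_continuous_uncurry _ (by
      simp only [Function.uncurry_def, ContinuousMap.coe_mk]; fun_prop)
  exact Continuous.compMeasurePreservingLp (E := ℂ) (p := 2) (f := fun _ => u) continuous_const hc
    (fun h => measurePreserving_add_right volume h) (by norm_num)

theorem inner_trans_left (h : Space N) (u v : Lp ℂ 2 (volume : Measure (Space N))) :
    inner ℂ (trans h u) v = inner ℂ u (trans (-h) v) := by
  have : v = trans h (trans (-h) v) := by rw [trans_trans, add_neg_cancel, trans_zero]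
  conv_lhs => rw [this]
  exact (trans h).inner_map_map _ _

theorem IsWeakGradient.isWeakDeriv {u : Space N → ℂ} {g : Space N → Grad N}
    (hu : MemLp u 2 (volume : Measure (Space N))) (hg : MemLp g 2 (volume : Measure (Space N)))
    (H : IsWeakGradient u g) (h : Space N) :
    IsWeakDeriv h u (fun x => ∑ i, (h i : ℂ) * g x i) := by
  intro φ hφ hc
  have hh : h = ∑ i, h i • EuclideanSpace.single i (1 : ℝ) := by
    ext j
    simp [Finset.sum_apply, Pi.single_apply]
  have h1 : ∀ x, fderiv ℝ φ x h • u x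
      = ∑ i, (h i : ℂ) * (fderiv ℝ φ x (EuclideanSpace.single i (1 : ℝ)) • u x) := by
    intro x
    conv_lhs => rw [hh]
    rw [map_sum, Finset.sum_smul]
    refine Finset.sum_congr rfl fun i _ => ?_
    simp [mul_assoc]
  have h2 : ∀ x, φ x • ∑ i, (h i : ℂ) * g x i = ∑ i, (h i : ℂ) * (φ x • g x i) := by
    intro x
    rw [Finset.smul_sum]
    refine Finset.sum_congr rfl fun i _ => ?_
    simp only [Complex.real_smul]; ring
  simp only [h1, h2]
  rw [integral_finsetSum, integral_finsetSum, ← Finset.sum_neg_distrib]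
  · refine Finset.sum_congr rfl fun i _ => ?_
    rw [integral_const_mul, integral_const_mul, H φ hφ hc i, mul_neg]
  · exact fun i _ => (integrable_test_smul hφ.continuous hc (memLp_coord hg i)).const_mul _
  · exact fun i _ => (integrable_test_smul (continuous_partial hφ _)
      (hc.fderiv_apply ℝ _) hu).const_mul _

/-- A change of variables moves the translation from `u` onto the smooth factor `φ`, so that
differentiation under the integral only meets `φ`; the weak derivative identity then moves the
derivative back. -/
theorem hasDerivAt_integral_test {h : Space N} {u w : Space N → ℂ}
    (hu : MemLp u 2 (volume : Measure (Space N)))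
    (H : IsWeakDeriv h u w) {φ : Space N → ℝ} (hφ : ContDiff ℝ ∞ φ) (hc : HasCompactSupport φ)
    (t : ℝ) :
    HasDerivAt (fun t : ℝ => ∫ x, φ x • u (x + t • h)) (∫ x, φ x • w (x + t • h)) t := by
  have hsub : ∀ (f : Space N → ℂ) (s : ℝ),
      ∫ x, φ x • f (x + s • h) = ∫ x, φ (x - s • h) • f x := by
    intro f s
    rw [← integral_add_right_eq_self (μ := volume) (fun x => φ (x - s • h) • f x) (s • h)]
    simp
  have hφt : ∀ s : ℝ, ContDiff ℝ ∞ (fun x => φ (x - s • h)) := fun s => by fun_prop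
  have hct : ∀ s : ℝ, HasCompactSupport (fun x => φ (x - s • h)) := fun s => by
    simpa [Function.comp_def] using hc.comp_homeomorph (Homeomorph.subRight (s • h))
  have hfd : ∀ (s : ℝ) (x : Space N), fderiv ℝ (fun x => φ (x - s • h)) x =
      fderiv ℝ φ (x - s • h) := fun s x => by
    rw [fderiv_comp_sub]
  have hd : Continuous fun x => fderiv ℝ φ x h := continuous_partial hφ h
  obtain ⟨C, hC⟩ := hd.bounded_above_of_compact_support (hc.fderiv_apply ℝ h)
  -- The compact set swept by the supports of the translates of `φ` for parameters within distance 1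
  -- of `t`. Off it the integrand vanishes, on it `C‖u‖` dominates.
  set K : Set (Space N) := (fun q : ℝ × Space N => q.2 + q.1 • h) ''
    (Set.Icc (t - 1) (t + 1) ×ˢ tsupport φ) with hK
  have hKc : IsCompact K := (isCompact_Icc.prod hc).image (by fun_prop)
  have hw : ∫ x, φ x • w (x + t • h) = ∫ x, -(fderiv ℝ φ (x - t • h) h • u x) := by
    rw [hsub, integral_neg, ← neg_neg (∫ x, φ (x - t • h) • w x), ← H _ (hφt t) (hct t)]
    simp only [hfd]
  simp only [hsub u]
  rw [hw]
  refine (hasDerivAt_integral_of_dominated_loc_of_deriv_le (𝕜 := ℝ) (s := Set.Icc (t - 1) (t + 1))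
    (F := fun s x => φ (x - s • h) • u x) (F' := fun s x => -(fderiv ℝ φ (x - s • h) h • u x))
    (bound := fun x => K.indicator (fun x => C * ‖u x‖) x) ?_ ?_ ?_ ?_ ?_ ?_ ?_).2
  · exact Icc_mem_nhds (by linarith) (by linarith)
  · exact Filter.Eventually.of_forall fun s =>
      (integrable_test_smul (hφt s).continuous (hct s) hu).aestronglyMeasurable
  · exact integrable_test_smul (hφt t).continuous (hct t) hu
  · exact ((hd.comp (by fun_prop : Continuous fun x => x - t • h)).aestronglyMeasurable.smul
      hu.1).neg
  · refine Filter.Eventually.of_forall fun x s hs => ?_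
    rw [norm_neg, norm_smul]
    by_cases hx : x ∈ K
    · rw [Set.indicator_of_mem hx]
      gcongr
      exact hC _
    · rw [Set.indicator_of_notMem hx]
      have : x - s • h ∉ tsupport φ := fun hx' => hx ⟨(s, x - s • h), ⟨hs, hx'⟩, by simp⟩
      have : fderiv ℝ φ (x - s • h) = 0 := by
        by_contra hne
        exact this (support_fderiv_subset ℝ (by simpa using hne))
      simp [this]
  · rw [integrable_indicator_iff hKc.measurableSet]
    exact (((hu.locallyIntegrable (by norm_num)).integrableOn_isCompact hKc).norm).const_mul C
  · refine Filter.Eventually.of_forall fun x s _ => ?_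
    have h1 : HasDerivAt (fun s : ℝ => x - s • h) (-h) s := by
      simpa using ((hasDerivAt_id s).smul_const h).const_sub x
    have h2 := ((hφ.differentiable (by simp)) (x - s • h)).hasFDerivAt.comp_hasDerivAt s h1
    have h3 := h2.smul_const (u x)
    simpa [Function.comp_def, neg_smul] using h3

/-- Paired with a test function this is the fundamental theorem of calculus for a scalar function,
and test functions separate points of `L²`. It upgrades a weak derivative to a strong one along the
translation group. -/
theorem trans_sub_eq_integral {h : Space N} {u w : Lp ℂ 2 (volume : Measure (Space N))}
    (H : IsWeakDeriv h u w) (t : ℝ) :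
    trans (t • h) u - u = ∫ s in (0 : ℝ)..t, trans (s • h) w := by
  have hcont : Continuous fun s : ℝ => trans (s • h) w :=
    (continuous_trans w).comp (by fun_prop)
  rw [← sub_eq_zero]
  apply Lp.ext
  have : ∀ᵐ x, (trans (t • h) u - u - ∫ s in (0 : ℝ)..t, trans (s • h) w :
      Lp ℂ 2 (volume : Measure (Space N))) x = 0 := by
    refine ae_eq_zero_of_integral_contDiff_smul_eq_zero
      ((Lp.memLp _).locallyIntegrable (by norm_num)) fun φ hφ hc => ?_
    have hφL : MemLp (fun x => (φ x : ℂ)) 2 (volume : Measure (Space N)) :=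
      (Complex.continuous_ofReal.comp hφ.continuous).memLp_of_hasCompactSupport
        (hc.comp_left (g := ((↑) : ℝ → ℂ)) Complex.ofReal_zero)
    have hpair : ∀ f : Lp ℂ 2 (volume : Measure (Space N)),
        ∫ x, φ x • f x = innerSL ℂ (hφL.toLp _) f := by
      intro f
      rw [innerSL_apply_apply, L2.inner_def]
      refine integral_congr_ae ?_
      filter_upwards [hφL.coeFn_toLp] with x hx
      rw [hx]
      simp [mul_comm]
    have htr : ∀ (s : ℝ) (f : Lp ℂ 2 (volume : Measure (Space N))),
        innerSL ℂ (hφL.toLp _) (trans (s • h) f) = ∫ x, φ x • f (x + s • h) := by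
      intro s f
      rw [← hpair]
      refine integral_congr_ae ?_
      filter_upwards [trans_coe (s • h) f] with x hx
      rw [hx]
    have hFTC : ∫ s in (0 : ℝ)..t, innerSL ℂ (hφL.toLp _) (trans (s • h) w)
        = innerSL ℂ (hφL.toLp _) (trans (t • h) u)
          - innerSL ℂ (hφL.toLp _) (trans ((0 : ℝ) • h) u) := by
      refine intervalIntegral.integral_eq_sub_of_hasDerivAt
        (f := fun s : ℝ => innerSL ℂ (hφL.toLp _) (trans (s • h) u)) (fun s _ => ?_)
        ((innerSL ℂ (hφL.toLp _)).continuous.comp hcont).continuousOn.intervalIntegrable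
      simp only [htr]
      exact hasDerivAt_integral_test (Lp.memLp u) H hφ hc s
    rw [hpair, map_sub, map_sub, ← ContinuousLinearMap.intervalIntegral_comp_comm _
      (hcont.continuousOn.intervalIntegrable), hFTC]
    simp [trans_zero]
  filter_upwards [this, Lp.coeFn_zero ℂ 2 (volume : Measure (Space N))] with x hx h0
  rw [hx, h0]; rfl

theorem hasDerivAt_trans_zero {h : Space N} {u w : Lp ℂ 2 (volume : Measure (Space N))}
    (H : IsWeakDeriv h u w) : HasDerivAt (fun t : ℝ => trans (t • h) u) w 0 := by
  have hcont : Continuous fun s : ℝ => trans (s • h) w :=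
    (continuous_trans w).comp (by fun_prop)
  have h1 := (intervalIntegral.integral_hasDerivAt_right (a := (0 : ℝ)) (b := 0)
    hcont.continuousOn.intervalIntegrable
    (hcont.stronglyMeasurableAtFilter _ _) hcont.continuousAt).add_const u
  have h2 : (fun t : ℝ => trans (t • h) u) = fun t => (∫ s in (0 : ℝ)..t, trans (s • h) w) + u := by
    funext t
    rw [← trans_sub_eq_integral H t, sub_add_cancel]
  rw [h2]
  simpa [trans_zero] using h1

/-- Translations are isometries, so the integrand in the previous formula has constant norm `‖w‖`.
This estimate is the source of both the Sobolev embedding and the compactness. -/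
theorem norm_trans_sub_le {h : Space N} {u w : Lp ℂ 2 (volume : Measure (Space N))}
    (H : IsWeakDeriv h u w) : ‖trans h u - u‖ ≤ ‖w‖ := by
  have h1 := trans_sub_eq_integral H 1
  rw [one_smul] at h1
  rw [h1]
  simpa using intervalIntegral.norm_integral_le_of_norm_le_const (a := (0 : ℝ)) (b := 1)
    (f := fun s => trans (s • h) w) (C := ‖w‖) (fun s _ => by simp)

/-! ### The quadratic energy and the bottom of the spectrum -/

theorem Lp_norm_sq_eq_integral {F : Type*} [NormedAddCommGroup F] [InnerProductSpace ℂ F]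
    (f : Lp F 2 (volume : Measure (Space N))) : ‖f‖ ^ 2 = ∫ x, ‖f x‖ ^ 2 := by
  have h1 : ((‖f‖ ^ 2 : ℝ) : ℂ) = ((∫ x, ‖f x‖ ^ 2 : ℝ) : ℂ) := by
    have h := inner_self_eq_norm_sq_to_K (𝕜 := ℂ) f
    rw [L2.inner_def] at h
    push_cast
    rw [show ((‖f‖ : ℝ) : ℂ) ^ 2 = _ from h.symm, ← integral_complex_ofReal]
    refine integral_congr_ae (Filter.Eventually.of_forall fun x => ?_)
    simp only [inner_self_eq_norm_sq_to_K (𝕜 := ℂ)]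
    push_cast
    rfl
  exact_mod_cast h1

theorem memLp_sigmaFn (u : SigmaSpace N) : MemLp (sigmaFn u) 2 volume := Lp.memLp _

theorem memLp_sigmaGrad (u : SigmaSpace N) : MemLp (sigmaGrad u) 2 volume := Lp.memLp _

theorem sigmaSpace_norm_sq (u : SigmaSpace N) :
    ‖u‖ ^ 2 = ‖u.1.fst‖ ^ 2 + (‖u.1.snd.fst‖ ^ 2 + ‖u.1.snd.snd‖ ^ 2) := by
  rw [Submodule.coe_norm, WithLp.prod_norm_sq_eq_of_L2, WithLp.prod_norm_sq_eq_of_L2]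

theorem quadEnergy_eq (lam : ℝ) (u : SigmaSpace N) :
    quadEnergy lam u = 1 / 2 * ‖u.1.snd.fst‖ ^ 2 + 1 / 2 * ‖u.1.snd.snd‖ ^ 2
      + lam / 2 * ‖u.1.fst‖ ^ 2 := by
  have h : ∫ x, ‖x‖ ^ 2 * ‖sigmaFn u x‖ ^ 2 = ∫ x, ‖u.1.snd.snd x‖ ^ 2 := by
    refine integral_congr_ae ?_
    filter_upwards [u.2.2] with x hx
    rw [hx]
    simp [sigmaFn, mul_pow]
  rw [quadEnergy, h, Lp_norm_sq_eq_integral, Lp_norm_sq_eq_integral, Lp_norm_sq_eq_integral]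
  rfl

theorem quadEnergy_eq_norm_sq (lam : ℝ) (u : SigmaSpace N) :
    quadEnergy lam u = 1 / 2 * ‖u‖ ^ 2 + (lam - 1) / 2 * ‖u.1.fst‖ ^ 2 := by
  rw [quadEnergy_eq, sigmaSpace_norm_sq]; ring

theorem memLp_coord_mul (u : SigmaSpace N) (i : Fin N) :
    MemLp (fun x => (x i : ℂ) * sigmaFn u x) 2 volume := by
  refine (Lp.memLp u.1.snd.snd).mono ?_ ?_
  · exact ((by fun_prop : Continuous fun x : Space N => (x i : ℂ)).aestronglyMeasurable).mul
      (memLp_sigmaFn u).1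
  · filter_upwards [u.2.2] with x hx
    rw [hx]
    simp only [norm_mul, Complex.norm_real, norm_norm]
    exact mul_le_mul_of_nonneg_right (PiLp.norm_apply_le x i) (norm_nonneg _)

theorem isWeakDeriv_sigmaFn (u : SigmaSpace N) (h : Space N) :
    IsWeakDeriv h (sigmaFn u) (fun x => ∑ i, (h i : ℂ) * sigmaGrad u x i) :=
  u.2.1.isWeakDeriv (memLp_sigmaFn u) (memLp_sigmaGrad u) h

theorem isWeakDeriv_single (u : SigmaSpace N) (i : Fin N) :
    IsWeakDeriv (EuclideanSpace.single i 1) (sigmaFn u) (fun x => sigmaGrad u x i) := by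
  intro φ hφ hc
  exact u.2.1 φ hφ hc i

/-- The commutator identity `[∂_i, x_i] = 1` in form sense. -/
theorem inner_coord_grad (u : SigmaSpace N) (i : Fin N) :
    2 * (inner ℂ ((memLp_coord_mul u i).toLp _) ((memLp_coord (memLp_sigmaGrad u) i).toLp _)).re
      = - ‖u.1.fst‖ ^ 2 := by
  set e : Space N := EuclideanSpace.single i 1 with he
  set U := u.1.fst with hU
  set V := (memLp_coord_mul u i).toLp _ with hV
  set G := (memLp_coord (memLp_sigmaGrad u) i).toLp _ with hG
  have hW : IsWeakDeriv e U G := by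
    intro φ hφ hc
    rw [he, hU]
    refine (isWeakDeriv_single u i φ hφ hc).trans ?_
    congr 1
    refine integral_congr_ae ?_
    filter_upwards [(memLp_coord (memLp_sigmaGrad u) i).coeFn_toLp] with x hx
    rw [hG, hx]
  have hd := hasDerivAt_trans_zero hW
  -- Multiplication by `x_i` commutes with translation by `t e_i` up to `t`. Differentiating this
  -- identity at `t = 0` gives the commutator relation without approximating `u` by smooth
  -- functions.
  have key : ∀ t : ℝ, inner ℂ V (trans (t • e) U)
      = inner ℂ (trans (-(t • e)) U) V - t * inner ℂ U (trans (t • e) U) := by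
    intro t
    have h1 : inner ℂ (trans (-(t • e)) U) V = inner ℂ U (trans (t • e) V) := by
      rw [inner_trans_left, neg_neg]
    rw [h1, ← inner_smul_right, ← inner_sub_right, L2.inner_def, L2.inner_def]
    refine integral_congr_ae ?_
    have h2 := (measurePreserving_add_right volume (t • e)).quasiMeasurePreserving.ae_eq_comp
      (memLp_coord_mul u i).coeFn_toLp
    filter_upwards [trans_coe (t • e) U, trans_coe (t • e) V,
      Lp.coeFn_sub (trans (t • e) V) ((t : ℂ) • trans (t • e) U),
      Lp.coeFn_smul (t : ℂ) (trans (t • e) U), h2, (memLp_coord_mul u i).coeFn_toLp]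
      with x h3 h4 h5 h6 h7 h8
    rw [h5, Pi.sub_apply, h6, Pi.smul_apply, h4, h3, hV, h8]
    simp only [Function.comp_def] at h7
    rw [h7]
    have h9 : (x + t • e) i = x i + t := by simp [he]
    rw [h9]
    simp only [RCLike.inner_apply, smul_eq_mul, sigmaFn, ← hU, map_mul, Complex.conj_ofReal]
    push_cast
    ring
  have hd1 : HasDerivAt (fun t : ℝ => inner ℂ V (trans (t • e) U)) (inner ℂ V G) 0 := by
    simpa using (hasDerivAt_const (0 : ℝ) V).inner ℂ hd
  have hneg : HasDerivAt (fun t : ℝ => trans (-(t • e)) U) (-G) 0 := by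
    have := HasDerivAt.scomp (x := (0 : ℝ)) (h := fun t : ℝ => -t) (h' := -1)
      (g₁ := fun t : ℝ => trans (t • e) U) (g₁' := G) (by simpa using hd)
      (hasDerivAt_neg (0 : ℝ))
    simpa [Function.comp_def] using this
  have hd2 : HasDerivAt (fun t : ℝ => inner ℂ (trans (-(t • e)) U) V) (-inner ℂ G V) 0 := by
    simpa using hneg.inner ℂ (hasDerivAt_const (0 : ℝ) V)
  have hd3 : HasDerivAt (fun t : ℝ => (t : ℂ) * inner ℂ U (trans (t • e) U)) (inner ℂ U U) 0 := by
    have h4 : HasDerivAt (fun t : ℝ => (inner ℂ U (trans (t • e) U) : ℂ)) (inner ℂ U G) 0 := by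
      simpa using (hasDerivAt_const (0 : ℝ) U).inner ℂ hd
    have h5 := (hasDerivAt_id (0 : ℝ)).ofReal_comp.mul h4
    simp only [id, Complex.ofReal_zero, zero_mul, add_zero, zero_smul, trans_zero,
      Complex.ofReal_one, one_mul] at h5
    exact h5
  have heq : (inner ℂ V G : ℂ) = -inner ℂ G V - inner ℂ U U := by
    refine hd1.unique ?_
    simp only [key]
    exact hd2.sub hd3
  have hre := congrArg Complex.re heq
  have h5 : (inner ℂ G V : ℂ).re = (inner ℂ V G : ℂ).re := inner_re_symm (𝕜 := ℂ) G V
  have h6 : (inner ℂ U U : ℂ).re = ‖U‖ ^ 2 := inner_self_eq_norm_sq (𝕜 := ℂ) U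
  rw [Complex.sub_re, Complex.neg_re, h5, h6] at hre
  linarith

theorem sum_norm_sq_coord_mul (u : SigmaSpace N) :
    ∑ i, ‖(memLp_coord_mul u i).toLp _‖ ^ 2 = ‖u.1.snd.snd‖ ^ 2 := by
  simp only [Lp_norm_sq_eq_integral]
  rw [← integral_finsetSum]
  · refine integral_congr_ae ?_
    have : ∀ᵐ x : Space N, ∀ i, (memLp_coord_mul u i).toLp _ x = (x i : ℂ) * sigmaFn u x :=
      ae_all_iff.2 fun i => (memLp_coord_mul u i).coeFn_toLp
    filter_upwards [this, u.2.2] with x hx hx'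
    rw [hx']
    simp only [hx, norm_mul, mul_pow, Complex.norm_real, norm_norm]
    rw [← Finset.sum_mul, EuclideanSpace.norm_sq_eq]
    rfl
  · exact fun i _ => (Lp.memLp _).integrable_norm_pow (by norm_num)

theorem sum_norm_sq_grad (u : SigmaSpace N) :
    ∑ i, ‖(memLp_coord (memLp_sigmaGrad u) i).toLp _‖ ^ 2 = ‖u.1.snd.fst‖ ^ 2 := by
  simp only [Lp_norm_sq_eq_integral]
  rw [← integral_finsetSum]
  · refine integral_congr_ae ?_
    have : ∀ᵐ x : Space N, ∀ i,
        (memLp_coord (memLp_sigmaGrad u) i).toLp _ x = sigmaGrad u x i :=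
      ae_all_iff.2 fun i => (memLp_coord (memLp_sigmaGrad u) i).coeFn_toLp
    filter_upwards [this] with x hx
    simp only [hx]
    rw [EuclideanSpace.norm_sq_eq]
    rfl
  · exact fun i _ => (Lp.memLp _).integrable_norm_pow (by norm_num)

/-- The harmonic oscillator is bounded below by its first eigenvalue `N`. -/
theorem spectral_bound (u : SigmaSpace N) :
    N * ‖u.1.fst‖ ^ 2 ≤ ‖u.1.snd.fst‖ ^ 2 + ‖u.1.snd.snd‖ ^ 2 := by
  rw [← sum_norm_sq_grad, ← sum_norm_sq_coord_mul, ← Finset.sum_add_distrib]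
  have h : ∀ i ∈ Finset.univ, ‖u.1.fst‖ ^ 2 ≤ ‖(memLp_coord (memLp_sigmaGrad u) i).toLp _‖ ^ 2
      + ‖(memLp_coord_mul u i).toLp _‖ ^ 2 := by
    intro i _
    have h1 := inner_coord_grad u i
    set V := (memLp_coord_mul u i).toLp _
    set G := (memLp_coord (memLp_sigmaGrad u) i).toLp _
    have h2 : |(inner ℂ V G : ℂ).re| ≤ ‖V‖ * ‖G‖ :=
      (Complex.abs_re_le_norm _).trans (norm_inner_le_norm V G)
    -- `‖u‖² = -2 Re⟨V, G⟩ ≤ 2‖V‖‖G‖ ≤ ‖V‖² + ‖G‖²` in each of the `N` directions.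
    nlinarith [sq_nonneg (‖V‖ - ‖G‖), neg_abs_le (inner ℂ V G : ℂ).re]
  simpa using Finset.sum_le_sum h

/-- A function with `∇u = -x u` saturates the spectral bound. -/
theorem spectral_eq (u : SigmaSpace N)
    (h : ∀ᵐ x : Space N, ∀ i, sigmaGrad u x i = -((x i : ℂ) * sigmaFn u x)) :
    ‖u.1.snd.fst‖ ^ 2 + ‖u.1.snd.snd‖ ^ 2 = N * ‖u.1.fst‖ ^ 2 := by
  rw [← sum_norm_sq_grad, ← sum_norm_sq_coord_mul, ← Finset.sum_add_distrib]
  have h : ∀ i ∈ Finset.univ, ‖(memLp_coord (memLp_sigmaGrad u) i).toLp _‖ ^ 2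
      + ‖(memLp_coord_mul u i).toLp _‖ ^ 2 = ‖u.1.fst‖ ^ 2 := by
    intro i _
    have h1 := inner_coord_grad u i
    -- With `∂_i u = -x_i u` the commutator identity reads `2‖x_i u‖² = ‖u‖²`, and the two terms of
    -- the sum are equal.
    have h2 : (memLp_coord (memLp_sigmaGrad u) i).toLp _ = -(memLp_coord_mul u i).toLp _ := by
      rw [← MemLp.toLp_neg]
      refine MemLp.toLp_congr _ _ ?_
      filter_upwards [h] with x hx
      simp [hx i]
    rw [h2] at h1 ⊢
    have h6 := inner_self_eq_norm_sq (𝕜 := ℂ) ((memLp_coord_mul u i).toLp _)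
    rw [inner_neg_right, Complex.neg_re] at h1
    rw [norm_neg]
    change (inner ℂ _ _ : ℂ).re = _ at h6
    linarith
  rw [Finset.sum_congr rfl h]
  simp

/-! ### Completeness of `Σ` -/

/-- The element of `Σ` given by a function with its weak gradient. -/
def mkSigma (u : Space N → ℂ) (g : Space N → Grad N) (hu : MemLp u 2 volume)
    (hg : MemLp g 2 volume) (hx : MemLp (fun x => (‖x‖ : ℂ) * u x) 2 volume)
    (H : IsWeakGradient u g) : SigmaSpace N :=
  ⟨WithLp.toLp 2 (hu.toLp u, WithLp.toLp 2 (hg.toLp g, hx.toLp _)),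
    H.congr hu.coeFn_toLp.symm hg.coeFn_toLp.symm, by
      filter_upwards [hu.coeFn_toLp, hx.coeFn_toLp] with x h1 h2
      change hx.toLp _ x = _ * hu.toLp u x
      rw [h2, h1]⟩

theorem continuous_integral_test_smul {ψ : Space N → ℝ} (hψ : Continuous ψ)
    (hc : HasCompactSupport ψ) :
    Continuous fun f : Lp ℂ 2 (volume : Measure (Space N)) => ∫ x, ψ x • f x := by
  have hψL : MemLp (fun x => (ψ x : ℂ)) 2 (volume : Measure (Space N)) :=
    (Complex.continuous_ofReal.comp hψ).memLp_of_hasCompactSupport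
      (hc.comp_left (g := ((↑) : ℝ → ℂ)) Complex.ofReal_zero)
  refine (innerSL ℂ (hψL.toLp _)).continuous.congr fun f => ?_
  rw [innerSL_apply_apply, L2.inner_def]
  refine integral_congr_ae ?_
  filter_upwards [hψL.coeFn_toLp] with x hx
  rw [hx]
  simp [mul_comm]

/-- Both defining conditions, the almost everywhere one included, are equivalent to families of
equations between integrals against test functions, and each side is continuous in the triple. -/
theorem isClosed_sigmaSpace : IsClosed (SigmaSpace N : Set (Triple N)) := by
  have hfst : Continuous fun z : Triple N => z.fst := WithLp.continuous_fst _ _ _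
  have hsnd : Continuous fun z : Triple N => z.snd := WithLp.continuous_snd _ _ _
  have hg : Continuous fun z : Triple N => z.snd.fst := (WithLp.continuous_fst _ _ _).comp hsnd
  have hw : Continuous fun z : Triple N => z.snd.snd := (WithLp.continuous_snd _ _ _).comp hsnd
  have heq : (SigmaSpace N : Set (Triple N)) =
      (⋂ (φ : Space N → ℝ) (_ : ContDiff ℝ ∞ φ) (_ : HasCompactSupport φ) (i : Fin N),
        {z | ∫ x, fderiv ℝ φ x (EuclideanSpace.single i 1) • z.fst x
          = - ∫ x, φ x • (EuclideanSpace.proj (𝕜 := ℂ) i).compLp z.snd.fst x}) ∩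
      ⋂ (φ : Space N → ℝ) (_ : ContDiff ℝ ∞ φ) (_ : HasCompactSupport φ),
        {z | ∫ x, φ x • z.snd.snd x = ∫ x, (φ x * ‖x‖) • z.fst x} := by
    ext z
    simp only [Set.mem_inter_iff, Set.mem_iInter, Set.mem_ofPred_eq]
    refine and_congr ?_ ?_
    · refine forall_congr' fun φ => forall_congr' fun hφ => forall_congr' fun hc =>
        forall_congr' fun i => ?_
      have : ∫ x, φ x • (EuclideanSpace.proj (𝕜 := ℂ) i).compLp z.snd.fst x
          = ∫ x, φ x • z.snd.fst x i := by
        refine integral_congr_ae ?_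
        filter_upwards [(EuclideanSpace.proj (𝕜 := ℂ) i).coeFn_compLp z.snd.fst] with x hx
        rw [hx]; rfl
      rw [this]
    · constructor
      · intro h φ _ _
        refine integral_congr_ae ?_
        filter_upwards [h] with x hx
        rw [hx]
        simp [mul_assoc]
      · intro h
        refine ae_eq_of_integral_contDiff_smul_eq
          ((Lp.memLp _).locallyIntegrable (by norm_num)) ?_ fun φ hφ hc => ?_
        · have h1 : LocallyIntegrable z.fst :=
            (Lp.memLp z.fst).locallyIntegrable (by norm_num)
          rw [← locallyIntegrableOn_univ] at h1 ⊢
          exact LocallyIntegrableOn.continuousOn_mul (f := z.fst)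
            (g := fun x : Space N => (‖x‖ : ℂ)) h1 (by fun_prop) isOpen_univ.isLocallyClosed
        · rw [h φ hφ hc]
          simp [mul_assoc]
  rw [heq]
  refine IsClosed.inter ?_ ?_
  · refine isClosed_iInter fun φ => isClosed_iInter fun hφ => isClosed_iInter fun hc =>
      isClosed_iInter fun i => isClosed_eq ?_ ?_
    · exact (continuous_integral_test_smul (continuous_partial hφ _)
        (hc.fderiv_apply ℝ _)).comp hfst
    · exact ((continuous_integral_test_smul hφ.continuous hc).comp
        (((EuclideanSpace.proj (𝕜 := ℂ) i).compLpL 2 volume).continuous.comp hg)).neg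
  · refine isClosed_iInter fun φ => isClosed_iInter fun hφ => isClosed_iInter fun hc =>
      isClosed_eq ?_ ?_
    · exact (continuous_integral_test_smul hφ.continuous hc).comp hw
    · exact (continuous_integral_test_smul (hφ.continuous.mul continuous_norm)
        hc.mul_right).comp hfst

instance : CompleteSpace (SigmaSpace N) := isClosed_sigmaSpace.completeSpace_coe

/-! ### Averages over cubes -/

theorem eLpNorm_two_sq {α F : Type*} [MeasurableSpace α] {μ : Measure α} [NormedAddCommGroup F]
    (f : α → F) : eLpNorm f 2 μ ^ 2 = ∫⁻ x, ‖f x‖ₑ ^ 2 ∂μ := by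
  have h := eLpNorm_nnreal_pow_eq_lintegral (μ := μ) (f := f) (p := 2) (by norm_num)
  simpa using h

/-- Jensen: `z` minus the mean of `f` is the mean of `z - f`, and on a probability space the `L¹`
norm is at most the `L²` norm. -/
theorem enorm_sub_integral_sq_le {α : Type*} [MeasurableSpace α] {ν : Measure α}
    [IsProbabilityMeasure ν] {f : α → ℂ} (hf : Integrable f ν) (z : ℂ) :
    ‖z - ∫ y, f y ∂ν‖ₑ ^ 2 ≤ ∫⁻ y, ‖z - f y‖ₑ ^ 2 ∂ν := by
  have h1 : z - ∫ y, f y ∂ν = ∫ y, (z - f y) ∂ν := by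
    rw [integral_sub (integrable_const z) hf]; simp
  rw [h1, ← eLpNorm_two_sq (fun y => z - f y)]
  gcongr
  calc ‖∫ y, (z - f y) ∂ν‖ₑ ≤ eLpNorm (fun y => z - f y) 1 ν := by
        rw [eLpNorm_one_eq_lintegral_enorm]; exact enorm_integral_le_lintegral_enorm _
    _ ≤ eLpNorm (fun y => z - f y) 2 ν :=
        eLpNorm_le_eLpNorm_of_exponent_le (by norm_num)
          ((integrable_const z).sub hf).aestronglyMeasurable

/-- The index of the cube of the grid `s ℤ^N` containing `x`. -/
def cellIndex (s : ℝ) (x : Space N) : Fin N → ℤ := fun i => ⌊x i / s⌋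

/-- The cube of the grid `s ℤ^N` with index `j`. -/
def cell (s : ℝ) (j : Fin N → ℤ) : Set (Space N) := cellIndex s ⁻¹' {j}

theorem mem_cell_self (s : ℝ) (x : Space N) : x ∈ cell s (cellIndex s x) := rfl

theorem measurable_cellIndex (s : ℝ) : Measurable (cellIndex s : Space N → Fin N → ℤ) := by
  refine measurable_pi_iff.2 fun i => ?_
  exact Int.measurable_floor.comp (by fun_prop)

theorem measurableSet_cell (s : ℝ) (j : Fin N → ℤ) : MeasurableSet (cell s j) :=
  measurable_cellIndex s (measurableSet_singleton j)

theorem volume_ofLp_preimage_pi (S : Fin N → Set ℝ) (hS : ∀ i, MeasurableSet (S i)) :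
    volume {x : Space N | ∀ i, x i ∈ S i} = ∏ i, volume (S i) := by
  rw [← volume_pi_pi, ← (PiLp.volume_preserving_ofLp (Fin N)).measure_preimage
    (MeasurableSet.univ_pi hS).nullMeasurableSet]
  congr 1
  ext x
  simp

theorem volume_cell {s : ℝ} (hs : 0 < s) (j : Fin N → ℤ) :
    volume (cell s j) = ENNReal.ofReal s ^ N := by
  have h : cell s j = {x : Space N | ∀ i, x i ∈ Set.Ico (j i * s) ((j i + 1) * s)} := by
    ext x
    simp only [cell, cellIndex, Set.mem_preimage, Set.mem_singleton_iff, funext_iff,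
      Int.floor_eq_iff, le_div_iff₀ hs, div_lt_iff₀ hs, Set.mem_ofPred_eq, Set.mem_Ico]
  rw [h, volume_ofLp_preimage_pi _ fun _ => measurableSet_Ico]
  simp only [Real.volume_Ico]
  rw [Finset.prod_congr rfl fun i _ => by rw [show (j i + 1) * s - j i * s = s by ring]]
  simp

theorem abs_sub_le_of_cellIndex_eq {s : ℝ} (hs : 0 < s) {x y : Space N}
    (h : cellIndex s x = cellIndex s y) (i : Fin N) : |x i - y i| ≤ s := by
  have h1 := Int.abs_sub_lt_one_of_floor_eq_floor (congrFun h i)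
  rw [← sub_div, abs_div, abs_of_pos hs, div_lt_one hs] at h1
  exact h1.le

theorem cellIndex_eq_of_half {s : ℝ} {x y : Space N}
    (h : cellIndex (s / 2) x = cellIndex (s / 2) y) : cellIndex s x = cellIndex s y := by
  funext i
  have h1 : ∀ z : Space N, cellIndex s z i = cellIndex (s / 2) z i / (2 : ℕ) := fun z => by
    rw [cellIndex, cellIndex, ← Int.floor_div_natCast]
    congr 1
    push_cast
    rw [div_div, div_mul_cancel₀ _ two_ne_zero]
  rw [h1, h1, h]

/-- The average of `u` over the cube containing `x`. -/
def cellAvg (s : ℝ) (u : Space N → ℂ) (x : Space N) : ℂ :=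
  ⨍ y in cell s (cellIndex s x), u y

theorem measurable_cellAvg (s : ℝ) (u : Space N → ℂ) : Measurable (cellAvg s u) :=
  (Measurable.of_discrete (f := fun j : Fin N → ℤ => ⨍ y in cell s j, u y)).comp
    (measurable_cellIndex s)

theorem cellAvg_congr {s : ℝ} (u : Space N → ℂ) {x y : Space N}
    (h : cellIndex s x = cellIndex s y) : cellAvg s u x = cellAvg s u y := by
  rw [cellAvg, cellAvg, h]

theorem integrableOn_cell {s : ℝ} (hs : 0 < s) {u : Space N → ℂ} (hu : MemLp u 2 volume)
    (j : Fin N → ℤ) : IntegrableOn u (cell s j) := by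
  have : IsFiniteMeasure (volume.restrict (cell s j)) :=
    ⟨by rw [Measure.restrict_apply_univ, volume_cell hs]; exact ENNReal.pow_lt_top (by simp)⟩
  exact (hu.restrict _).integrable (by norm_num)

theorem enorm_sub_cellAvg_sq_le {s : ℝ} (hs : 0 < s) {u : Space N → ℂ} (hu : MemLp u 2 volume)
    (x : Space N) : ‖u x - cellAvg s u x‖ₑ ^ 2 ≤
      (ENNReal.ofReal s ^ N)⁻¹ * ∫⁻ y in cell s (cellIndex s x), ‖u x - u y‖ₑ ^ 2 := by
  set S := cell s (cellIndex s x)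
  have hv : volume S = ENNReal.ofReal s ^ N := volume_cell hs _
  have h0 : volume S ≠ 0 := by rw [hv]; exact pow_ne_zero _ (by simpa using hs)
  have ht : volume S ≠ ⊤ := by rw [hv]; exact ENNReal.pow_ne_top (by simp)
  have : NeZero (volume.restrict S) := ⟨by rwa [Ne, Measure.restrict_eq_zero]⟩
  have : IsFiniteMeasure (volume.restrict S) :=
    ⟨by rw [Measure.restrict_apply_univ]; exact ht.lt_top⟩
  have h := enorm_sub_integral_sq_le (ν := (volume.restrict S Set.univ)⁻¹ • volume.restrict S)
    ((integrableOn_cell hs hu (cellIndex s x)).smul_measure (by simpa using h0)) (u x)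
  rw [lintegral_smul_measure, Measure.restrict_apply_univ, hv] at h
  rw [cellAvg, average, Measure.restrict_apply_univ, hv]
  exact h

/-- A Poincaré inequality from translations alone. Two points of one cube differ by some `h ∈ [-s,
s]^N`, so after Jensen and Tonelli only translates by such `h` occur. The constant `2^N` is the
volume of `[-s, s]^N` divided by that of a cube. -/
theorem lintegral_sub_cellAvg_le {s : ℝ} (hs : 0 < s) {u : Space N → ℂ}
    (hm : StronglyMeasurable u) (hu : MemLp u 2 volume) {D : ℝ≥0∞}
    (hD : ∀ h : Space N, (∀ i, |h i| ≤ s) → ∫⁻ x, ‖u (x + h) - u x‖ₑ ^ 2 ≤ D) :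
    ∫⁻ x, ‖u x - cellAvg s u x‖ₑ ^ 2 ≤ 2 ^ N * D := by
  set B : Set (Space N) := {h | ∀ i, h i ∈ Set.Icc (-s) s} with hB
  have hBm : MeasurableSet B := by
    have : B = ⋂ i, (fun h : Space N => h i) ⁻¹' Set.Icc (-s) s := by ext; simp [hB]
    rw [this]
    exact MeasurableSet.iInter fun i => measurableSet_Icc.preimage (by fun_prop)
  have hBv : volume B = ENNReal.ofReal (2 * s) ^ N := by
    rw [hB, volume_ofLp_preimage_pi _ fun _ => measurableSet_Icc]
    simp [two_mul]
  have hmu := hm.measurable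
  have h1 : ∀ x, ∫⁻ y in cell s (cellIndex s x), ‖u x - u y‖ₑ ^ 2
      ≤ ∫⁻ h in B, ‖u (x + h) - u x‖ₑ ^ 2 := by
    intro x
    rw [← lintegral_indicator (measurableSet_cell _ _), ← lintegral_indicator hBm,
      ← lintegral_add_left_eq_self _ x]
    refine lintegral_mono fun h => ?_
    by_cases hh : x + h ∈ cell s (cellIndex s x)
    · have hb : h ∈ B := fun i => by
        have := abs_sub_le_of_cellIndex_eq hs (x := x + h) (y := x) hh i
        simpa [abs_le] using this
      rw [Set.indicator_of_mem hh, Set.indicator_of_mem hb, ← enorm_neg, neg_sub]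
    · rw [Set.indicator_of_notMem hh]; exact zero_le
  calc ∫⁻ x, ‖u x - cellAvg s u x‖ₑ ^ 2
      ≤ ∫⁻ x, (ENNReal.ofReal s ^ N)⁻¹ * ∫⁻ h in B, ‖u (x + h) - u x‖ₑ ^ 2 :=
        lintegral_mono fun x => (enorm_sub_cellAvg_sq_le hs hu x).trans (mul_le_mul_right (h1 x) _)
    _ = (ENNReal.ofReal s ^ N)⁻¹ * ∫⁻ h in B, ∫⁻ x, ‖u (x + h) - u x‖ₑ ^ 2 := by
        rw [lintegral_const_mul' _ _ (by simpa using fun h => absurd h (not_le.2 hs)),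
          lintegral_lintegral_swap]
        exact Measurable.aemeasurable (by fun_prop)
    _ ≤ (ENNReal.ofReal s ^ N)⁻¹ * ∫⁻ h in B, D := by
        gcongr 1
        refine setLIntegral_mono' hBm fun h hh => hD h fun i => ?_
        simpa [abs_le] using hh i
    _ = 2 ^ N * D := by
        rw [setLIntegral_const, hBv, ENNReal.ofReal_mul (by norm_num), mul_pow]
        rw [show (ENNReal.ofReal s ^ N)⁻¹ * (D * (ENNReal.ofReal 2 ^ N * ENNReal.ofReal s ^ N))
          = ((ENNReal.ofReal s ^ N)⁻¹ * ENNReal.ofReal s ^ N) * (ENNReal.ofReal 2 ^ N * D) by ring]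
        rw [ENNReal.inv_mul_cancel (pow_ne_zero _ (by simpa using hs))
          (ENNReal.pow_ne_top (by simp)), one_mul]
        simp

/-! ### Inverse inequality and subcritical Sobolev embedding -/

/-- The cube of `x` alone, of volume `s^N`, contributes `‖f x‖² s^N` to the squared `L²` norm. -/
theorem enorm_le_of_cellwise {s : ℝ} (hs : 0 < s) {f : Space N → ℂ}
    (hf : ∀ x y, cellIndex s x = cellIndex s y → f x = f y) (x : Space N) :
    ‖f x‖ₑ ≤ ENNReal.ofReal s ^ (-(N / 2 : ℝ)) * eLpNorm f 2 volume := by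
  have h1 : ‖f x‖ₑ ^ 2 * ENNReal.ofReal s ^ N ≤ eLpNorm f 2 volume ^ 2 := by
    rw [eLpNorm_two_sq, ← volume_cell hs (cellIndex s x), ← setLIntegral_const]
    refine (setLIntegral_mono' (measurableSet_cell _ _) fun y hy => ?_).trans
      (setLIntegral_le_lintegral _ _)
    rw [hf x y (show cellIndex s y = _ from hy).symm]
  have hs0 : ENNReal.ofReal s ≠ 0 := by simpa using hs
  have h2 : (ENNReal.ofReal s ^ (-(N / 2 : ℝ))) ^ 2 = (ENNReal.ofReal s ^ N)⁻¹ := by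
    rw [← ENNReal.rpow_natCast, ← ENNReal.rpow_mul, ← ENNReal.rpow_natCast, ← ENNReal.rpow_neg]
    congr 1
    push_cast
    ring
  refine (ENNReal.pow_le_pow_left_iff two_ne_zero).1 ?_
  rw [mul_pow, h2, mul_comm]
  rw [← div_eq_mul_inv, ENNReal.le_div_iff_mul_le (Or.inl (pow_ne_zero _ hs0))
    (Or.inl (ENNReal.pow_ne_top (by simp)))]
  exact h1

/-- Inverse inequality: `|f|^r ≤ (sup |f|)^{r-2} |f|²`, with the sup bound for functions constant on
cubes. -/
theorem eLpNorm_le_of_cellwise {s : ℝ} (hs : 0 < s) {f : Space N → ℂ} (hfm : Measurable f)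
    (hf : ∀ x y, cellIndex s x = cellIndex s y → f x = f y) {r : ℝ} (hr : 2 < r) :
    eLpNorm f (ENNReal.ofReal r) volume
      ≤ ENNReal.ofReal s ^ (-(N * (1 / 2 - 1 / r) : ℝ)) * eLpNorm f 2 volume := by
  have hr0 : 0 < r := by linarith
  set X := eLpNorm f 2 volume with hX
  set c := ENNReal.ofReal s ^ (-(N / 2 : ℝ)) with hc
  have h1 : ∫⁻ x, ‖f x‖ₑ ^ r ≤ (c * X) ^ (r - 2) * X ^ (2 : ℝ) := by
    rw [ENNReal.rpow_ofNat, hX, eLpNorm_two_sq, ← lintegral_const_mul _ (by fun_prop)]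
    refine lintegral_mono fun x => ?_
    calc ‖f x‖ₑ ^ r = ‖f x‖ₑ ^ (r - 2) * ‖f x‖ₑ ^ (2 : ℝ) := by
          rw [← ENNReal.rpow_add_of_nonneg _ _ (by linarith) (by norm_num)]; congr 1; ring
      _ ≤ _ := by
          rw [ENNReal.rpow_ofNat]
          exact mul_le_mul_left (ENNReal.rpow_le_rpow (enorm_le_of_cellwise hs hf x)
            (by linarith)) _
  rw [eLpNorm_eq_lintegral_rpow_enorm_toReal (by simpa using hr0) (by simp),
    ENNReal.toReal_ofReal hr0.le]
  calc (∫⁻ x, ‖f x‖ₑ ^ r) ^ (1 / r) ≤ ((c * X) ^ (r - 2) * X ^ (2 : ℝ)) ^ (1 / r) := by gcongr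
    _ = c ^ ((r - 2) * (1 / r)) * (X ^ ((r - 2) * (1 / r)) * X ^ (2 * (1 / r))) := by
        rw [ENNReal.mul_rpow_of_nonneg _ _ (by positivity), ← ENNReal.rpow_mul, ← ENNReal.rpow_mul,
          ENNReal.mul_rpow_of_nonneg _ _ (mul_nonneg (by linarith) (by positivity)), mul_assoc]
    _ = _ := by
        rw [← ENNReal.rpow_add_of_nonneg _ _ (mul_nonneg (by linarith) (by positivity))
          (by positivity), hc, ← ENNReal.rpow_mul]
        rw [show (r - 2) * (1 / r) + 2 * (1 / r) = 1 by field_simp; ring, ENNReal.rpow_one]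
        congr 2
        field_simp

/-- Hölder, with the two weights of sum 1 for which `r` is the corresponding mean of `2` and `r'`.
-/
theorem lintegral_rpow_interpolate {f : Space N → ℂ} (hf : AEStronglyMeasurable f volume)
    {r r' : ℝ} (hr : 2 < r) (hr' : r < r') :
    ∫⁻ x, ‖f x‖ₑ ^ r ≤ (∫⁻ x, ‖f x‖ₑ ^ (2 : ℝ)) ^ ((r' - r) / (r' - 2))
      * (∫⁻ x, ‖f x‖ₑ ^ r') ^ ((r - 2) / (r' - 2)) := by
  have h2 : 0 < r' - 2 := by linarith
  have ha : 0 ≤ (r' - r) / (r' - 2) := div_nonneg (by linarith) h2.le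
  have hb : 0 ≤ (r - 2) / (r' - 2) := div_nonneg (by linarith) h2.le
  refine le_trans (le_of_eq ?_) (ENNReal.lintegral_mul_norm_pow_le (hf.enorm.pow_const _)
    (hf.enorm.pow_const _) ha hb (by field_simp; ring))
  refine lintegral_congr fun x => ?_
  rw [← ENNReal.rpow_mul, ← ENNReal.rpow_mul, ← ENNReal.rpow_add_of_nonneg _ _
    (mul_nonneg (by norm_num) ha) (mul_nonneg (by linarith) hb)]
  congr 1
  field_simp
  ring

theorem norm_trans_sigma_sub_le (u : SigmaSpace N) {s : ℝ} (h : Space N)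
    (hh : ∀ i, |h i| ≤ s) : ‖trans h u.1.fst - u.1.fst‖ ≤ N * s * ‖u‖ := by
  set G : Fin N → Lp ℂ 2 (volume : Measure (Space N)) :=
    fun i => (memLp_coord (memLp_sigmaGrad u) i).toLp _ with hG
  have hGle : ∀ i, ‖G i‖ ≤ ‖u‖ := fun i => by
    have h1 : ‖G i‖ ^ 2 ≤ ∑ i, ‖G i‖ ^ 2 :=
      Finset.single_le_sum (f := fun i => ‖G i‖ ^ 2) (fun _ _ => sq_nonneg _) (Finset.mem_univ i)
    rw [sum_norm_sq_grad] at h1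
    have h2 := sigmaSpace_norm_sq u
    refine (sq_le_sq₀ (norm_nonneg _) (norm_nonneg _)).1
      (by nlinarith [sq_nonneg ‖u.1.fst‖, sq_nonneg ‖u.1.snd.snd‖])
  have hw : IsWeakDeriv h u.1.fst (∑ i, (h i : ℂ) • G i : Lp ℂ 2 (volume : Measure (Space N))) := by
    intro φ hφ hc
    refine (isWeakDeriv_sigmaFn u h φ hφ hc).trans ?_
    congr 1
    refine integral_congr_ae ?_
    have h1 : ∀ᵐ x : Space N, ∀ i, ((h i : ℂ) • G i : Lp ℂ 2 (volume : Measure (Space N))) x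
        = (h i : ℂ) * sigmaGrad u x i := by
      refine ae_all_iff.2 fun i => ?_
      filter_upwards [Lp.coeFn_smul (h i : ℂ) (G i),
        (memLp_coord (memLp_sigmaGrad u) i).coeFn_toLp] with x h3 h4
      rw [h3, Pi.smul_apply, hG, h4, smul_eq_mul]
    filter_upwards [h1, Lp.coeFn_finsetSum Finset.univ fun i => (h i : ℂ) • G i] with x h5 h6
    rw [h6, Finset.sum_apply, Finset.sum_congr rfl fun i _ => h5 i]
  refine (norm_trans_sub_le hw).trans ?_
  calc ‖∑ i, (h i : ℂ) • G i‖ ≤ ∑ i, ‖(h i : ℂ) • G i‖ := norm_sum_le _ _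
    _ ≤ ∑ _i : Fin N, s * ‖u‖ := by
        refine Finset.sum_le_sum fun i _ => ?_
        rw [norm_smul, Complex.norm_real]
        exact mul_le_mul (hh i) (hGle i) (norm_nonneg _) ((abs_nonneg _).trans (hh i))
    _ = N * s * ‖u‖ := by simp [mul_assoc]

theorem eLpNorm_sub_cellAvg_le (u : SigmaSpace N) {s : ℝ} (hs : 0 < s) :
    eLpNorm (sigmaFn u - cellAvg s (sigmaFn u)) 2 volume
      ≤ ENNReal.ofReal (2 ^ N * N * s * ‖u‖) := by
  have h := lintegral_sub_cellAvg_le hs (Lp.stronglyMeasurable u.1.fst) (memLp_sigmaFn u)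
    (D := ENNReal.ofReal (N * s * ‖u‖) ^ 2) fun h hh => by
      have h1 := norm_trans_sigma_sub_le u h hh
      rw [← eLpNorm_two_sq fun x => u.1.fst (x + h) - u.1.fst x]
      gcongr
      have h2 : eLpNorm (fun x => u.1.fst (x + h) - u.1.fst x) 2 volume
          = ‖trans h u.1.fst - u.1.fst‖ₑ := by
        rw [Lp.enorm_def]
        refine eLpNorm_congr_ae ?_
        filter_upwards [Lp.coeFn_sub (trans h u.1.fst) u.1.fst, trans_coe h u.1.fst] with x h3 h4
        rw [h3, Pi.sub_apply, h4]
      rw [h2, ← ofReal_norm]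
      exact ENNReal.ofReal_le_ofReal h1
  refine (ENNReal.pow_le_pow_left_iff two_ne_zero).1 ?_
  rw [eLpNorm_two_sq]
  refine h.trans ?_
  -- The square root of the Poincaré constant `2^N` is bounded crudely by `2^N`.
  have h1 : (2 : ℝ≥0∞) ^ N ≤ ENNReal.ofReal (2 ^ N) ^ 2 := by
    rw [ENNReal.ofReal_pow (by norm_num), ENNReal.ofReal_ofNat]
    have h1 : (1 : ℝ≥0∞) ≤ 2 ^ N := one_le_pow₀ (by norm_num)
    exact le_self_pow₀ h1 two_ne_zero
  rw [show 2 ^ N * N * s * ‖u‖ = 2 ^ N * (N * s * ‖u‖) by ring,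
    ENNReal.ofReal_mul (p := 2 ^ N) (by positivity), mul_pow]
  exact mul_le_mul' h1 le_rfl

theorem enorm_fst_le (u : SigmaSpace N) :
    eLpNorm (sigmaFn u) 2 volume ≤ ENNReal.ofReal ‖u‖ := by
  have h1 : ‖u.1.fst‖ ≤ ‖u‖ := (sq_le_sq₀ (norm_nonneg _) (norm_nonneg _)).1 (by
    nlinarith [sigmaSpace_norm_sq u, sq_nonneg ‖u.1.snd.fst‖, sq_nonneg ‖u.1.snd.snd‖])
  rw [show eLpNorm (sigmaFn u) 2 volume = ‖u.1.fst‖ₑ from (Lp.enorm_def _).symm, ← ofReal_norm]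
  exact ENNReal.ofReal_le_ofReal h1

theorem enorm_weight_le (u : SigmaSpace N) :
    eLpNorm (fun x => (‖x‖ : ℂ) * sigmaFn u x) 2 volume ≤ ENNReal.ofReal ‖u‖ := by
  have h1 : ‖u.1.snd.snd‖ ≤ ‖u‖ := (sq_le_sq₀ (norm_nonneg _) (norm_nonneg _)).1 (by
    nlinarith [sigmaSpace_norm_sq u, sq_nonneg ‖u.1.snd.fst‖, sq_nonneg ‖u.1.fst‖])
  have h2 : eLpNorm (fun x => (‖x‖ : ℂ) * sigmaFn u x) 2 volume = ‖u.1.snd.snd‖ₑ := by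
    rw [Lp.enorm_def]
    exact eLpNorm_congr_ae (Filter.EventuallyEq.symm u.2.2)
  rw [h2, ← ofReal_norm]
  exact ENNReal.ofReal_le_ofReal h1

/-- Convergence in `L²` gives an almost everywhere convergent subsequence, to which Fatou applies.
-/
theorem eLpNorm_le_of_tendsto_eLpNorm_sub {f : ℕ → Space N → ℂ} {g : Space N → ℂ}
    (hf : ∀ n, AEStronglyMeasurable (f n) volume) (hg : AEStronglyMeasurable g volume)
    (hlim : Filter.Tendsto (fun n => eLpNorm (f n - g) 2 volume) Filter.atTop (nhds 0))
    {r B : ℝ≥0∞} (hB : ∀ n, eLpNorm (f n) r volume ≤ B) : eLpNorm g r volume ≤ B := by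
  obtain ⟨ns, -, hns⟩ :=
    (tendstoInMeasure_of_tendsto_eLpNorm (by norm_num) hf hg hlim).exists_seq_tendsto_ae
  refine (Lp.eLpNorm_lim_le_liminf_eLpNorm (fun n => hf (ns n)) _ hns).trans ?_
  refine (Filter.liminf_le_liminf (Filter.Eventually.of_forall fun n => hB (ns n))).trans ?_
  simp

set_option maxHeartbeats 1000000 in
/-- The subcritical Sobolev embedding. -/
theorem sobolev_embedding {r : ℝ} (hr : 2 < r) (hrN : N * (1 / 2 - 1 / r) < 1) :
    ∃ C : ℝ, 0 ≤ C ∧ ∀ u : SigmaSpace N,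
      eLpNorm (sigmaFn u) (ENNReal.ofReal r) volume ≤ ENNReal.ofReal (C * ‖u‖) := by
  have hr1 : 1 ≤ ENNReal.ofReal r := by
    rw [← ENNReal.ofReal_one]; exact ENNReal.ofReal_le_ofReal (by linarith)
  set a : ℝ := N * (1 / 2 - 1 / r) with ha
  set K : ℝ := 2 ^ N * N with hK
  have hK0 : 0 ≤ K := by positivity
  -- Halving the cubes costs a factor `b = 2^a` in the inverse inequality and gains `1/2` in the
  -- Poincaré error. Subcriticality is `a < 1`, which makes the ratio `ρ = b/2` of the telescoping
  -- series less than 1.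
  set b : ℝ := (1 / 2 : ℝ) ^ (-a) with hb
  have hb0 : 0 < b := by positivity
  have hb2 : b < 2 := by
    have h := Real.rpow_lt_rpow_of_exponent_gt (x := (1 / 2 : ℝ)) (by norm_num) (by norm_num)
      (show (-1 : ℝ) < -a by linarith)
    rw [Real.rpow_neg_one] at h
    norm_num at h
    exact h
  set ρ : ℝ := b / 2 with hρ
  have hρ0 : 0 ≤ ρ := by positivity
  have hρ1 : ρ < 1 := by rw [hρ]; linarith
  refine ⟨1 + K + 2 * K * b * (1 - ρ)⁻¹, by
    have : 0 < 1 - ρ := by linarith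
    positivity, fun u => ?_⟩
  set s : ℕ → ℝ := fun k => (1 / 2) ^ k with hs
  have hs0 : ∀ k, 0 < s k := fun k => by positivity
  set A : ℕ → Space N → ℂ := fun k => cellAvg (s k) (sigmaFn u) with hA
  have hAm : ∀ k, Measurable (A k) := fun k => measurable_cellAvg _ _
  have hAu : ∀ k, eLpNorm (A k - sigmaFn u) 2 volume ≤ ENNReal.ofReal (K * s k * ‖u‖) := fun k => by
    rw [← eLpNorm_neg, neg_sub]
    exact eLpNorm_sub_cellAvg_le u (hs0 k)
  have hum := (memLp_sigmaFn u).1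
  have hcell : ∀ (k : ℕ) (x y : Space N), cellIndex (s (k + 1)) x = cellIndex (s (k + 1)) y →
      cellIndex (s k) x = cellIndex (s k) y := fun k x y h => by
    apply cellIndex_eq_of_half
    convert h using 2 <;> simp [hs, pow_succ] <;> ring
  -- The grids are nested, so both averages are constant on the finer cubes and the inverse
  -- inequality applies to their difference at scale `s (k + 1)`.
  have hstep : ∀ k, eLpNorm (A (k + 1) - A k) (ENNReal.ofReal r) volume
      ≤ ENNReal.ofReal (2 * K * b * ρ ^ k * ‖u‖) := by
    intro k
    have h2 : eLpNorm (A (k + 1) - A k) 2 volume ≤ ENNReal.ofReal (2 * K * s k * ‖u‖) := by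
      have : A (k + 1) - A k = (A (k + 1) - sigmaFn u) - (A k - sigmaFn u) := by abel
      rw [this]
      refine (eLpNorm_sub_le ((hAm _).aestronglyMeasurable.sub hum)
        ((hAm _).aestronglyMeasurable.sub hum) (by norm_num)).trans ?_
      refine (add_le_add (hAu _) (hAu _)).trans ?_
      rw [← ENNReal.ofReal_add (by have := hs0 (k + 1); positivity)
        (by have := hs0 k; positivity)]
      refine ENNReal.ofReal_le_ofReal ?_
      have h3 : s (k + 1) ≤ s k := by
        simp only [hs, pow_succ]
        have := hs0 k
        simp only [hs] at this
        linarith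
      have h4 : K * s (k + 1) * ‖u‖ ≤ K * s k * ‖u‖ := by gcongr
      linarith
    refine (eLpNorm_le_of_cellwise (hs0 (k + 1)) ((hAm _).sub (hAm _)) ?_ hr).trans ?_
    · intro x y h
      simp only [Pi.sub_apply, hA]
      rw [cellAvg_congr _ h, cellAvg_congr _ (hcell k x y h)]
    · refine (mul_le_mul_right h2 _).trans ?_
      rw [ENNReal.ofReal_rpow_of_pos (hs0 _),
        ← ENNReal.ofReal_mul (by have := hs0 (k + 1); positivity)]
      refine ENNReal.ofReal_le_ofReal (le_of_eq ?_)
      have h5 : s (k + 1) ^ (-a) = b ^ (k + 1) := by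
        rw [hs, hb, ← Real.rpow_natCast, ← Real.rpow_mul (by norm_num), mul_comm,
          Real.rpow_mul (by norm_num), Real.rpow_natCast]
      rw [← ha, h5, hρ, hs]
      simp only
      rw [div_pow, div_pow, one_pow, pow_succ]
      ring
  have hbound : ∀ n, eLpNorm (A n) (ENNReal.ofReal r) volume
      ≤ ENNReal.ofReal ((1 + K) * ‖u‖ + 2 * K * b * (∑ k ∈ Finset.range n, ρ ^ k) * ‖u‖) := by
    intro n
    induction n with
    | zero =>
      refine (eLpNorm_le_of_cellwise (hs0 0) (hAm 0) (fun x y h => cellAvg_congr _ h) hr).trans ?_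
      have h1 : eLpNorm (A 0) 2 volume ≤ ENNReal.ofReal ((1 + K) * ‖u‖) := by
        have : A 0 = sigmaFn u + (A 0 - sigmaFn u) := by abel
        rw [this]
        refine (eLpNorm_add_le hum ((hAm _).aestronglyMeasurable.sub hum) (by norm_num)).trans ?_
        refine (add_le_add (enorm_fst_le u) (hAu 0)).trans ?_
        rw [← ENNReal.ofReal_add (norm_nonneg _) (by have := hs0 0; positivity)]
        refine ENNReal.ofReal_le_ofReal (le_of_eq ?_)
        simp [hs]; ring
      simpa [hs] using h1
    | succ n ih =>
      have : A (n + 1) = A n + (A (n + 1) - A n) := by abel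
      rw [this]
      refine (eLpNorm_add_le (hAm _).aestronglyMeasurable
        ((hAm _).sub (hAm _)).aestronglyMeasurable hr1).trans ?_
      refine (add_le_add ih (hstep n)).trans ?_
      rw [← ENNReal.ofReal_add (by positivity) (by positivity), Finset.sum_range_succ]
      refine ENNReal.ofReal_le_ofReal (le_of_eq ?_)
      ring
  have hbound' : ∀ n, eLpNorm (A n) (ENNReal.ofReal r) volume
      ≤ ENNReal.ofReal ((1 + K + 2 * K * b * (1 - ρ)⁻¹) * ‖u‖) := by
    intro n
    refine (hbound n).trans (ENNReal.ofReal_le_ofReal ?_)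
    have h1 : ∑ k ∈ Finset.range n, ρ ^ k ≤ (1 - ρ)⁻¹ := by
      rw [← tsum_geometric_of_lt_one hρ0 hρ1]
      exact (summable_geometric_of_lt_one hρ0 hρ1).sum_le_tsum _ fun _ _ => by positivity
    have h2 := mul_le_mul_of_nonneg_right (mul_le_mul_of_nonneg_left h1
      (show 0 ≤ 2 * K * b by positivity)) (norm_nonneg u)
    linarith
  have hlim : Filter.Tendsto (fun n => eLpNorm (A n - sigmaFn u) 2 volume) Filter.atTop
      (nhds 0) := by
    refine tendsto_of_tendsto_of_tendsto_of_le_of_le tendsto_const_nhds ?_ (fun _ => zero_le) hAu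
    rw [← ENNReal.ofReal_zero]
    refine ENNReal.tendsto_ofReal ?_
    have : Filter.Tendsto s Filter.atTop (nhds 0) :=
      tendsto_pow_atTop_nhds_zero_of_lt_one (by norm_num) (by norm_num)
    simpa using (this.const_mul K).mul_const ‖u‖
  exact eLpNorm_le_of_tendsto_eLpNorm_sub (fun n => (hAm n).aestronglyMeasurable) hum hlim hbound'

/-! ### Compactness of `Σ → L²` -/

/-- The inclusion `Σ → L²`. -/
def l2Emb (N : ℕ) : SigmaSpace N →L[ℂ] Lp ℂ 2 (volume : Measure (Space N)) :=
  LinearMap.mkContinuous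
    { toFun := fun u => u.1.fst
      map_add' := fun _ _ => rfl
      map_smul' := fun _ _ => rfl } 1 fun u => by
    rw [one_mul]
    exact (sq_le_sq₀ (norm_nonneg _) (norm_nonneg _)).1 (by
      change ‖u.1.fst‖ ^ 2 ≤ _
      nlinarith [sigmaSpace_norm_sq u, sq_nonneg ‖u.1.snd.fst‖, sq_nonneg ‖u.1.snd.snd‖])

theorem l2Emb_apply (u : SigmaSpace N) : l2Emb N u = u.1.fst := rfl

/-- The normalised indicator function of a cube. -/
def cellLp {s : ℝ} (hs : 0 < s) (j : Fin N → ℤ) : Lp ℂ 2 (volume : Measure (Space N)) :=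
  indicatorConstLp 2 (measurableSet_cell s j)
    (by rw [volume_cell hs]; exact ENNReal.pow_ne_top (by simp)) 1

/-- The cubewise average, cut off to finitely many cubes. -/
def cellProj {s : ℝ} (hs : 0 < s) (J : Finset (Fin N → ℤ)) :
    Lp ℂ 2 (volume : Measure (Space N)) →L[ℂ] Lp ℂ 2 (volume : Measure (Space N)) :=
  ∑ j ∈ J, ((innerSL ℂ (cellLp hs j)).smulRight
    (((volume.real (cell s j))⁻¹ : ℂ) • cellLp hs j))

theorem cellProj_coe {s : ℝ} (hs : 0 < s) (J : Finset (Fin N → ℤ))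
    (u : Lp ℂ 2 (volume : Measure (Space N))) :
    cellProj hs J u =ᵐ[volume]
      (cellIndex s ⁻¹' (J : Set (Fin N → ℤ))).indicator (cellAvg s u) := by
  have h1 : ∀ᵐ x : Space N, ∀ j, (((innerSL ℂ (cellLp hs j)).smulRight
    (((volume.real (cell s j))⁻¹ : ℂ) • cellLp hs j)) u) x
      = (cell s j).indicator (fun _ => ⨍ y in cell s j, u y) x := by
    refine ae_all_iff.2 fun j => ?_
    simp only [ContinuousLinearMap.smulRight_apply, innerSL_apply_apply, smul_smul]
    have h2 : inner ℂ (cellLp hs j) u = ∫ y in cell s j, u y :=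
      L2.inner_indicatorConstLp_one _ _ _
    filter_upwards [Lp.coeFn_smul (inner ℂ (cellLp hs j) u * ((volume.real (cell s j))⁻¹ : ℂ))
      (cellLp hs j), indicatorConstLp_coeFn (p := 2) (hs := measurableSet_cell s j)
      (hμs := by rw [volume_cell hs]; exact ENNReal.pow_ne_top (by simp)) (c := (1 : ℂ))
      (μ := volume)] with x hx hx2
    have hx3 : cellLp hs j x = (cell s j).indicator (fun _ => (1 : ℂ)) x := hx2
    rw [hx, Pi.smul_apply, hx3, h2]
    by_cases hxj : x ∈ cell s j
    · rw [Set.indicator_of_mem hxj, Set.indicator_of_mem hxj, setAverage_eq, smul_eq_mul, mul_one,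
        Complex.real_smul, mul_comm]
      push_cast
      rfl
    · rw [Set.indicator_of_notMem hxj, Set.indicator_of_notMem hxj, smul_zero]
  rw [cellProj, sum_apply]
  filter_upwards [h1, Lp.coeFn_finsetSum J fun j => ((innerSL ℂ (cellLp hs j)).smulRight
    (((volume.real (cell s j))⁻¹ : ℂ) • cellLp hs j)) u] with x hx hx2
  rw [hx2, Finset.sum_apply, Finset.sum_congr rfl fun j _ => hx j]
  by_cases hxJ : cellIndex s x ∈ J
  · rw [Set.indicator_of_mem (show x ∈ cellIndex s ⁻¹' (J : Set (Fin N → ℤ)) from hxJ),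
      Finset.sum_eq_single_of_mem _ hxJ, Set.indicator_of_mem (mem_cell_self s x), cellAvg]
    intro j _ hj
    exact Set.indicator_of_notMem (s := cell s j)
      (fun h => hj (show cellIndex s x = j from h).symm) _
  · rw [Set.indicator_of_notMem (show x ∉ cellIndex s ⁻¹' (J : Set (Fin N → ℤ)) from hxJ)]
    refine Finset.sum_eq_zero fun j hj => ?_
    exact Set.indicator_of_notMem (s := cell s j)
      (fun h => hxJ ((show cellIndex s x = j from h) ▸ hj)) _

theorem isCompactOperator_cellProj {s : ℝ} (hs : 0 < s) (J : Finset (Fin N → ℤ)) :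
    IsCompactOperator (cellProj hs J) := by
  rw [cellProj]
  induction J using Finset.induction_on with
  | empty => exact isCompactOperator_zero
  | insert j J hj ih =>
    rw [Finset.sum_insert hj]
    refine IsCompactOperator.add ?_ ih
    have h : IsCompactOperator (innerSL ℂ (cellLp hs j)) :=
      isCompactOperator_of_locallyCompactSpace_dom (innerSL ℂ (cellLp hs j))
    exact h.clm_comp (ContinuousLinearMap.toSpanSingleton ℂ
      (((volume.real (cell s j))⁻¹ : ℂ) • cellLp hs j))

/-- On the retained cubes the error is that of the Poincaré inequality. Off them `|x| ≥ Ms`, hence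
`|u| ≤ (Ms)⁻¹ |x| |u|`. -/
theorem norm_l2Emb_sub_cellProj_le {s : ℝ} (hs : 0 < s) {M : ℕ} (hM : 0 < M) (u : SigmaSpace N) :
    ‖l2Emb N u - cellProj hs (Fintype.piFinset fun _ => Finset.Icc (-M : ℤ) M) (l2Emb N u)‖
      ≤ (2 ^ N * N * s + (M * s)⁻¹) * ‖u‖ := by
  set J : Finset (Fin N → ℤ) := Fintype.piFinset fun _ => Finset.Icc (-M : ℤ) M with hJ
  set S : Set (Space N) := cellIndex s ⁻¹' (J : Set (Fin N → ℤ)) with hS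
  have hSm : MeasurableSet S := measurable_cellIndex s J.measurableSet
  have hMs : 0 < M * s := by positivity
  have hout : ∀ x ∉ S, M * s ≤ ‖x‖ := by
    intro x hx
    have : ∃ i, ¬ (cellIndex s x i ∈ Finset.Icc (-M : ℤ) M) := by
      by_contra! h
      exact hx (Fintype.mem_piFinset.2 h)
    obtain ⟨i, hi⟩ := this
    refine le_trans ?_ (PiLp.norm_apply_le x i)
    rw [Real.norm_eq_abs, ← div_le_div_iff_of_pos_right hs, mul_div_assoc, div_self hs.ne', mul_one]
    rw [show |x i| / s = |x i / s| by rw [abs_div, abs_of_pos hs], le_abs]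
    rw [Finset.mem_Icc, not_and_or, not_le, not_le] at hi
    rcases hi with hi | hi
    · right
      have h1 := Int.lt_floor_add_one (x i / s)
      have h2 : ((cellIndex s x i : ℤ) : ℝ) + 1 ≤ -M := by exact_mod_cast hi
      simp only [cellIndex] at h2
      linarith
    · left
      have h1 := Int.floor_le (x i / s)
      have h2 : (M : ℝ) < (cellIndex s x i : ℤ) := by exact_mod_cast hi
      simp only [cellIndex] at h2
      linarith
  have hum := (memLp_sigmaFn u).1
  have h1 : ‖l2Emb N u - cellProj hs J (l2Emb N u)‖ₑ
      = eLpNorm (S.indicator (sigmaFn u - cellAvg s (sigmaFn u))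
        + Sᶜ.indicator (sigmaFn u)) 2 volume := by
    rw [Lp.enorm_def]
    refine eLpNorm_congr_ae ?_
    filter_upwards [Lp.coeFn_sub (l2Emb N u) (cellProj hs J (l2Emb N u)),
      cellProj_coe hs J (l2Emb N u)] with x hx hx2
    rw [hx, Pi.sub_apply, hx2, l2Emb_apply, Pi.add_apply]
    by_cases hxS : x ∈ S
    · rw [Set.indicator_of_mem hxS, Set.indicator_of_mem hxS,
        Set.indicator_of_notMem (by simpa using hxS), add_zero]
      rfl
    · rw [Set.indicator_of_notMem hxS, Set.indicator_of_notMem hxS,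
        Set.indicator_of_mem (by simpa using hxS), zero_add, sub_zero]
      rfl
  have h2 : eLpNorm (Sᶜ.indicator (sigmaFn u)) 2 volume ≤ ENNReal.ofReal ((M * s)⁻¹ * ‖u‖) := by
    have h3 : eLpNorm (Sᶜ.indicator (sigmaFn u)) 2 volume
        ≤ ENNReal.ofReal (M * s)⁻¹
          * eLpNorm (fun x => (‖x‖ : ℂ) * sigmaFn u x) 2 volume := by
      refine eLpNorm_le_mul_eLpNorm_of_ae_le_mul (Filter.Eventually.of_forall fun x => ?_) 2
      by_cases hxS : x ∈ S
      · rw [Set.indicator_of_notMem (by simpa using hxS), norm_zero]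
        positivity
      · rw [Set.indicator_of_mem (by simpa using hxS), norm_mul, Complex.norm_real, norm_norm,
          ← mul_assoc]
        refine le_mul_of_one_le_left (norm_nonneg _) ?_
        rw [← div_eq_inv_mul, one_le_div hMs]
        exact hout x hxS
    refine h3.trans ?_
    rw [ENNReal.ofReal_mul (by positivity)]
    exact mul_le_mul_right (enorm_weight_le u) _
  have h4 : ‖l2Emb N u - cellProj hs J (l2Emb N u)‖ₑ
      ≤ ENNReal.ofReal ((2 ^ N * N * s + (M * s)⁻¹) * ‖u‖) := by
    rw [h1]
    have hsub : AEStronglyMeasurable (sigmaFn u - cellAvg s (sigmaFn u)) volume :=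
      hum.sub (measurable_cellAvg _ _).aestronglyMeasurable
    refine (eLpNorm_add_le (hsub.indicator hSm) (hum.indicator hSm.compl) (by norm_num)).trans ?_
    rw [add_mul, ENNReal.ofReal_add (by positivity) (by positivity)]
    exact add_le_add ((eLpNorm_indicator_le _).trans (eLpNorm_sub_cellAvg_le u hs)) h2
  rw [← ofReal_norm] at h4
  exact (ENNReal.ofReal_le_ofReal_iff (by positivity)).1 h4

theorem isCompactOperator_of_approx {E F : Type*} [NormedAddCommGroup E] [NormedSpace ℂ E]
    [NormedAddCommGroup F] [NormedSpace ℂ F] [CompleteSpace F] (T : E →L[ℂ] F)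
    (P : ℕ → E →L[ℂ] F) (hP : ∀ n, IsCompactOperator (P n)) (C : ℝ) (hC : 0 ≤ C)
    (h : ∀ n u, ‖T u - P n u‖ ≤ C * ((n : ℝ) + 1)⁻¹ * ‖u‖) : IsCompactOperator T := by
  have hlim : Filter.Tendsto (fun n => ‖P n - T‖) Filter.atTop (nhds 0) := by
    refine squeeze_zero (fun _ => norm_nonneg _)
      (g := fun n : ℕ => C * ((n : ℝ) + 1)⁻¹) (fun n => ?_) ?_
    · refine ContinuousLinearMap.opNorm_le_bound _ (by positivity) fun u => ?_
      rw [sub_apply, ← norm_neg, neg_sub]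
      exact h n u
    · have := tendsto_one_div_add_atTop_nhds_zero_nat (𝕜 := ℝ)
      simpa [one_div] using this.const_mul C
  exact isCompactOperator_of_tendsto (l := Filter.atTop)
    (tendsto_iff_norm_sub_tendsto_zero.2 hlim) (Filter.Eventually.of_forall hP)

/-- The inclusion `Σ → L²` is compact. -/
theorem isCompactOperator_l2Emb : IsCompactOperator (l2Emb N) := by
  have hs0 : ∀ n : ℕ, 0 < ((n : ℝ) + 1)⁻¹ := fun n => by positivity
  -- With side `s = 1/(n+1)` and `M = (n+1)²` one has `Ms = n+1`, so both parts of the error are of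
  -- order `1/(n+1)`.
  set J : ℕ → Finset (Fin N → ℤ) := fun n =>
    Fintype.piFinset fun _ => Finset.Icc (-((n + 1) ^ 2 : ℕ) : ℤ) ((n + 1) ^ 2 : ℕ) with hJ
  refine isCompactOperator_of_approx (l2Emb N)
    (fun n : ℕ => (cellProj (hs0 n) (J n)).comp (l2Emb N))
    (fun n => (isCompactOperator_cellProj (hs0 n) (J n)).comp_clm _)
    (2 ^ N * N + 1) (by positivity) fun n u => ?_
  refine (norm_l2Emb_sub_cellProj_le (hs0 n) (M := (n + 1) ^ 2) (by positivity) u).trans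
    (le_of_eq ?_)
  push_cast
  field_simp

/-! ### The compact embeddings `Σ → L^r` -/

/-- A bound for the embedding `Σ → L^r`. -/
def HasLrBound (N : ℕ) (r C : ℝ) : Prop :=
  ∀ u : SigmaSpace N, eLpNorm (sigmaFn u) (ENNReal.ofReal r) volume ≤ ENNReal.ofReal (C * ‖u‖)

theorem HasLrBound.memLp {r C : ℝ} (h : HasLrBound N r C) (u : SigmaSpace N) :
    MemLp (sigmaFn u) (ENNReal.ofReal r) volume :=
  ⟨(memLp_sigmaFn u).1, (h u).trans_lt ENNReal.ofReal_lt_top⟩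

theorem sigmaFn_add (u v : SigmaSpace N) : sigmaFn (u + v) =ᵐ[volume] sigmaFn u + sigmaFn v :=
  Lp.coeFn_add u.1.fst v.1.fst

theorem sigmaFn_smul (c : ℂ) (u : SigmaSpace N) : sigmaFn (c • u) =ᵐ[volume] c • sigmaFn u :=
  Lp.coeFn_smul c u.1.fst

/-- The inclusion `Σ → L^r`. -/
def lrEmb {r C : ℝ} [Fact (1 ≤ ENNReal.ofReal r)] (hC : 0 ≤ C) (h : HasLrBound N r C) :
    SigmaSpace N →L[ℂ] Lp ℂ (ENNReal.ofReal r) (volume : Measure (Space N)) :=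
  LinearMap.mkContinuous
    { toFun := fun u => (h.memLp u).toLp _
      map_add' := fun u v => by
        rw [← MemLp.toLp_add]
        exact MemLp.toLp_congr _ _ (sigmaFn_add u v)
      map_smul' := fun c u => by
        rw [RingHom.id_apply, ← MemLp.toLp_const_smul]
        exact MemLp.toLp_congr _ _ (sigmaFn_smul c u) } C fun u => by
    change ‖(h.memLp u).toLp _‖ ≤ _
    rw [Lp.norm_toLp]
    exact ENNReal.toReal_le_of_le_ofReal (by positivity) (h u)

theorem lrEmb_apply {r C : ℝ} [Fact (1 ≤ ENNReal.ofReal r)] (hC : 0 ≤ C) (h : HasLrBound N r C)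
    (u : SigmaSpace N) : lrEmb hC h u = (h.memLp u).toLp _ := rfl

theorem norm_Lp_rpow_eq {r : ℝ} (hr : 0 < r) {f : Space N → ℂ}
    (hf : MemLp f (ENNReal.ofReal r) volume) : ‖hf.toLp f‖ ^ r = ∫ x, ‖f x‖ ^ r := by
  rw [Lp.norm_toLp, hf.eLpNorm_eq_integral_rpow_norm (by simpa using hr) (by simp),
    ENNReal.toReal_ofReal hr.le, ENNReal.toReal_ofReal (by positivity),
    ← Real.rpow_mul (integral_nonneg fun _ => by positivity), inv_mul_cancel₀ hr.ne', Real.rpow_one]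

theorem powInt_eq {r C : ℝ} [Fact (1 ≤ ENNReal.ofReal r)] (hr : 0 < r) (hC : 0 ≤ C)
    (h : HasLrBound N r C) (u : SigmaSpace N) : powInt r u = ‖lrEmb hC h u‖ ^ r := by
  rw [lrEmb_apply, norm_Lp_rpow_eq hr]; rfl

theorem norm_lrEmb_interpolate {r C r' C' : ℝ} [Fact (1 ≤ ENNReal.ofReal r)]
    (hr : 2 < r) (hr' : r < r')
    (hC : 0 ≤ C) (h : HasLrBound N r C) (hC' : 0 ≤ C') (h' : HasLrBound N r' C')
    (u : SigmaSpace N) :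
    ‖lrEmb hC h u‖ ^ r ≤ (‖l2Emb N u‖ ^ 2) ^ ((r' - r) / (r' - 2))
      * ((C' * ‖u‖) ^ r') ^ ((r - 2) / (r' - 2)) := by
  have hr0 : 0 < r := by linarith
  have hr0' : 0 < r' := by linarith
  have ha : 0 ≤ (r' - r) / (r' - 2) := div_nonneg (by linarith) (by linarith)
  have hb : 0 ≤ (r - 2) / (r' - 2) := div_nonneg (by linarith) (by linarith)
  have key := lintegral_rpow_interpolate (memLp_sigmaFn u).1 hr hr'
  have e1 : ∀ (s : ℝ), 0 < s → ∫⁻ x, ‖sigmaFn u x‖ₑ ^ s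
      = eLpNorm (sigmaFn u) (ENNReal.ofReal s) volume ^ s := fun s hs => by
    rw [eLpNorm_eq_lintegral_rpow_enorm_toReal (by simpa using hs) (by simp),
      ENNReal.toReal_ofReal hs.le, ← ENNReal.rpow_mul, one_div, inv_mul_cancel₀ hs.ne',
      ENNReal.rpow_one]
  have e2 : eLpNorm (sigmaFn u) (ENNReal.ofReal r) volume = ENNReal.ofReal ‖lrEmb hC h u‖ := by
    rw [lrEmb_apply, Lp.norm_toLp, ENNReal.ofReal_toReal (h.memLp u).2.ne]
  have e3 : eLpNorm (sigmaFn u) (ENNReal.ofReal 2) volume = ENNReal.ofReal ‖l2Emb N u‖ := by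
    rw [ENNReal.ofReal_ofNat, Lp.norm_def, ENNReal.ofReal_toReal (Lp.eLpNorm_ne_top _)]; rfl
  rw [e1 r hr0, e1 r' hr0', e1 2 two_pos, e2, e3] at key
  have key2 := key.trans (mul_le_mul_right (ENNReal.rpow_le_rpow
    (ENNReal.rpow_le_rpow (h' u) hr0'.le) hb) _)
  rw [ENNReal.ofReal_rpow_of_nonneg (norm_nonneg _) hr0.le,
    ENNReal.ofReal_rpow_of_nonneg (norm_nonneg _) (by norm_num),
    ENNReal.ofReal_rpow_of_nonneg (by positivity) ha,
    ENNReal.ofReal_rpow_of_nonneg (by positivity) hr0'.le,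
    ENNReal.ofReal_rpow_of_nonneg (by positivity) hb, ← ENNReal.ofReal_mul (by positivity),
    ENNReal.ofReal_le_ofReal_iff (by positivity), Real.rpow_two] at key2
  exact key2

/-- Interpolation between `L²` and `L^{r'}`, `r' > r`: the `L^{r'}` factor of a difference stays
bounded, and the `L²` distance enters with a positive power. -/
theorem cauchySeq_lrEmb {r C r' C' : ℝ} [Fact (1 ≤ ENNReal.ofReal r)]
    (hr : 2 < r) (hr' : r < r')
    (hC : 0 ≤ C) (h : HasLrBound N r C) (hC' : 0 ≤ C') (h' : HasLrBound N r' C')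
    {u : ℕ → SigmaSpace N} {R : ℝ} (hR : ∀ n, ‖u n‖ ≤ R)
    (hu : CauchySeq fun n => l2Emb N (u n)) : CauchySeq fun n => lrEmb hC h (u n) := by
  rw [cauchySeq_iff_tendsto_dist_atTop_0] at hu ⊢
  have hr0 : 0 < r := by linarith
  have ha : 0 < (r' - r) / (r' - 2) := div_pos (by linarith) (by linarith)
  have hb : 0 ≤ (r - 2) / (r' - 2) := div_nonneg (by linarith) (by linarith)
  set K := ((C' * (2 * R)) ^ r') ^ ((r - 2) / (r' - 2)) with hK
  have hle : ∀ n : ℕ × ℕ, dist (lrEmb hC h (u n.1)) (lrEmb hC h (u n.2))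
      ≤ ((dist (l2Emb N (u n.1)) (l2Emb N (u n.2)) ^ 2) ^ ((r' - r) / (r' - 2)) * K) ^ r⁻¹ := by
    intro n
    rw [dist_eq_norm, dist_eq_norm, ← map_sub, ← map_sub]
    have h1 := norm_lrEmb_interpolate hr hr' hC h hC' h' (u n.1 - u n.2)
    have h2 : ‖u n.1 - u n.2‖ ≤ 2 * R := by
      linarith [norm_sub_le (u n.1) (u n.2), hR n.1, hR n.2]
    have h3 : ((C' * ‖u n.1 - u n.2‖) ^ r') ^ ((r - 2) / (r' - 2)) ≤ K :=
      Real.rpow_le_rpow (by positivity) (Real.rpow_le_rpow (by positivity) (by gcongr)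
        (by linarith)) hb
    have hR0 : 0 ≤ R := (norm_nonneg _).trans (hR 0)
    rw [Real.le_rpow_inv_iff_of_pos (norm_nonneg _) (by positivity) hr0]
    exact h1.trans (mul_le_mul_of_nonneg_left h3 (by positivity))
  refine squeeze_zero (fun _ => dist_nonneg) hle ?_
  have h4 := (((hu.pow 2).rpow_const (p := (r' - r) / (r' - 2)) (Or.inr ha.le)).mul_const
    K).rpow_const (p := r⁻¹) (Or.inr (by positivity))
  simpa [Real.zero_rpow ha.ne', Real.zero_rpow (inv_pos.2 hr0).ne'] using h4

theorem exists_subseq_cauchySeq_l2Emb {u : ℕ → SigmaSpace N} {R : ℝ} (hR : ∀ n, ‖u n‖ ≤ R) :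
    ∃ φ : ℕ → ℕ, StrictMono φ ∧ CauchySeq fun n => l2Emb N (u (φ n)) := by
  obtain ⟨K, hK, hsub⟩ := IsCompactOperator.image_closedBall_subset_compact
    (f := (l2Emb N).toLinearMap) (isCompactOperator_l2Emb (N := N)) R
  obtain ⟨y, -, φ, hφ, hy⟩ := hK.tendsto_subseq (x := fun n => l2Emb N (u n)) fun n =>
    hsub ⟨u n, by simpa using hR n, rfl⟩
  exact ⟨φ, hφ, hy.cauchySeq⟩

/-! ### The direct method -/

/-- Direct method: a functional `½‖u‖² + Φ(T u)` with `T` compact attains its minimum on a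
homogeneous constraint set on which it is coercive. -/
theorem exists_minimizer {H X : Type*} [NormedAddCommGroup H] [NormedSpace ℝ H]
    [CompleteSpace H]
    (hpl : ∀ x y : H, ‖x + y‖ ^ 2 + ‖x - y‖ ^ 2 = 2 * (‖x‖ ^ 2 + ‖y‖ ^ 2))
    [NormedAddCommGroup X] [NormedSpace ℝ X] [CompleteSpace X] (T : H →L[ℝ] X)
    (hT : ∀ (u : ℕ → H) (R : ℝ), (∀ n, ‖u n‖ ≤ R) →
      ∃ φ : ℕ → ℕ, StrictMono φ ∧ CauchySeq fun n => T (u (φ n)))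
    {Φ n : X → ℝ} (hΦ : Continuous Φ) (hn : Continuous n)
    (hhom : ∀ (t : ℝ) (x : X), 0 < t → n (t • x) = t * n x) {κ : ℝ} (hκ : 0 < κ)
    (hne : ∃ u : H, n (T u) = κ) {c C : ℝ} (hc : 0 < c)
    (hcoer : ∀ u : H, n (T u) = κ → c * ‖u‖ ^ 2 - C ≤ 1 / 2 * ‖u‖ ^ 2 + Φ (T u)) :
    ∃ v : H, n (T v) = κ ∧ ∀ w : H, n (T w) = κ →
      1 / 2 * ‖v‖ ^ 2 + Φ (T v) ≤ 1 / 2 * ‖w‖ ^ 2 + Φ (T w) := by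
  set E : H → ℝ := fun u => 1 / 2 * ‖u‖ ^ 2 + Φ (T u) with hE
  set S : Set H := {u | n (T u) = κ} with hS
  have hbdd : BddBelow (E '' S) := by
    refine ⟨-C, ?_⟩
    rintro _ ⟨u, hu, rfl⟩
    have := hcoer u hu
    have : 0 ≤ c * ‖u‖ ^ 2 := by positivity
    simp only [hE]
    linarith
  set m := sInf (E '' S) with hm
  have hmle : ∀ w, n (T w) = κ → m ≤ E w := fun w hw => csInf_le hbdd ⟨w, hw, rfl⟩
  obtain ⟨e, -, hem, heS⟩ := exists_seq_tendsto_sInf (S := E '' S)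
    (Set.Nonempty.image E hne) hbdd
  choose u₀ hu₀S hu₀e using heS
  obtain ⟨B, hB⟩ := hem.bddAbove_range
  have hbound : ∀ k, ‖u₀ k‖ ≤ Real.sqrt ((B + C) / c) := fun k => by
    refine Real.le_sqrt_of_sq_le ?_
    rw [le_div_iff₀ hc]
    have h1 := hcoer (u₀ k) (hu₀S k)
    have h2 : E (u₀ k) ≤ B := hB ⟨k, (hu₀e k).symm⟩
    simp only [hE] at h2
    linarith
  obtain ⟨φ, hφ, hcau⟩ := hT u₀ _ hbound
  set u : ℕ → H := fun k => u₀ (φ k) with hu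
  have huE : Filter.Tendsto (fun k => E (u k)) Filter.atTop (nhds m) := by
    have := hem.comp hφ.tendsto_atTop
    refine this.congr fun k => ?_
    simp [hu, hu₀e]
  obtain ⟨y, hy⟩ := cauchySeq_tendsto_of_complete hcau
  have hny : n y = κ := tendsto_nhds_unique ((hn.tendsto y).comp hy)
    (tendsto_const_nhds.congr fun k => (hu₀S (φ k)).symm)
  have hnorm : Filter.Tendsto (fun k => ‖u k‖ ^ 2) Filter.atTop (nhds (2 * (m - Φ y))) := by
    have := (huE.sub ((hΦ.tendsto y).comp hy)).const_mul 2
    refine this.congr fun k => ?_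
    simp only [hE, Function.comp_apply]
    ring
  -- Midpoints of the minimizing sequence. By the parallelogram law, a lower bound on their norms
  -- forces `‖u j - u k‖ → 0`.
  set w : ℕ × ℕ → H := fun k => (1 / 2 : ℝ) • (u k.1 + u k.2) with hw
  have hfst : Filter.Tendsto (Prod.fst : ℕ × ℕ → ℕ) Filter.atTop Filter.atTop :=
    Filter.tendsto_atTop_atTop.2 fun b => ⟨(b, b), fun a ha => ha.1⟩
  have hsnd : Filter.Tendsto (Prod.snd : ℕ × ℕ → ℕ) Filter.atTop Filter.atTop :=
    Filter.tendsto_atTop_atTop.2 fun b => ⟨(b, b), fun a ha => ha.2⟩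
  have hTw : Filter.Tendsto (fun k => T (w k)) Filter.atTop (nhds y) := by
    have := ((hy.comp hfst).add (hy.comp hsnd)).const_smul (1 / 2 : ℝ)
    rw [← two_smul ℝ y, smul_smul, show (1 / 2 : ℝ) * 2 = 1 by norm_num, one_smul] at this
    refine this.congr fun k => ?_
    simp only [hw, map_smul, map_add, Function.comp_apply]
    rfl
  have hnw : Filter.Tendsto (fun k => n (T (w k))) Filter.atTop (nhds κ) := by
    rw [← hny]; exact (hn.tendsto y).comp hTw
  -- The midpoints may leave the constraint set. Homogeneity brings them back by this factor, which
  -- tends to 1, so comparing `t • w` with the infimum `m` loses nothing in the limit.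
  set t : ℕ × ℕ → ℝ := fun k => κ / n (T (w k)) with ht
  have ht1 : Filter.Tendsto t Filter.atTop (nhds 1) := by
    have := (tendsto_const_nhds (x := κ)).div hnw hκ.ne'
    rwa [div_self hκ.ne'] at this
  have hΦw : Filter.Tendsto (fun k => Φ (t k • T (w k))) Filter.atTop (nhds (Φ y)) := by
    have := ht1.smul hTw
    rw [one_smul] at this
    exact (hΦ.tendsto y).comp this
  have hlow : ∀ᶠ k in Filter.atTop, 2 * (m - Φ (t k • T (w k))) / t k ^ 2 ≤ ‖w k‖ ^ 2 := by
    filter_upwards [hnw.eventually (lt_mem_nhds hκ)] with k hk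
    have htk : 0 < t k := div_pos hκ hk
    rw [div_le_iff₀ (by positivity)]
    have h1 := hmle (t k • w k) (by
      rw [map_smul, hhom _ _ htk, ht]
      exact div_mul_cancel₀ _ hk.ne')
    simp only [hE, map_smul, norm_smul, mul_pow, Real.norm_eq_abs, sq_abs] at h1
    linarith
  have hpar : ∀ k : ℕ × ℕ, ‖u k.1 - u k.2‖ ^ 2 = 2 * ‖u k.1‖ ^ 2 + 2 * ‖u k.2‖ ^ 2
      - 4 * ‖w k‖ ^ 2 := fun k => by
    have h1 := hpl (u k.1) (u k.2)
    have h2 : ‖w k‖ = 1 / 2 * ‖u k.1 + u k.2‖ := by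
      rw [hw, norm_smul]; norm_num
    rw [h2]
    linarith
  have hsq : Filter.Tendsto (fun k : ℕ × ℕ => ‖u k.1 - u k.2‖ ^ 2) Filter.atTop (nhds 0) := by
    have hup : Filter.Tendsto (fun k : ℕ × ℕ => 2 * ‖u k.1‖ ^ 2 + 2 * ‖u k.2‖ ^ 2
        - 4 * (2 * (m - Φ (t k • T (w k))) / t k ^ 2)) Filter.atTop (nhds 0) := by
      have h1 := (((hnorm.comp hfst).const_mul 2).add ((hnorm.comp hsnd).const_mul 2)).sub
        ((((hΦw.const_sub m).const_mul 2).div (ht1.pow 2) (by norm_num)).const_mul 4)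
      rw [show 2 * (2 * (m - Φ y)) + 2 * (2 * (m - Φ y)) - 4 * (2 * (m - Φ y) / 1 ^ 2) = 0 by
        ring] at h1
      exact h1
    refine tendsto_of_tendsto_of_tendsto_of_le_of_le' tendsto_const_nhds hup
      (Filter.Eventually.of_forall fun _ => sq_nonneg _) ?_
    filter_upwards [hlow] with k hk
    rw [hpar]
    linarith
  have hCauchy : CauchySeq u := by
    rw [cauchySeq_iff_tendsto_dist_atTop_0]
    have := hsq.sqrt
    rw [Real.sqrt_zero] at this
    refine this.congr fun k => ?_
    rw [Real.sqrt_sq (norm_nonneg _), dist_eq_norm]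
  obtain ⟨v, hv⟩ := cauchySeq_tendsto_of_complete hCauchy
  have hTv : T v = y := tendsto_nhds_unique ((T.continuous.tendsto v).comp hv) hy
  refine ⟨v, by rw [hTv, hny], fun z hz => ?_⟩
  have hEc : Continuous E := by
    simp only [hE]; fun_prop
  have hEv : E v = m := tendsto_nhds_unique ((hEc.tendsto v).comp hv) huE
  exact hEv.le.trans (hmle z hz)

/-! ### Differentiability of `∫ |f|^r` on `L^r` -/

/-- Scale to `t = x / y ∈ [0, 1]`; then use Bernoulli if `α ≥ 1`, and `t ≤ t^α` if `α ≤ 1`. The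
extra factor `x` is what makes `z ↦ |z|^α z` locally Lipschitz even for `α < 1`, where `|z|^α` is
not. -/
theorem rpow_sub_mul_le {α x y : ℝ} (hα : 0 < α) (hx : 0 ≤ x) (hxy : x ≤ y) :
    (y ^ α - x ^ α) * x ≤ (1 + α) * y ^ α * (y - x) := by
  rcases (hx.trans hxy).eq_or_lt with hy | hy
  · have : x = 0 := le_antisymm (hy ▸ hxy) hx
    subst this; simp [← hy]
  set t := x / y with ht
  have ht0 : 0 ≤ t := by positivity
  have ht1 : t ≤ 1 := (div_le_one hy).2 hxy
  have hxt : x = t * y := by rw [ht, div_mul_cancel₀ _ hy.ne']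
  have key : (1 - t ^ α) * t ≤ (1 + α) * (1 - t) := by
    have htα : 0 ≤ t ^ α := by positivity
    rcases le_total 1 α with h1 | h1
    · have h2 := one_add_mul_self_le_rpow_one_add (s := t - 1) (by linarith) h1
      rw [add_sub_cancel] at h2
      have h3 : 1 - t ^ α ≤ α * (1 - t) := by linarith
      nlinarith [mul_nonneg hα.le (sub_nonneg.2 ht1)]
    · have h2 : t ≤ t ^ α := by
        simpa using Real.rpow_le_rpow_of_exponent_ge_of_imp ht0 ht1 h1
          (fun _ h => absurd h one_ne_zero)
      nlinarith [mul_nonneg hα.le (sub_nonneg.2 ht1)]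
  have hyα : 0 < y ^ α := by positivity
  rw [hxt, Real.mul_rpow ht0 hy.le]
  have := mul_le_mul_of_nonneg_left key (mul_pos hyα hy).le
  linarith

theorem norm_rpow_smul_sub_le {α : ℝ} (hα : 0 < α) {a b : ℂ} (hab : ‖b‖ ≤ ‖a‖) :
    ‖‖a‖ ^ α • a - ‖b‖ ^ α • b‖ ≤ (2 + α) * ‖a‖ ^ α * ‖a - b‖ := by
  have h1 : ‖a‖ ^ α • a - ‖b‖ ^ α • b = ‖a‖ ^ α • (a - b) + (‖a‖ ^ α - ‖b‖ ^ α) • b := by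
    rw [smul_sub, sub_smul]; abel
  have h2 : 0 ≤ ‖a‖ ^ α - ‖b‖ ^ α :=
    sub_nonneg.2 (Real.rpow_le_rpow (norm_nonneg _) hab hα.le)
  rw [h1]
  refine (norm_add_le _ _).trans ?_
  rw [norm_smul, norm_smul, Real.norm_of_nonneg (by positivity), Real.norm_of_nonneg h2]
  have h3 := rpow_sub_mul_le hα (norm_nonneg b) hab
  have h4 : (1 + α) * ‖a‖ ^ α * (‖a‖ - ‖b‖) ≤ (1 + α) * ‖a‖ ^ α * ‖a - b‖ := by
    gcongr; exact norm_sub_norm_le a b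
  linarith

theorem norm_rpow_smul_sub_le' {α M : ℝ} (hα : 0 < α) {a b : ℂ} (ha : ‖a‖ ≤ M) (hb : ‖b‖ ≤ M) :
    ‖‖a‖ ^ α • a - ‖b‖ ^ α • b‖ ≤ (2 + α) * M ^ α * ‖a - b‖ := by
  rcases le_total ‖b‖ ‖a‖ with h | h
  · refine (norm_rpow_smul_sub_le hα h).trans ?_
    gcongr
  · rw [← norm_neg, neg_sub, ← norm_neg (a - b), neg_sub]
    refine (norm_rpow_smul_sub_le hα h).trans ?_
    gcongr

/-- Mean value inequality on the segment from `z` to `z + w`, after subtracting the derivative at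
`z`. The gradient `r|x|^{r-2}x` is Lipschitz on the ball of radius `|z| + |w|` by the preceding
bound. -/
theorem abs_norm_rpow_add_sub_le {r : ℝ} (hr : 2 < r) (z w : ℂ) :
    |‖z + w‖ ^ r - ‖z‖ ^ r - r * ‖z‖ ^ (r - 2) * inner ℝ z w|
      ≤ r * r * ((‖z‖ + ‖w‖) ^ (r - 2) * ‖w‖ ^ (2 : ℝ)) := by
  have hr0 : 0 < r := by linarith
  have key := (convex_segment (𝕜 := ℝ) z (z + w)).norm_image_sub_le_of_norm_hasFDerivWithin_le'
    (f := fun x : ℂ => ‖x‖ ^ r) (f' := fun x => (r * ‖x‖ ^ (r - 2)) • innerSL ℝ x)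
    (φ := (r * ‖z‖ ^ (r - 2)) • innerSL ℝ z) (C := r * (r * (‖z‖ + ‖w‖) ^ (r - 2) * ‖w‖))
    (fun x _ => (hasFDerivAt_norm_rpow x (by linarith)).hasFDerivWithinAt) (fun x hx => ?_)
    (left_mem_segment ℝ z (z + w)) (right_mem_segment ℝ z (z + w))
  · rw [add_sub_cancel_left, Real.norm_eq_abs] at key
    refine (le_of_eq ?_).trans (key.trans (le_of_eq ?_))
    · rfl
    · rw [Real.rpow_two]; ring
  · have h1 : (r * ‖x‖ ^ (r - 2)) • innerSL ℝ x - (r * ‖z‖ ^ (r - 2)) • innerSL ℝ z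
        = r • innerSL ℝ (‖x‖ ^ (r - 2) • x - ‖z‖ ^ (r - 2) • z) := by
      rw [map_sub, map_smul, map_smul, smul_sub, smul_smul, smul_smul]
    obtain ⟨t, ht, rfl⟩ := (segment_eq_image' ℝ z (z + w)) ▸ hx
    simp only [add_sub_cancel_left] at h1 ⊢
    have h2 : ‖t • w‖ ≤ ‖w‖ := by
      rw [norm_smul, Real.norm_of_nonneg ht.1]
      exact mul_le_of_le_one_left (norm_nonneg _) ht.2
    rw [h1, norm_smul, Real.norm_of_nonneg hr0.le, innerSL_apply_norm]
    refine mul_le_mul_of_nonneg_left ?_ hr0.le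
    refine (norm_rpow_smul_sub_le' (M := ‖z‖ + ‖w‖) (by linarith)
      ((norm_add_le _ _).trans (by linarith)) (by linarith [norm_nonneg w])).trans ?_
    rw [add_sub_cancel_left, add_sub_cancel]
    gcongr

theorem integrable_rpow_mul_rpow {r s t : ℝ} (hr : 0 < r) (hs : 0 ≤ s) (ht : 0 ≤ t)
    (hst : s + t = r) {f g : Space N → ℝ} (hf : MemLp f (ENNReal.ofReal r) volume)
    (hg : MemLp g (ENNReal.ofReal r) volume) (hf0 : ∀ x, 0 ≤ f x) (hg0 : ∀ x, 0 ≤ g x) :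
    Integrable (fun x => f x ^ s * g x ^ t) volume := by
  have hi : Integrable (fun x => ‖f x + g x‖ ^ r) volume := by
    have := (hf.add hg).integrable_norm_rpow (by simpa using hr) (by simp)
    rwa [ENNReal.toReal_ofReal hr.le] at this
  refine hi.mono' ((hf.1.aemeasurable.pow_const s).mul
    (hg.1.aemeasurable.pow_const t)).aestronglyMeasurable (Filter.Eventually.of_forall fun x => ?_)
  have h1 := hf0 x
  have h2 := hg0 x
  rw [Real.norm_of_nonneg (by positivity), Real.norm_of_nonneg (by positivity), ← hst,
    Real.rpow_add_of_nonneg (by positivity) hs ht]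
  gcongr <;> linarith

theorem integral_rpow_mul_rpow_le {r s t : ℝ} (hr : 0 < r) (hs : 0 ≤ s) (ht : 0 ≤ t)
    (hst : s + t = r) {f g : Space N → ℝ} (hf : MemLp f (ENNReal.ofReal r) volume)
    (hg : MemLp g (ENNReal.ofReal r) volume) (hf0 : ∀ x, 0 ≤ f x) (hg0 : ∀ x, 0 ≤ g x) :
    ∫ x, f x ^ s * g x ^ t ≤ (eLpNorm f (ENNReal.ofReal r) volume).toReal ^ s
      * (eLpNorm g (ENNReal.ofReal r) volume).toReal ^ t := by
  have hpow : ∀ {f : Space N → ℝ} {s : ℝ}, 0 ≤ s →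
      (∫⁻ x, ‖f x‖ₑ ^ r) ^ (s / r) = eLpNorm f (ENNReal.ofReal r) volume ^ s := fun {f s} hs => by
    rw [eLpNorm_eq_lintegral_rpow_enorm_toReal (by simpa using hr) (by simp),
      ENNReal.toReal_ofReal hr.le, ← ENNReal.rpow_mul]
    congr 1
    ring
  have key := ENNReal.lintegral_mul_norm_pow_le (hf.1.enorm.pow_const r) (hg.1.enorm.pow_const r)
    (div_nonneg hs hr.le) (div_nonneg ht hr.le) (by rw [← add_div, hst, div_self hr.ne'])
  rw [hpow hs, hpow ht] at key
  rw [ENNReal.toReal_rpow, ENNReal.toReal_rpow, ← ENNReal.toReal_mul,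
    integral_eq_lintegral_of_nonneg_ae
      (Filter.Eventually.of_forall fun x => mul_nonneg (Real.rpow_nonneg (hf0 x) _)
        (Real.rpow_nonneg (hg0 x) _))
      (integrable_rpow_mul_rpow hr hs ht hst hf hg hf0 hg0).aestronglyMeasurable]
  refine ENNReal.toReal_mono (ENNReal.mul_ne_top (ENNReal.rpow_ne_top_of_nonneg hs hf.2.ne)
    (ENNReal.rpow_ne_top_of_nonneg ht hg.2.ne)) (le_trans (le_of_eq ?_) key)
  refine lintegral_congr fun x => ?_
  rw [← ENNReal.rpow_mul, ← ENNReal.rpow_mul, mul_div_cancel₀ _ hr.ne', mul_div_cancel₀ _ hr.ne',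
    ENNReal.ofReal_mul (Real.rpow_nonneg (hf0 x) _), Real.enorm_of_nonneg (hf0 x),
    Real.enorm_of_nonneg (hg0 x), ENNReal.ofReal_rpow_of_nonneg (hf0 x) hs,
    ENNReal.ofReal_rpow_of_nonneg (hg0 x) ht]

theorem norm_rpow_mul_inner_le {r : ℝ} (hr : 2 < r) (z w : ℂ) :
    ‖r * ‖z‖ ^ (r - 2) * inner ℝ z w‖ ≤ r * (‖z‖ ^ (r - 1) * ‖w‖ ^ (1 : ℝ)) := by
  have hr0 : 0 < r := by linarith
  rw [norm_mul, Real.norm_of_nonneg (by positivity), Real.rpow_one]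
  have h1 : ‖z‖ ^ (r - 1) = ‖z‖ ^ (r - 2) * ‖z‖ := by
    rw [show r - 1 = (r - 2) + 1 by ring, Real.rpow_add_of_nonneg (norm_nonneg _) (by linarith)
      zero_le_one, Real.rpow_one]
  rw [h1]
  have h2 := norm_inner_le_norm (𝕜 := ℝ) z w
  calc r * ‖z‖ ^ (r - 2) * ‖(inner ℝ z w : ℝ)‖
      ≤ r * ‖z‖ ^ (r - 2) * (‖z‖ * ‖w‖) := by gcongr
    _ = _ := by ring

theorem integrable_norm_rpow_mul_inner {r : ℝ} (hr : 2 < r)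
    (f h : Lp ℂ (ENNReal.ofReal r) (volume : Measure (Space N))) :
    Integrable (fun x => r * ‖f x‖ ^ (r - 2) * inner ℝ (f x) (h x)) volume := by
  have hi := integrable_rpow_mul_rpow (s := r - 1) (t := 1) (by linarith : 0 < r) (by linarith)
    zero_le_one (by ring) (Lp.memLp f).norm (Lp.memLp h).norm (fun _ => norm_nonneg _)
    (fun _ => norm_nonneg _)
  exact (hi.const_mul r).mono' ((((Lp.memLp f).1.norm.aemeasurable.pow_const _).const_mul
    r).aestronglyMeasurable.mul ((Lp.memLp f).1.inner (Lp.memLp h).1))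
    (Filter.Eventually.of_forall fun x => norm_rpow_mul_inner_le hr _ _)

theorem integrable_Lp_norm_rpow {r : ℝ} (hr : 2 < r)
    (f : Lp ℂ (ENNReal.ofReal r) (volume : Measure (Space N))) :
    Integrable (fun x => ‖f x‖ ^ r) volume := by
  have hr0 : 0 < r := by linarith
  have := (Lp.memLp f).integrable_norm_rpow (by simpa using hr0) (by simp)
  rwa [ENNReal.toReal_ofReal hr0.le] at this

theorem Lp_norm_rpow_eq_integral {r : ℝ} (hr : 2 < r)
    (f : Lp ℂ (ENNReal.ofReal r) (volume : Measure (Space N))) :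
    ‖f‖ ^ r = ∫ x, ‖f x‖ ^ r := by
  have := norm_Lp_rpow_eq (by linarith : 0 < r) (Lp.memLp f)
  rwa [Lp.toLp_coeFn] at this

/-- The derivative of `f ↦ ∫ |f|^r`. -/
def lpPowDeriv {r : ℝ} [Fact (1 ≤ ENNReal.ofReal r)] (hr : 2 < r)
    (f : Lp ℂ (ENNReal.ofReal r) (volume : Measure (Space N))) :
    Lp ℂ (ENNReal.ofReal r) (volume : Measure (Space N)) →L[ℝ] ℝ :=
  LinearMap.mkContinuous
    { toFun := fun h => ∫ x, r * ‖f x‖ ^ (r - 2) * inner ℝ (f x) (h x)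
      map_add' := fun h k => by
        rw [← integral_add (integrable_norm_rpow_mul_inner hr f h)
          (integrable_norm_rpow_mul_inner hr f k)]
        refine integral_congr_ae ?_
        filter_upwards [Lp.coeFn_add h k] with x hx
        rw [hx, Pi.add_apply, inner_add_right, mul_add]
      map_smul' := fun c h => by
        rw [RingHom.id_apply, smul_eq_mul, ← integral_const_mul]
        refine integral_congr_ae ?_
        filter_upwards [Lp.coeFn_smul c h] with x hx
        rw [hx, Pi.smul_apply, real_inner_smul_right]
        ring } (r * ‖f‖ ^ (r - 1)) fun h => by
    have hr0 : 0 < r := by linarith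
    have hi := integrable_rpow_mul_rpow (s := r - 1) (t := 1) hr0 (by linarith)
      zero_le_one (by ring) (Lp.memLp f).norm (Lp.memLp h).norm (fun _ => norm_nonneg _)
      (fun _ => norm_nonneg _)
    have hle := integral_rpow_mul_rpow_le (s := r - 1) (t := 1) hr0 (by linarith)
      zero_le_one (by ring) (Lp.memLp f).norm (Lp.memLp h).norm (fun _ => norm_nonneg _)
      (fun _ => norm_nonneg _)
    rw [eLpNorm_norm, eLpNorm_norm, ← Lp.norm_def, ← Lp.norm_def, Real.rpow_one] at hle
    change ‖∫ x, r * ‖f x‖ ^ (r - 2) * inner ℝ (f x) (h x)‖ ≤ _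
    refine (norm_integral_le_of_norm_le (hi.const_mul r)
      (Filter.Eventually.of_forall fun x => norm_rpow_mul_inner_le hr _ _)).trans ?_
    rw [integral_const_mul, mul_assoc]
    exact mul_le_mul_of_nonneg_left hle hr0.le

theorem lpPowDeriv_apply {r : ℝ} [Fact (1 ≤ ENNReal.ofReal r)] (hr : 2 < r)
    (f h : Lp ℂ (ENNReal.ofReal r) (volume : Measure (Space N))) :
    lpPowDeriv hr f h = ∫ x, r * ‖f x‖ ^ (r - 2) * inner ℝ (f x) (h x) := rfl

/-- The pointwise Taylor bound is integrated, and Hölder with weights `(r-2)/r` and `2/r` keeps the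
remainder quadratic in `h`. -/
theorem abs_lpPow_remainder_le {r : ℝ} [Fact (1 ≤ ENNReal.ofReal r)] (hr : 2 < r)
    (f h : Lp ℂ (ENNReal.ofReal r) (volume : Measure (Space N))) :
    |‖f + h‖ ^ r - ‖f‖ ^ r - lpPowDeriv hr f h|
      ≤ r * r * ((‖f‖ + ‖h‖) ^ (r - 2) * ‖h‖ ^ 2) := by
  have hr0 : 0 < r := by linarith
  have hfh : MemLp (fun x => ‖f x‖ + ‖h x‖) (ENNReal.ofReal r) volume :=
    (Lp.memLp f).norm.add (Lp.memLp h).norm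
  have hi := integrable_rpow_mul_rpow (s := r - 2) (t := 2) hr0 (by linarith)
    zero_le_two (by ring) hfh (Lp.memLp h).norm (fun _ => by positivity)
    (fun _ => norm_nonneg _)
  have hle := integral_rpow_mul_rpow_le (s := r - 2) (t := 2) hr0 (by linarith)
    zero_le_two (by ring) hfh (Lp.memLp h).norm (fun _ => by positivity)
    (fun _ => norm_nonneg _)
  rw [eLpNorm_norm, ← Lp.norm_def, Real.rpow_two] at hle
  have hsum : (eLpNorm (fun x => ‖f x‖ + ‖h x‖) (ENNReal.ofReal r) volume).toReal
      ≤ ‖f‖ + ‖h‖ := by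
    have h1 := eLpNorm_add_le (p := ENNReal.ofReal r) (Lp.memLp f).1.norm (Lp.memLp h).1.norm
      Fact.out
    rw [eLpNorm_norm, eLpNorm_norm] at h1
    have h2 := ENNReal.toReal_mono (ENNReal.add_ne_top.2 ⟨Lp.eLpNorm_ne_top f, Lp.eLpNorm_ne_top h⟩)
      h1
    rw [ENNReal.toReal_add (Lp.eLpNorm_ne_top f) (Lp.eLpNorm_ne_top h), ← Lp.norm_def,
      ← Lp.norm_def] at h2
    exact h2
  have heq : ‖f + h‖ ^ r - ‖f‖ ^ r - lpPowDeriv hr f h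
      = ∫ x, (‖f x + h x‖ ^ r - ‖f x‖ ^ r - r * ‖f x‖ ^ (r - 2) * inner ℝ (f x) (h x)) := by
    have hae : (fun x => ‖(f + h : Lp ℂ (ENNReal.ofReal r) (volume : Measure (Space N))) x‖ ^ r)
        =ᵐ[volume] fun x => ‖f x + h x‖ ^ r := by
      filter_upwards [Lp.coeFn_add f h] with x hx
      rw [hx, Pi.add_apply]
    rw [Lp_norm_rpow_eq_integral hr, Lp_norm_rpow_eq_integral hr, lpPowDeriv_apply,
      integral_congr_ae hae, ← integral_sub, ← integral_sub]
    · exact ((integrable_Lp_norm_rpow hr (f + h)).congr hae).sub (integrable_Lp_norm_rpow hr f)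
    · exact integrable_norm_rpow_mul_inner hr f h
    · exact (integrable_Lp_norm_rpow hr (f + h)).congr hae
    · exact integrable_Lp_norm_rpow hr f
  rw [heq, ← Real.norm_eq_abs]
  refine (norm_integral_le_of_norm_le (hi.const_mul (r * r))
    (Filter.Eventually.of_forall fun x => abs_norm_rpow_add_sub_le hr _ _)).trans ?_
  rw [integral_const_mul]
  refine mul_le_mul_of_nonneg_left (hle.trans ?_) (by positivity)
  exact mul_le_mul_of_nonneg_right (Real.rpow_le_rpow ENNReal.toReal_nonneg hsum (by linarith))
    (sq_nonneg _)

theorem hasFDerivAt_Lp_norm_rpow {r : ℝ} [Fact (1 ≤ ENNReal.ofReal r)] (hr : 2 < r)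
    (f : Lp ℂ (ENNReal.ofReal r) (volume : Measure (Space N))) :
    HasFDerivAt (fun f : Lp ℂ (ENNReal.ofReal r) (volume : Measure (Space N)) => ‖f‖ ^ r)
      (lpPowDeriv hr f) f := by
  rw [hasFDerivAt_iff_isLittleO_nhds_zero]
  have h1 : (fun h => ‖f + h‖ ^ r - ‖f‖ ^ r - lpPowDeriv hr f h) =O[nhds 0]
      fun h => ‖h‖ ^ 2 := by
    refine Asymptotics.IsBigO.of_bound (r * r * (‖f‖ + 1) ^ (r - 2)) ?_
    filter_upwards [Metric.ball_mem_nhds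
      (0 : Lp ℂ (ENNReal.ofReal r) (volume : Measure (Space N))) one_pos] with h hh
    have hh1 : ‖h‖ ≤ 1 := by simpa using (mem_ball_zero_iff.1 hh).le
    refine (abs_lpPow_remainder_le hr f h).trans ?_
    rw [Real.norm_of_nonneg (sq_nonneg _), ← mul_assoc]
    refine mul_le_mul_of_nonneg_right (mul_le_mul_of_nonneg_left ?_ (by nlinarith)) (sq_nonneg _)
    exact Real.rpow_le_rpow (by positivity) (by linarith) (by linarith)
  refine h1.trans_isLittleO ?_
  simpa using (Asymptotics.isLittleO_norm_pow_id (E' := Lp ℂ (ENNReal.ofReal r)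
    (volume : Measure (Space N))) one_lt_two)

/-! ### Test functions and the Gaussian as elements of `Σ` -/

theorem isWeakGradient_of_contDiff {u : Space N → ℂ} (hu : ContDiff ℝ 1 u) :
    IsWeakGradient u
      (fun x => WithLp.toLp 2 fun i => fderiv ℝ u x (EuclideanSpace.single i 1)) := by
  intro φ hφ hc i
  have hd : Continuous fun x => fderiv ℝ u x (EuclideanSpace.single i (1 : ℝ)) :=
    (hu.continuous_fderiv (by simp)).clm_apply continuous_const
  have h := integral_smul_fderiv_eq_neg_fderiv_smul_of_integrable (μ := volume)
    (f := φ) (g := u) (v := EuclideanSpace.single i (1 : ℝ)) ?_ ?_ ?_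
    (fun x _ => hφ.differentiable (by simp) x) (fun x _ => hu.differentiable (by simp) x)
  · simp only
    rw [h, neg_neg]
  · exact ((continuous_partial hφ _).smul hu.continuous).integrable_of_hasCompactSupport
      (hc.fderiv_apply ℝ _).smul_right
  · exact (hφ.continuous.smul hd).integrable_of_hasCompactSupport hc.smul_right
  · exact (hφ.continuous.smul hu.continuous).integrable_of_hasCompactSupport hc.smul_right

theorem memLp_grad_of_memLp {g : Space N → Grad N}
    (h : ∀ i, MemLp (fun x => g x i) 2 (volume : Measure (Space N))) : MemLp g 2 volume :=
  (memLp_piLp_iff ..).2 h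

/-- The element `φ z` of `Σ` for a test function `φ` and `z : ℂ`. -/
theorem exists_test_sigma {φ : Space N → ℝ} (hφ : ContDiff ℝ ∞ φ) (hc : HasCompactSupport φ)
    (z : ℂ) : ∃ h : SigmaSpace N, sigmaFn h =ᵐ[volume] (fun x => φ x • z) ∧
      (h.1.snd.snd =ᵐ[volume] fun x => ((‖x‖ * φ x) • z : ℂ)) ∧
      ∀ᵐ x : Space N, ∀ i, sigmaGrad h x i = fderiv ℝ φ x (EuclideanSpace.single i 1) • z := by
  have hu : ContDiff ℝ 1 fun x => φ x • z := (hφ.of_le (by simp)).smul contDiff_const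
  have hd : ∀ x v, fderiv ℝ (fun x => φ x • z) x v = fderiv ℝ φ x v • z := fun x v => by
    rw [fderiv_smul_const (hφ.differentiable (by simp) x)]; rfl
  have h1 : MemLp (fun x => φ x • z) 2 (volume : Measure (Space N)) :=
    hu.continuous.memLp_of_hasCompactSupport hc.smul_right
  have h2 : MemLp (fun x => (WithLp.toLp 2 fun i =>
      fderiv ℝ (fun x => φ x • z) x (EuclideanSpace.single i 1) : Grad N)) 2
      (volume : Measure (Space N)) := by
    refine memLp_grad_of_memLp fun i => ?_
    simp only [hd]
    exact ((continuous_partial hφ _).smul continuous_const).memLp_of_hasCompactSupport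
      (hc.fderiv_apply ℝ _).smul_right
  have h3 : MemLp (fun x => (‖x‖ : ℂ) * (φ x • z)) 2 (volume : Measure (Space N)) :=
    ((Complex.continuous_ofReal.comp continuous_norm).mul
      hu.continuous).memLp_of_hasCompactSupport hc.smul_right.mul_left
  refine ⟨mkSigma _ _ h1 h2 h3 (isWeakGradient_of_contDiff hu), h1.coeFn_toLp, ?_, ?_⟩
  · filter_upwards [h3.coeFn_toLp] with x hx
    refine (show _ = _ from hx).trans ?_
    simp [mul_assoc]
  · filter_upwards [h2.coeFn_toLp] with x hx i
    have : sigmaGrad (mkSigma _ _ h1 h2 h3 (isWeakGradient_of_contDiff hu)) x = _ := hx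
    rw [this]
    exact hd _ _

/-- The ground state of the harmonic oscillator. -/
def gaussian (x : Space N) : ℂ := (Real.exp (-(1 / 2) * ‖x‖ ^ 2) : ℝ)

theorem contDiff_gaussian : ContDiff ℝ 1 (gaussian : Space N → ℂ) :=
  Complex.ofRealCLM.contDiff.comp ((contDiff_const.mul (contDiff_norm_sq ℝ)).exp)

theorem fderiv_gaussian (x : Space N) (i : Fin N) :
    fderiv ℝ gaussian x (EuclideanSpace.single i 1) = -((x i : ℂ) * gaussian x) := by
  have h1 : HasFDerivAt (fun x : Space N => ‖x‖ ^ 2) (2 • innerSL ℝ x) x :=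
    (hasStrictFDerivAt_norm_sq x).hasFDerivAt
  have h2 := Complex.ofRealCLM.hasFDerivAt.comp x ((h1.const_mul (-(1 / 2))).exp)
  have h3 : HasFDerivAt (gaussian : Space N → ℂ) _ x := h2
  rw [h3.fderiv]
  simp [gaussian, EuclideanSpace.inner_single_right]
  ring

theorem integrable_exp_neg_mul_sq_norm {b : ℝ} (hb : 0 < b) :
    Integrable (fun x : Space N => Real.exp (-b * ‖x‖ ^ 2)) volume := by
  have h := (GaussianFourier.integrable_cexp_neg_mul_sq_norm_add (V := Space N) (b := b)
    (by simpa using hb) 0 0).norm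
  refine h.congr (Filter.Eventually.of_forall fun x => ?_)
  simp only [Complex.norm_exp]
  congr 1
  simp [← Complex.ofReal_pow]

theorem memLp_gaussian_mul {f : Space N → ℂ} (hf : Continuous f) (hle : ∀ x, ‖f x‖ ≤ 1 + ‖x‖) :
    MemLp (fun x => f x * gaussian x) 2 volume := by
  have hcont : Continuous fun x => f x * gaussian x := hf.mul contDiff_gaussian.continuous
  rw [memLp_two_iff_integrable_sq_norm hcont.aestronglyMeasurable]
  refine ((integrable_exp_neg_mul_sq_norm (N := N) (b := 1 / 2) (by norm_num)).const_mul 4).mono'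
    (hcont.norm.pow 2).aestronglyMeasurable (Filter.Eventually.of_forall fun x => ?_)
  have h1 : ‖gaussian x‖ = Real.exp (-(1 / 2) * ‖x‖ ^ 2) := by
    rw [gaussian, Complex.norm_real, Real.norm_of_nonneg (Real.exp_pos _).le]
  rw [Real.norm_of_nonneg (sq_nonneg _), norm_mul, mul_pow, h1, sq (Real.exp _), ← mul_assoc]
  refine mul_le_mul_of_nonneg_right ?_ (Real.exp_pos _).le
  have h2 : ‖f x‖ ^ 2 ≤ (1 + ‖x‖) ^ 2 := pow_le_pow_left₀ (norm_nonneg _) (hle x) 2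
  have h3 := Real.add_one_le_exp (1 / 2 * ‖x‖ ^ 2)
  -- `(1+t)² ≤ 2 + 2t² ≤ 4(1 + t²/2) ≤ 4 exp(t²/2)`: linear growth costs half of the exponent in
  -- `|gaussian|²`.
  have h4 : ‖f x‖ ^ 2 ≤ 4 * Real.exp (1 / 2 * ‖x‖ ^ 2) := by
    nlinarith [sq_nonneg (‖x‖ - 1), norm_nonneg x]
  calc ‖f x‖ ^ 2 * Real.exp (-(1 / 2) * ‖x‖ ^ 2)
      ≤ 4 * Real.exp (1 / 2 * ‖x‖ ^ 2) * Real.exp (-(1 / 2) * ‖x‖ ^ 2) := by gcongr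
    _ = 4 := by rw [mul_assoc, ← Real.exp_add]; simp

theorem exists_gaussian_sigma (N : ℕ) : ∃ h : SigmaSpace N, ¬ (sigmaFn h =ᵐ[volume] 0) ∧
    ‖h.1.snd.fst‖ ^ 2 + ‖h.1.snd.snd‖ ^ 2 = N * ‖h.1.fst‖ ^ 2 := by
  have h1 : MemLp (gaussian : Space N → ℂ) 2 volume := by
    simpa using memLp_gaussian_mul (N := N) (f := fun _ => 1) continuous_const (by simp)
  have h2 : MemLp (fun x => (WithLp.toLp 2 fun i =>
      fderiv ℝ gaussian x (EuclideanSpace.single i 1) : Grad N)) 2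
      (volume : Measure (Space N)) := by
    refine memLp_grad_of_memLp fun i => ?_
    simp only [fderiv_gaussian, ← neg_mul]
    refine memLp_gaussian_mul (by fun_prop) fun x => ?_
    have := PiLp.norm_apply_le x i
    simp only [norm_neg, Complex.norm_real]
    linarith
  have h3 : MemLp (fun x => (‖x‖ : ℂ) * gaussian x) 2 (volume : Measure (Space N)) :=
    memLp_gaussian_mul (by fun_prop) (by simp)
  refine ⟨mkSigma _ _ h1 h2 h3 (isWeakGradient_of_contDiff contDiff_gaussian), ?_,
    spectral_eq _ ?_⟩
  · intro h0
    have h4 : (gaussian : Space N → ℂ) =ᵐ[volume] 0 := h1.coeFn_toLp.symm.trans h0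
    obtain ⟨x, hx⟩ := h4.exists
    simp [gaussian] at hx
  · filter_upwards [h2.coeFn_toLp, h1.coeFn_toLp] with x hx hx' i
    have e1 : sigmaGrad (mkSigma _ _ h1 h2 h3 (isWeakGradient_of_contDiff contDiff_gaussian)) x
      = _ := hx
    have e2 : sigmaFn (mkSigma _ _ h1 h2 h3 (isWeakGradient_of_contDiff contDiff_gaussian)) x
      = _ := hx'
    rw [e1, e2]
    exact fderiv_gaussian x i

/-! ### Coercivity and existence of minimizers -/

/-- On bounded `L^p` sets, the weight `|x|²` controls the `L²` norm. -/
theorem exists_l2_bound {r C : ℝ} (hr : 2 < r) (h : HasLrBound N r C) {ε : ℝ} (hε : 0 < ε) :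
    ∃ K : ℝ, ∀ u : SigmaSpace N, ‖u.1.fst‖ ^ 2 ≤ K + powInt r u + ε * ‖u‖ ^ 2 := by
  have hr0 : 0 < r := by linarith
  -- Outside the ball of this radius `ε|x|² ≥ 1`. Inside, `|u|² ≤ 1 + |u|^r`, so `K` is the volume
  -- of the ball.
  set R : ℝ := Real.sqrt ε⁻¹ with hR
  have hR2 : R ^ 2 = ε⁻¹ := Real.sq_sqrt (by positivity)
  set S : Set (Space N) := Metric.closedBall 0 R with hS
  refine ⟨volume.real S, fun u => ?_⟩
  have hi1 : Integrable (S.indicator (1 : Space N → ℝ)) volume :=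
    (integrable_indicator_iff measurableSet_closedBall).2
      (integrableOn_const (measure_closedBall_lt_top.ne))
  have hi2 : Integrable (fun x => ‖sigmaFn u x‖ ^ r) volume := by
    have := (h.memLp u).integrable_norm_rpow (by simpa using hr0) (by simp)
    rwa [ENNReal.toReal_ofReal hr0.le] at this
  have hi3 : Integrable (fun x => ‖u.1.snd.snd x‖ ^ 2) volume :=
    (Lp.memLp _).integrable_norm_pow (by norm_num)
  have hle : ‖u.1.fst‖ ^ 2 ≤ ∫ x, (S.indicator (1 : Space N → ℝ) x + ‖sigmaFn u x‖ ^ r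
      + ε * ‖u.1.snd.snd x‖ ^ 2) := by
    rw [Lp_norm_sq_eq_integral]
    refine integral_mono_ae ((Lp.memLp _).integrable_norm_pow (by norm_num))
      ((hi1.add hi2).add (hi3.const_mul ε)) ?_
    filter_upwards [u.2.2] with x hx
    rw [hx, norm_mul, mul_pow, Complex.norm_real, norm_norm]
    change ‖sigmaFn u x‖ ^ 2 ≤ _ + ε * (‖x‖ ^ 2 * ‖sigmaFn u x‖ ^ 2)
    by_cases hxS : x ∈ S
    · rw [Set.indicator_of_mem hxS, Pi.one_apply]
      have h0 : 0 ≤ ε * (‖x‖ ^ 2 * ‖sigmaFn u x‖ ^ 2) := by positivity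
      have h2 : ‖sigmaFn u x‖ ^ 2 ≤ 1 + ‖sigmaFn u x‖ ^ r := by
        rcases le_total ‖sigmaFn u x‖ 1 with h1 | h1
        · have := pow_le_one₀ (n := 2) (norm_nonneg _) h1
          have : 0 ≤ ‖sigmaFn u x‖ ^ r := by positivity
          linarith
        · have := Real.rpow_le_rpow_of_exponent_le h1 hr.le
          rw [Real.rpow_two] at this
          linarith
      linarith
    · rw [Set.indicator_of_notMem hxS]
      have h1 : R < ‖x‖ := by simpa [hS] using hxS
      have h2 : ε⁻¹ ≤ ‖x‖ ^ 2 := by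
        rw [← hR2]; exact pow_le_pow_left₀ (Real.sqrt_nonneg _) h1.le 2
      have h3 : 1 ≤ ε * ‖x‖ ^ 2 := by
        rwa [inv_le_iff_one_le_mul₀' hε] at h2
      have h4 : 0 ≤ ‖sigmaFn u x‖ ^ r := by positivity
      nlinarith [sq_nonneg ‖sigmaFn u x‖]
  have hi12 : Integrable (fun x => S.indicator (1 : Space N → ℝ) x + ‖sigmaFn u x‖ ^ r) volume :=
    hi1.add hi2
  rw [integral_add hi12 (hi3.const_mul ε), integral_add hi1 hi2, integral_const_mul,
    ← Lp_norm_sq_eq_integral, integral_indicator_one measurableSet_closedBall] at hle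
  refine hle.trans ?_
  have h5 : ‖u.1.snd.snd‖ ^ 2 ≤ ‖u‖ ^ 2 := by
    nlinarith [sigmaSpace_norm_sq u, sq_nonneg ‖u.1.snd.fst‖, sq_nonneg ‖u.1.fst‖]
  have h6 := mul_le_mul_of_nonneg_left h5 hε.le
  exact add_le_add le_rfl h6

/-- Subcriticality as one inequality for all dimensions: it is equivalent to `p < 2^*` for `N ≥ 3`
and automatic for `N = 1, 2`. -/
theorem mul_lt_of_lt_critExp {p : ℝ} (hN : 1 ≤ N) (hp : 2 < p)
    (h : ENNReal.ofReal p < critExp N) : ((N : ℝ) - 2) * p < 2 * N := by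
  have hN1 : (1 : ℝ) ≤ N := by exact_mod_cast hN
  rcases le_or_gt N 2 with h2 | h2
  · have : (N : ℝ) ≤ 2 := by exact_mod_cast h2
    nlinarith
  · have h3 : (2 : ℝ) < N := by exact_mod_cast h2
    have e : critExp N = ENNReal.ofReal (2 * N / (N - 2)) := by
      rw [ENNReal.ofReal_div_of_pos (by linarith), ENNReal.ofReal_mul (by norm_num),
        ENNReal.ofReal_sub _ (by norm_num), ENNReal.ofReal_natCast, ENNReal.ofReal_ofNat, critExp]
    rw [e, ENNReal.ofReal_lt_ofReal_iff (div_pos (by linarith) (by linarith)),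
      lt_div_iff₀ (by linarith)] at h
    linarith

theorem exists_hasLrBound {r : ℝ} (hr : 2 < r) (h : ((N : ℝ) - 2) * r < 2 * N) :
    ∃ C : ℝ, 0 ≤ C ∧ HasLrBound N r C := by
  refine sobolev_embedding hr ?_
  have hr0 : 0 < r := by linarith
  rw [show (N : ℝ) * (1 / 2 - 1 / r) = N * (r - 2) / (2 * r) by field_simp,
    div_lt_one (by positivity)]
  linarith

theorem exists_larger_exponent {r : ℝ} (h : ((N : ℝ) - 2) * r < 2 * N) :
    ∃ r', r < r' ∧ ((N : ℝ) - 2) * r' < 2 * N := by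
  have hN : (0 : ℝ) < N + 1 := by positivity
  -- The gap `2N - (N-2)r` divided by `N + 1 > N - 2`, so that the increment uses up less than the
  -- gap.
  refine ⟨r + (2 * N - (N - 2) * r) / (N + 1), ?_, ?_⟩
  · have : 0 < (2 * N - (N - 2) * r) / (N + 1) := div_pos (by linarith) hN
    linarith
  · have h1 : ((N : ℝ) - 2) * ((2 * N - (N - 2) * r) / (N + 1)) < 2 * N - (N - 2) * r := by
      rw [mul_div_assoc', div_lt_iff₀ hN]
      nlinarith
    linarith

theorem fact_one_le_ofReal {r : ℝ} (hr : 2 < r) : Fact (1 ≤ ENNReal.ofReal r) :=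
  ⟨by rw [← ENNReal.ofReal_one]; exact ENNReal.ofReal_le_ofReal (by linarith)⟩

theorem powInt_smul {r t : ℝ} (ht : 0 < t) (u : SigmaSpace N) :
    powInt r (t • u) = t ^ r * powInt r u := by
  rw [powInt, powInt, ← integral_const_mul]
  refine integral_congr_ae ?_
  filter_upwards [sigmaFn_smul (t : ℂ) u] with x hx
  have : sigmaFn (t • u) x = (t : ℂ) • sigmaFn u x := hx
  rw [this, norm_smul, Complex.norm_real, Real.norm_of_nonneg ht.le,
    Real.mul_rpow ht.le (norm_nonneg _)]

theorem quadEnergy_smul (lam t : ℝ) (u : SigmaSpace N) :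
    quadEnergy lam (t • u) = t ^ 2 * quadEnergy lam u := by
  rw [quadEnergy_eq_norm_sq, quadEnergy_eq_norm_sq, norm_smul,
    show (t • u).1.fst = t • u.1.fst from rfl, norm_smul, Real.norm_eq_abs, mul_pow, mul_pow,
    sq_abs]
  ring

theorem powInt_pos {r C : ℝ} (hr : 2 < r) (hC : 0 ≤ C) (h : HasLrBound N r C) {u : SigmaSpace N}
    (hu : ¬ (sigmaFn u =ᵐ[volume] 0)) : 0 < powInt r u := by
  have := fact_one_le_ofReal hr
  rw [powInt_eq (by linarith) hC h]
  refine Real.rpow_pos_of_pos (norm_pos_iff.2 fun h0 => hu ?_) _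
  rw [lrEmb_apply] at h0
  refine (h.memLp u).coeFn_toLp.symm.trans ?_
  rw [h0]
  exact Lp.coeFn_zero _ _ _

theorem exists_smul_mem_lpSphere {r C : ℝ} (hr : 2 < r) (hC : 0 ≤ C) (h : HasLrBound N r C)
    {u : SigmaSpace N} (hu : ¬ (sigmaFn u =ᵐ[volume] 0)) :
    ∃ t : ℝ, 0 < t ∧ t • u ∈ lpSphere N r := by
  have hr0 : 0 < r := by linarith
  have hJ := powInt_pos hr hC h hu
  have ht : 0 < (r / powInt r u) ^ r⁻¹ := by positivity
  refine ⟨(r / powInt r u) ^ r⁻¹, ht, ?_⟩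
  change 1 / r * powInt r _ = 1
  rw [powInt_smul ht, ← Real.rpow_mul (by positivity), inv_mul_cancel₀ hr0.ne', Real.rpow_one]
  field_simp

theorem mem_lpSphere_iff {r : ℝ} (hr : 0 < r) (u : SigmaSpace N) :
    u ∈ lpSphere N r ↔ powInt r u = r := by
  change 1 / r * powInt r u = 1 ↔ _
  rw [one_div, inv_mul_eq_one₀ hr.ne', eq_comm]

set_option maxHeartbeats 2000000 in
/-- Existence of minimizers on the `L^p` sphere. -/
theorem exists_isMinOn_lpSphere {p q : ℝ} (hp : 2 < p) (hp' : ((N : ℝ) - 2) * p < 2 * N)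
    (hq : 2 < q) (hq' : ((N : ℝ) - 2) * q < 2 * N) (lam : ℝ) {b : ℝ} (hb : 0 ≤ b) :
    ∃ v ∈ lpSphere N p, IsMinOn (fun w => quadEnergy lam w + b / q * powInt q w)
      (lpSphere N p) v := by
  have hp0 : 0 < p := by linarith
  have hq0 : 0 < q := by linarith
  have := fact_one_le_ofReal hp
  have := fact_one_le_ofReal hq
  obtain ⟨p', hpp', hp''⟩ := exists_larger_exponent hp'
  obtain ⟨q', hqq', hq''⟩ := exists_larger_exponent hq'
  obtain ⟨Cp, hCp, Hp⟩ := exists_hasLrBound hp hp'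
  obtain ⟨Cq, hCq, Hq⟩ := exists_hasLrBound hq hq'
  obtain ⟨Cp', hCp', Hp'⟩ := exists_hasLrBound (hp.trans hpp') hp''
  obtain ⟨Cq', hCq', Hq'⟩ := exists_hasLrBound (hq.trans hqq') hq''
  obtain ⟨h₀, hh₀, -⟩ := exists_gaussian_sigma N
  obtain ⟨t₀, ht₀, ht₀S⟩ := exists_smul_mem_lpSphere hp hCp Hp hh₀
  set T := ((l2Emb N).restrictScalars ℝ).prod
    (((lrEmb hCp Hp).restrictScalars ℝ).prod ((lrEmb hCq Hq).restrictScalars ℝ)) with hT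
  -- `L` dominates `|λ-1|` and is positive. With `ε = 1/(2L)` the loss `(L/2)ε‖u‖²` equals `¼‖u‖²`,
  -- leaving the coercivity constant `1/4`.
  set L := |lam - 1| + 1 with hL
  have hL0 : 0 < L := by positivity
  obtain ⟨K, hK⟩ := exists_l2_bound hp Hp (ε := (2 * L)⁻¹) (by positivity)
  -- The sphere as a level set of the `L^p` norm, the degree 1 form of the constraint which the
  -- direct method requires.
  have hκ : ∀ u : SigmaSpace N, ‖lrEmb hCp Hp u‖ = p ^ p⁻¹ ↔ u ∈ lpSphere N p := fun u => by
    rw [mem_lpSphere_iff hp0, powInt_eq hp0 hCp Hp,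
      Real.eq_rpow_inv (norm_nonneg _) hp0.le hp0.ne']
  obtain ⟨v, hv, hmin⟩ := exists_minimizer (H := SigmaSpace N)
    (fun x y => parallelogram_law_with_norm ℂ x y) T
    (fun u R hR => by
      obtain ⟨φ, hφ, h2⟩ := exists_subseq_cauchySeq_l2Emb hR
      exact ⟨φ, hφ, h2.prodMk
        ((cauchySeq_lrEmb hp hpp' hCp Hp hCp' Hp' (fun n => hR (φ n)) h2).prodMk
        (cauchySeq_lrEmb hq hqq' hCq Hq hCq' Hq' (fun n => hR (φ n)) h2))⟩)
    (Φ := fun x => (lam - 1) / 2 * ‖x.1‖ ^ 2 + b / q * ‖x.2.2‖ ^ q) (n := fun x => ‖x.2.1‖)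
    (by
      have : Continuous fun x : ℝ => x ^ q := Real.continuous_rpow_const hq0.le
      fun_prop)
    (by fun_prop)
    (fun t x ht => by
      simp only [Prod.smul_snd, Prod.smul_fst, norm_smul, Real.norm_of_nonneg ht.le])
    (κ := p ^ p⁻¹) (by positivity) ⟨t₀ • h₀, (hκ _).2 ht₀S⟩
    (c := 1 / 4) (C := L / 2 * (K + p)) (by norm_num)
    (fun u hu => by
      have hS := (hκ u).1 hu
      rw [mem_lpSphere_iff hp0] at hS
      have h1 := hK u
      rw [hS] at h1
      change _ ≤ 1 / 2 * ‖u‖ ^ 2 + ((lam - 1) / 2 * ‖u.1.fst‖ ^ 2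
        + b / q * ‖lrEmb hCq Hq u‖ ^ q)
      have h2 : 0 ≤ b / q * ‖lrEmb hCq Hq u‖ ^ q := by positivity
      have h3 : -(L / 2 * ‖u.1.fst‖ ^ 2) ≤ (lam - 1) / 2 * ‖u.1.fst‖ ^ 2 := by
        have := neg_abs_le (lam - 1)
        nlinarith [sq_nonneg ‖u.1.fst‖]
      have h4 := mul_le_mul_of_nonneg_left h1 (by positivity : 0 ≤ L / 2)
      have h5 : L / 2 * (K + p + (2 * L)⁻¹ * ‖u‖ ^ 2) = L / 2 * (K + p) + 1 / 4 * ‖u‖ ^ 2 := by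
        field_simp
        ring
      rw [h5] at h4
      linarith)
  have hE : ∀ u : SigmaSpace N, 1 / 2 * ‖u‖ ^ 2
      + ((lam - 1) / 2 * ‖(T u).1‖ ^ 2 + b / q * ‖(T u).2.2‖ ^ q)
      = quadEnergy lam u + b / q * powInt q u := fun u => by
    rw [quadEnergy_eq_norm_sq, powInt_eq hq0 hCq Hq, add_assoc]
    rfl
  refine ⟨v, (hκ v).1 hv, fun w hw => ?_⟩
  have h6 := hmin w ((hκ w).2 hw)
  rw [hE, hE] at h6
  exact h6

/-! ### Lagrange multipliers and homogeneity -/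

/-- Lagrange multiplier rule for a homogeneous constraint. -/
theorem fderiv_eq_smul_of_isMinOn {H : Type*} [NormedAddCommGroup H] [NormedSpace ℝ H]
    {E J : H → ℝ} {v : H} {DE DJ : H →L[ℝ] ℝ} (hE : HasFDerivAt E DE v) (hJ : HasFDerivAt J DJ v)
    {p κ : ℝ} (hp : 0 < p) (hκ : 0 < κ) (hhom : ∀ (t : ℝ) (w : H), 0 < t → J (t • w) = t ^ p * J w)
    (hv : J v = κ) (hmin : ∀ w, J w = κ → E v ≤ E w) :
    DE = (DE v / (p * κ)) • DJ := by
  ext h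
  have hl : HasDerivAt (fun s : ℝ => v + s • h) h 0 := by
    simpa using ((hasDerivAt_id (0 : ℝ)).smul_const h).const_add v
  have hj : HasDerivAt (fun s : ℝ => J (v + s • h)) (DJ h) 0 := by
    have hJ' : HasFDerivAt J DJ (v + (0 : ℝ) • h) := by simpa using hJ
    exact hJ'.comp_hasDerivAt (0 : ℝ) hl
  -- This factor rescales the line `v + s h` back to the level set `J = κ`, so no implicit function
  -- theorem is needed. The energy along the rescaled curve has a local minimum at `s = 0`.
  have hτ : HasDerivAt (fun s : ℝ => (J (v + s • h) / κ) ^ (-p⁻¹)) (-(DJ h / (p * κ))) 0 := by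
    have h1 := (hj.div_const κ).rpow_const (p := -p⁻¹)
      (Or.inl (by simp [hv, hκ.ne']))
    convert h1 using 1
    simp only [zero_smul, add_zero, hv, div_self hκ.ne', Real.one_rpow, mul_one]
    field_simp
  have hc := hτ.smul hl
  simp only [zero_smul, add_zero, hv, div_self hκ.ne', Real.one_rpow, one_smul] at hc
  have hEc : HasDerivAt (fun s : ℝ => E ((J (v + s • h) / κ) ^ (-p⁻¹) • (v + s • h)))
      (DE (h + -(DJ h / (p * κ)) • v)) 0 := by
    have hE' : HasFDerivAt E DE ((fun s : ℝ => (J (v + s • h) / κ) ^ (-p⁻¹) • (v + s • h)) 0) := by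
      simpa [hv, div_self hκ.ne'] using hE
    exact hE'.comp_hasDerivAt (0 : ℝ) hc
  have hloc : IsLocalMin (fun s : ℝ => E ((J (v + s • h) / κ) ^ (-p⁻¹) • (v + s • h))) 0 := by
    have hpos : ∀ᶠ s : ℝ in nhds 0, 0 < J (v + s • h) := by
      have := hj.continuousAt.eventually (lt_mem_nhds (a := 0) (by simpa [hv] using hκ))
      exact this
    filter_upwards [hpos] with s hs
    simp only [zero_smul, add_zero, hv, div_self hκ.ne', Real.one_rpow, one_smul]
    refine hmin _ ?_
    rw [hhom _ _ (by positivity), ← Real.rpow_mul (by positivity), neg_mul,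
      inv_mul_cancel₀ hp.ne', Real.rpow_neg_one]
    field_simp
  have h0 := hloc.hasDerivAt_eq_zero hEc
  rw [map_add, map_smul, smul_eq_mul] at h0
  rw [smul_apply, smul_eq_mul]
  linear_combination h0

/-- Chain rule for `f(w) = k f(c⁻¹ w)`. -/
theorem hasFDerivAt_smul_of_homogeneous {H : Type*} [NormedAddCommGroup H] [NormedSpace ℝ H]
    {f : H → ℝ} {v : H} {D : H →L[ℝ] ℝ} (hf : HasFDerivAt f D v) {c k : ℝ} (hc : 0 < c)
    (hhom : ∀ w, f (c • w) = k * f w) : HasFDerivAt f ((k * c⁻¹) • D) (c • v) := by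
  have h1 : f = fun w => k * f (c⁻¹ • w) := by
    funext w
    rw [← hhom, smul_smul, mul_inv_cancel₀ hc.ne', one_smul]
  have h2 : HasFDerivAt (fun w : H => c⁻¹ • w) (c⁻¹ • ContinuousLinearMap.id ℝ H) (c • v) :=
    (hasFDerivAt_id (c • v)).const_smul c⁻¹
  have hf' : HasFDerivAt f D (c⁻¹ • c • v) := by
    rwa [smul_smul, inv_mul_cancel₀ hc.ne', one_smul]
  have h3 := (hf'.comp (c • v) h2).const_mul k
  rw [h1]
  refine h3.congr_fderiv ?_
  ext h
  simp [mul_assoc]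

/-! ### The derivative of the action -/

/-- The weak gradient as a map `Σ → L²`. -/
def gradEmb (N : ℕ) : SigmaSpace N →L[ℝ] Lp (Grad N) 2 (volume : Measure (Space N)) :=
  LinearMap.mkContinuous
    { toFun := fun u => u.1.snd.fst
      map_add' := fun _ _ => rfl
      map_smul' := fun _ _ => rfl } 1 fun u => by
    rw [one_mul]
    exact (sq_le_sq₀ (norm_nonneg _) (norm_nonneg _)).1 (by
      change ‖u.1.snd.fst‖ ^ 2 ≤ _
      nlinarith [sigmaSpace_norm_sq u, sq_nonneg ‖u.1.fst‖, sq_nonneg ‖u.1.snd.snd‖])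

/-- The weight `u ↦ |x| u` as a map `Σ → L²`. -/
def weightEmb (N : ℕ) : SigmaSpace N →L[ℝ] Lp ℂ 2 (volume : Measure (Space N)) :=
  LinearMap.mkContinuous
    { toFun := fun u => u.1.snd.snd
      map_add' := fun _ _ => rfl
      map_smul' := fun _ _ => rfl } 1 fun u => by
    rw [one_mul]
    exact (sq_le_sq₀ (norm_nonneg _) (norm_nonneg _)).1 (by
      change ‖u.1.snd.snd‖ ^ 2 ≤ _
      nlinarith [sigmaSpace_norm_sq u, sq_nonneg ‖u.1.fst‖, sq_nonneg ‖u.1.snd.fst‖])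

theorem hasFDerivAt_norm_sq_comp {H X : Type*} [NormedAddCommGroup H] [NormedSpace ℝ H]
    [NormedAddCommGroup X] [InnerProductSpace ℝ X] (A : H →L[ℝ] X) (c : ℝ) (u : H) :
    HasFDerivAt (fun u => c / 2 * ‖A u‖ ^ 2) (c • (innerSL ℝ (A u)).comp A) u := by
  refine ((A.hasFDerivAt (x := u)).norm_sq.const_mul (c / 2)).congr_fderiv ?_
  ext h
  simp
  ring

/-- The derivative of the quadratic energy. -/
def quadDeriv (lam : ℝ) (u : SigmaSpace N) : SigmaSpace N →L[ℝ] ℝ :=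
  (1 : ℝ) • (innerSL ℝ (gradEmb N u)).comp (gradEmb N)
    + (1 : ℝ) • (innerSL ℝ (weightEmb N u)).comp (weightEmb N)
    + lam • (innerSL ℝ (l2Emb N u)).comp ((l2Emb N).restrictScalars ℝ)

theorem hasFDerivAt_quadEnergy (lam : ℝ) (u : SigmaSpace N) :
    HasFDerivAt (quadEnergy lam) (quadDeriv lam u) u := by
  have h := ((hasFDerivAt_norm_sq_comp (gradEmb N) 1 u).add
    (hasFDerivAt_norm_sq_comp (weightEmb N) 1 u)).add
    (hasFDerivAt_norm_sq_comp ((l2Emb N).restrictScalars ℝ) lam u)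
  exact h.congr_of_eventuallyEq (Filter.Eventually.of_forall fun w => quadEnergy_eq lam w)

theorem quadDeriv_apply (lam : ℝ) (u h : SigmaSpace N) :
    quadDeriv lam u h = (∫ x, inner ℝ (sigmaGrad u x) (sigmaGrad h x))
      + (∫ x, inner ℝ (u.1.snd.snd x) (h.1.snd.snd x))
      + lam * ∫ x, inner ℝ (sigmaFn u x) (sigmaFn h x) := by
  have : quadDeriv lam u h = 1 * inner ℝ u.1.snd.fst h.1.snd.fst
    + 1 * inner ℝ u.1.snd.snd h.1.snd.snd + lam * inner ℝ u.1.fst h.1.fst := rfl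
  rw [this, L2.inner_def, L2.inner_def, L2.inner_def, one_mul, one_mul]
  rfl

theorem quadDeriv_self (lam : ℝ) (u : SigmaSpace N) :
    quadDeriv lam u u = 2 * quadEnergy lam u := by
  have : quadDeriv lam u u = 1 * inner ℝ u.1.snd.fst u.1.snd.fst
    + 1 * inner ℝ u.1.snd.snd u.1.snd.snd + lam * inner ℝ u.1.fst u.1.fst := rfl
  rw [this, real_inner_self_eq_norm_sq, real_inner_self_eq_norm_sq, real_inner_self_eq_norm_sq,
    quadEnergy_eq]
  ring

theorem exists_hasFDerivAt_powInt {r : ℝ} (hr : 2 < r) (h : ((N : ℝ) - 2) * r < 2 * N)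
    (u : SigmaSpace N) : ∃ D : SigmaSpace N →L[ℝ] ℝ, HasFDerivAt (powInt r) D u ∧
      ∀ w, D w = ∫ x, r * ‖sigmaFn u x‖ ^ (r - 2) * inner ℝ (sigmaFn u x) (sigmaFn w x) := by
  obtain ⟨C, hC, H⟩ := exists_hasLrBound hr h
  have := fact_one_le_ofReal hr
  refine ⟨(lpPowDeriv hr (lrEmb hC H u)).comp ((lrEmb hC H).restrictScalars ℝ), ?_, fun w => ?_⟩
  · have h1 := (hasFDerivAt_Lp_norm_rpow hr (lrEmb hC H u)).comp u
      ((lrEmb hC H).restrictScalars ℝ).hasFDerivAt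
    exact h1.congr_of_eventuallyEq
      (Filter.Eventually.of_forall fun w => powInt_eq (by linarith) hC H w)
  · change lpPowDeriv hr (lrEmb hC H u) (lrEmb hC H w) = _
    rw [lpPowDeriv_apply]
    refine integral_congr_ae ?_
    filter_upwards [(H.memLp u).coeFn_toLp, (H.memLp w).coeFn_toLp] with x h1 h2
    rw [lrEmb_apply, lrEmb_apply, h1, h2]

/-! ### From critical points to distributional solutions -/

theorem continuous_nonlin {a p b q : ℝ} (hp : 2 < p) (hq : 2 < q) :
    Continuous (nonlin a p b q) := by
  have h1 : Continuous fun z : ℂ => ‖z‖ ^ (p - 2) :=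
    continuous_norm.rpow_const fun _ => Or.inr (by linarith)
  have h2 : Continuous fun z : ℂ => ‖z‖ ^ (q - 2) :=
    continuous_norm.rpow_const fun _ => Or.inr (by linarith)
  exact ((continuous_const.mul h1).smul continuous_id).sub
    ((continuous_const.mul h2).smul continuous_id)

theorem norm_rpow_mul_norm_le {p : ℝ} (hp : 2 < p) (z : ℂ) :
    ‖z‖ ^ (p - 2) * ‖z‖ ≤ 1 + ‖z‖ ^ p := by
  have h0 : 0 ≤ ‖z‖ ^ p := by positivity
  rcases le_total ‖z‖ 1 with h | h
  · have h1 := Real.rpow_le_one (norm_nonneg z) h (by linarith : 0 ≤ p - 2)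
    have h2 : 0 ≤ ‖z‖ ^ (p - 2) := by positivity
    nlinarith [norm_nonneg z]
  · have h1 : ‖z‖ ^ (p - 2) * ‖z‖ = ‖z‖ ^ (p - 1) := by
      rw [show p - 1 = (p - 2) + 1 by ring, Real.rpow_add_of_nonneg (norm_nonneg _) (by linarith)
        zero_le_one, Real.rpow_one]
    have h2 := Real.rpow_le_rpow_of_exponent_le h (by linarith : p - 1 ≤ p)
    rw [h1]
    linarith

theorem norm_nonlin_le {a p b q : ℝ} (hp : 2 < p) (hq : 2 < q) (z : ℂ) :
    ‖nonlin a p b q z‖ ≤ |a| * (1 + ‖z‖ ^ p) + |b| * (1 + ‖z‖ ^ q) := by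
  rw [nonlin]
  refine (norm_sub_le _ _).trans (add_le_add ?_ ?_)
  · rw [norm_smul, norm_mul, mul_assoc, Real.norm_eq_abs,
      Real.norm_of_nonneg (by positivity : 0 ≤ ‖z‖ ^ (p - 2))]
    exact mul_le_mul_of_nonneg_left (norm_rpow_mul_norm_le hp z) (abs_nonneg _)
  · rw [norm_smul, norm_mul, mul_assoc, Real.norm_eq_abs,
      Real.norm_of_nonneg (by positivity : 0 ≤ ‖z‖ ^ (q - 2))]
    exact mul_le_mul_of_nonneg_left (norm_rpow_mul_norm_le hq z) (abs_nonneg _)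

theorem integrable_norm_rpow_sigmaFn {r : ℝ} (hr : 2 < r) (h : ((N : ℝ) - 2) * r < 2 * N)
    (u : SigmaSpace N) : Integrable (fun x => ‖sigmaFn u x‖ ^ r) volume := by
  obtain ⟨C, hC, H⟩ := exists_hasLrBound hr h
  have hr0 : 0 < r := by linarith
  have := (H.memLp u).integrable_norm_rpow (by simpa using hr0) (by simp)
  rwa [ENNReal.toReal_ofReal hr0.le] at this

theorem locallyIntegrable_nonlin {a p b q : ℝ} (hp : 2 < p) (hp' : ((N : ℝ) - 2) * p < 2 * N)
    (hq : 2 < q) (hq' : ((N : ℝ) - 2) * q < 2 * N) (u : SigmaSpace N) :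
    LocallyIntegrable (fun x => nonlin a p b q (sigmaFn u x)) := by
  have h1 : LocallyIntegrable (fun x : Space N => |a| * (1 + ‖sigmaFn u x‖ ^ p)
      + |b| * (1 + ‖sigmaFn u x‖ ^ q)) :=
    (((locallyIntegrable_const (1 : ℝ)).add
      (integrable_norm_rpow_sigmaFn hp hp' u).locallyIntegrable).smul |a|).add
    (((locallyIntegrable_const (1 : ℝ)).add
      (integrable_norm_rpow_sigmaFn hq hq' u).locallyIntegrable).smul |b|)
  refine h1.mono ((continuous_nonlin hp hq).comp_aestronglyMeasurable (memLp_sigmaFn u).1)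
    (Filter.Eventually.of_forall fun x => ?_)
  exact (norm_nonlin_le hp hq _).trans (le_abs_self _)

theorem laplacian_eq_sum {φ : Space N → ℝ} (hφ : ContDiff ℝ ∞ φ) (x : Space N) :
    Δ φ x = ∑ i, fderiv ℝ (fun y => fderiv ℝ φ y (EuclideanSpace.single i 1)) x
      (EuclideanSpace.single i 1) := by
  rw [InnerProductSpace.laplacian_eq_iteratedFDeriv_orthonormalBasis φ
    (EuclideanSpace.basisFun (Fin N) ℝ)]
  refine Finset.sum_congr rfl fun i _ => ?_
  rw [iteratedFDeriv_two_apply, fderiv_clm_apply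
    (((hφ.fderiv_right (m := ∞) le_rfl).differentiable (by simp)) x) (by fun_prop)]
  simp

theorem inner_integral_smul {ψ : Space N → ℝ} {f : Space N → ℂ}
    (h : Integrable (fun x => ψ x • f x) volume) (z : ℂ) :
    ∫ x, ψ x * inner ℝ z (f x) = inner ℝ z (∫ x, ψ x • f x) := by
  rw [← integral_inner h z]
  simp only [real_inner_smul_right]

theorem contDiff_partial {φ : Space N → ℝ} (hφ : ContDiff ℝ ∞ φ) (v : Space N) :
    ContDiff ℝ ∞ fun x => fderiv ℝ φ x v :=
  (hφ.fderiv_right (m := ∞) le_rfl).clm_apply contDiff_const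

theorem continuous_laplacian {φ : Space N → ℝ} (hφ : ContDiff ℝ ∞ φ) : Continuous (Δ φ) := by
  rw [funext fun x => laplacian_eq_sum hφ x]
  exact continuous_finsetSum _ fun i _ => continuous_partial (contDiff_partial hφ _) _

theorem hasCompactSupport_laplacian {φ : Space N → ℝ} (hφ : ContDiff ℝ ∞ φ)
    (hc : HasCompactSupport φ) : HasCompactSupport (Δ φ) := by
  refine HasCompactSupport.intro hc.isCompact fun x hx => ?_
  rw [laplacian_eq_sum hφ]
  refine Finset.sum_eq_zero fun i _ => ?_
  have h1 := tsupport_fderiv_apply_subset ℝ (f := φ) (EuclideanSpace.single i (1 : ℝ))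
  have h2 := tsupport_fderiv_apply_subset ℝ
    (f := fun y => fderiv ℝ φ y (EuclideanSpace.single i 1)) (EuclideanSpace.single i (1 : ℝ))
  exact image_eq_zero_of_notMem_tsupport (f := fun y => fderiv ℝ (fun y => fderiv ℝ φ y
    (EuclideanSpace.single i 1)) y (EuclideanSpace.single i 1)) fun h => hx (h1 (h2 h))

/-- Each `∂_i φ` is itself a test function, so the weak gradient identity for `u` tested with it
puts the second derivative on `φ`. -/
theorem integral_inner_sigmaGrad_test {φ : Space N → ℝ} (hφ : ContDiff ℝ ∞ φ)
    (hc : HasCompactSupport φ) (u h : SigmaSpace N) (z : ℂ)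
    (hh : ∀ᵐ x, ∀ i, sigmaGrad h x i = fderiv ℝ φ x (EuclideanSpace.single i 1) • z) :
    ∫ x, inner ℝ (sigmaGrad u x) (sigmaGrad h x) = inner ℝ z (-∫ x, Δ φ x • sigmaFn u x) := by
  have hd : ∀ i, ContDiff ℝ ∞ fun x => fderiv ℝ φ x (EuclideanSpace.single i (1 : ℝ)) := fun i =>
    contDiff_partial hφ _
  have hdc : ∀ i, HasCompactSupport fun x => fderiv ℝ φ x (EuclideanSpace.single i (1 : ℝ)) :=
    fun i => hc.fderiv_apply ℝ _
  have hdd : ∀ i, Continuous fun x => fderiv ℝ (fun y => fderiv ℝ φ y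
      (EuclideanSpace.single i 1)) x (EuclideanSpace.single i (1 : ℝ)) := fun i =>
    continuous_partial (hd i) _
  have hint : ∀ i, Integrable (fun x => fderiv ℝ φ x (EuclideanSpace.single i (1 : ℝ)) •
      sigmaGrad u x i) volume := fun i =>
    integrable_test_smul (hd i).continuous (hdc i) (memLp_coord (memLp_sigmaGrad u) i)
  have hint2 : ∀ i, Integrable (fun x => fderiv ℝ (fun y => fderiv ℝ φ y
      (EuclideanSpace.single i 1)) x (EuclideanSpace.single i (1 : ℝ)) • sigmaFn u x) volume :=
    fun i => integrable_test_smul (hdd i) ((hdc i).fderiv_apply ℝ _) (memLp_sigmaFn u)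
  have h1 : ∫ x, inner ℝ (sigmaGrad u x) (sigmaGrad h x)
      = ∫ x, ∑ i, fderiv ℝ φ x (EuclideanSpace.single i 1) * inner ℝ z (sigmaGrad u x i) := by
    refine integral_congr_ae ?_
    filter_upwards [hh] with x hx
    rw [PiLp.inner_apply]
    refine Finset.sum_congr rfl fun i _ => ?_
    rw [hx i, real_inner_smul_right, real_inner_comm]
  have h2 : ∀ i, Integrable (fun x => fderiv ℝ φ x (EuclideanSpace.single i (1 : ℝ)) *
      inner ℝ z (sigmaGrad u x i)) volume := fun i => by
    simpa only [real_inner_smul_right] using (hint i).const_inner (𝕜 := ℝ) z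
  rw [h1, integral_finsetSum _ fun i _ => h2 i]
  simp only [laplacian_eq_sum hφ, Finset.sum_smul]
  rw [integral_finsetSum _ fun i _ => hint2 i, ← Finset.sum_neg_distrib, inner_sum]
  refine Finset.sum_congr rfl fun i _ => ?_
  rw [inner_integral_smul (hint i)]
  congr 1
  have := u.2.1 _ (hd i) (hdc i) i
  exact (neg_eq_iff_eq_neg.2 this).symm

theorem integral_inner_weight_test {φ : Space N → ℝ} (hφ : ContDiff ℝ ∞ φ)
    (hc : HasCompactSupport φ) (u h : SigmaSpace N) (z : ℂ)
    (hh : h.1.snd.snd =ᵐ[volume] fun x => ((‖x‖ * φ x) • z : ℂ)) :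
    ∫ x, inner ℝ (u.1.snd.snd x) (h.1.snd.snd x)
      = inner ℝ z (∫ x, (‖x‖ ^ 2 * φ x) • sigmaFn u x) := by
  have hint : Integrable (fun x => (‖x‖ ^ 2 * φ x) • sigmaFn u x) volume := integrable_test_smul
    ((continuous_norm.pow 2).mul hφ.continuous) hc.mul_left (memLp_sigmaFn u)
  rw [← inner_integral_smul hint]
  refine integral_congr_ae ?_
  filter_upwards [hh, u.2.2] with x h1 h2
  rw [h1, h2, real_inner_smul_right, ← Complex.real_smul, real_inner_smul_left, real_inner_comm]
  change _ = ‖x‖ ^ 2 * φ x * inner ℝ z (u.1.fst x)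
  ring

theorem integral_nonlin_test {φ : Space N → ℝ} {r : ℝ} {u h : SigmaSpace N} (z : ℂ)
    (hint : Integrable (fun x => φ x • (‖sigmaFn u x‖ ^ (r - 2) • sigmaFn u x)) volume)
    (hh : sigmaFn h =ᵐ[volume] fun x => φ x • z) :
    ∫ x, r * ‖sigmaFn u x‖ ^ (r - 2) * inner ℝ (sigmaFn u x) (sigmaFn h x)
      = r * inner ℝ z (∫ x, φ x • (‖sigmaFn u x‖ ^ (r - 2) • sigmaFn u x)) := by
  rw [← inner_integral_smul hint, ← integral_const_mul]
  refine integral_congr_ae ?_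
  filter_upwards [hh] with x hx
  rw [hx, real_inner_smul_right, real_inner_smul_right, real_inner_comm]
  ring

/-- Critical points of the action solve the equation in the sense of distributions. -/
theorem solvesInDistributions_of_critical {lam a p b q : ℝ} (hp : 2 < p)
    (hp' : ((N : ℝ) - 2) * p < 2 * N) (hq : 2 < q) (hq' : ((N : ℝ) - 2) * q < 2 * N)
    {u : SigmaSpace N} (hu : HasFDerivAt (action lam a p b q) (0 : SigmaSpace N →L[ℝ] ℝ) u) :
    SolvesInDistributions lam (nonlin a p b q) (sigmaFn u) := by
  refine ⟨(memLp_sigmaFn u).locallyIntegrable (by norm_num),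
    locallyIntegrable_nonlin hp hp' hq hq' u, fun φ hφ hc => ?_⟩
  obtain ⟨Dp, hDp, hDp'⟩ := exists_hasFDerivAt_powInt hp hp' u
  obtain ⟨Dq, hDq, hDq'⟩ := exists_hasFDerivAt_powInt hq hq' u
  have hder := ((hasFDerivAt_quadEnergy lam u).sub (hDp.const_mul (a / p))).add
    (hDq.const_mul (b / q))
  have hzero : quadDeriv lam u - (a / p) • Dp + (b / q) • Dq = 0 := hder.unique hu
  have hpow : ∀ r : ℝ, 2 < r → ((N : ℝ) - 2) * r < 2 * N →
      Integrable (fun x => φ x • (‖sigmaFn u x‖ ^ (r - 2) • sigmaFn u x)) volume :=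
    fun r hr hr' => by
      have := (locallyIntegrable_nonlin (a := 1) (b := 0) hr hr' hr hr'
        u).integrable_smul_left_of_hasCompactSupport hφ.continuous hc
      -- With `a = 1` and `b = 0` the nonlinearity is the single power.
      simpa [nonlin] using this
  have iΔ := integrable_test_smul (continuous_laplacian hφ) (hasCompactSupport_laplacian hφ hc)
    (memLp_sigmaFn u)
  have iw : Integrable (fun x => (‖x‖ ^ 2 * φ x) • sigmaFn u x) volume := integrable_test_smul
    ((continuous_norm.pow 2).mul hφ.continuous) hc.mul_left (memLp_sigmaFn u)
  have iφ := integrable_test_smul hφ.continuous hc (memLp_sigmaFn u)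
  have hL : ∫ x, (-(Δ φ x) + ‖x‖ ^ 2 * φ x + lam * φ x) • sigmaFn u x
      = -(∫ x, Δ φ x • sigmaFn u x) + (∫ x, (‖x‖ ^ 2 * φ x) • sigmaFn u x)
        + lam • ∫ x, φ x • sigmaFn u x := by
    have e1 : Integrable (fun x => -(Δ φ x • sigmaFn u x)) volume := iΔ.neg
    have e2 : Integrable (fun x => -(Δ φ x • sigmaFn u x) + (‖x‖ ^ 2 * φ x) • sigmaFn u x)
      volume := e1.add iw
    have e3 : Integrable (fun x => lam • φ x • sigmaFn u x) volume := iφ.smul lam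
    rw [← integral_neg, ← integral_smul, ← integral_add e1 iw, ← integral_add e2 e3]
    refine integral_congr_ae (Filter.Eventually.of_forall fun x => ?_)
    simp only [add_smul, neg_smul, mul_smul]
  have hR : ∫ x, φ x • nonlin a p b q (sigmaFn u x)
      = a • (∫ x, φ x • (‖sigmaFn u x‖ ^ (p - 2) • sigmaFn u x))
        - b • ∫ x, φ x • (‖sigmaFn u x‖ ^ (q - 2) • sigmaFn u x) := by
    have e1 : Integrable (fun x => a • φ x • (‖sigmaFn u x‖ ^ (p - 2) • sigmaFn u x)) volume :=
      (hpow p hp hp').smul a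
    have e2 : Integrable (fun x => b • φ x • (‖sigmaFn u x‖ ^ (q - 2) • sigmaFn u x)) volume :=
      (hpow q hq hq').smul b
    rw [← integral_smul, ← integral_smul, ← integral_sub e1 e2]
    refine integral_congr_ae (Filter.Eventually.of_forall fun x => ?_)
    simp only [nonlin, smul_sub, smul_smul, mul_left_comm]
  rw [← sub_eq_zero, hL, hR]
  -- The derivative is only real, so the complex identity is recovered from its real inner products
  -- with all `z`, each obtained from the variation `φz`.
  refine ext_inner_left ℝ fun z => ?_
  obtain ⟨h, h1, h2, h3⟩ := exists_test_sigma hφ hc z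
  have hz := DFunLike.congr_fun hzero h
  simp only [add_apply, sub_apply,
    smul_apply, zero_apply, smul_eq_mul] at hz
  have hfn : ∫ x, inner ℝ (sigmaFn u x) (sigmaFn h x)
      = inner ℝ z (∫ x, φ x • sigmaFn u x) := by
    rw [← inner_integral_smul iφ]
    refine integral_congr_ae ?_
    filter_upwards [h1] with x hx
    rw [hx, real_inner_smul_right, real_inner_comm]
  rw [quadDeriv_apply, hDp', hDq', integral_inner_sigmaGrad_test hφ hc u h z h3,
    integral_inner_weight_test hφ hc u h z h2, integral_nonlin_test z (hpow p hp hp') h1,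
    integral_nonlin_test z (hpow q hq hq') h1, hfn] at hz
  simp only [inner_sub_right, inner_add_right, real_inner_smul_right, inner_zero_right]
  have e1 : ∀ X, a / p * (p * X) = a * X := fun X => by field_simp
  have e2 : ∀ X, b / q * (q * X) = b * X := fun X => by field_simp
  rw [e1, e2] at hz
  linarith

/-! ### Sign of the minimum and of the multiplier -/

theorem not_ae_eq_zero_of_powInt_ne_zero {r : ℝ} (hr : r ≠ 0) {u : SigmaSpace N}
    (h : powInt r u ≠ 0) : ¬ (sigmaFn u =ᵐ[volume] 0) := fun h0 => h <| by
  refine integral_eq_zero_of_ae ?_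
  filter_upwards [h0] with x hx
  rw [hx, Pi.zero_apply, norm_zero, Real.zero_rpow hr, Pi.zero_apply]

theorem norm_fst_pos {u : SigmaSpace N} (h : ¬ (sigmaFn u =ᵐ[volume] 0)) : 0 < ‖u.1.fst‖ :=
  norm_pos_iff.2 fun h0 => h <| by
    rw [sigmaFn, h0]
    exact Lp.coeFn_zero _ _ _

/-- Above the bottom `-N` of the spectrum the quadratic energy is positive. -/
theorem quadEnergy_pos {lam : ℝ} (hlam : -(N : ℝ) < lam) {u : SigmaSpace N}
    (h : ¬ (sigmaFn u =ᵐ[volume] 0)) : 0 < quadEnergy lam u := by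
  have h1 : 0 < ‖u.1.fst‖ ^ 2 := pow_pos (norm_fst_pos h) 2
  rw [quadEnergy_eq]
  nlinarith [spectral_bound u, mul_pos (by linarith : 0 < lam + N) h1]

/-- Below `-N` the minimum of the quadratic energy on the sphere is negative. -/
theorem quadEnergy_neg_of_isMinOn {lam p : ℝ} (hlam : lam < -(N : ℝ)) (hp : 2 < p)
    (hp' : ((N : ℝ) - 2) * p < 2 * N) {v : SigmaSpace N}
    (hmin : IsMinOn (quadEnergy lam) (lpSphere N p) v) : quadEnergy lam v < 0 := by
  obtain ⟨C, hC, H⟩ := exists_hasLrBound hp hp'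
  -- The Gaussian, scaled to the sphere, is the competitor: its unscaled energy is `½(λ + N)‖g‖² <
  -- 0`.
  obtain ⟨g, hg, hg'⟩ := exists_gaussian_sigma N
  obtain ⟨t, ht, htg⟩ := exists_smul_mem_lpSphere hp hC H hg
  refine lt_of_le_of_lt (hmin htg) ?_
  rw [quadEnergy_smul]
  have h1 : 0 < ‖g.1.fst‖ ^ 2 := pow_pos (norm_fst_pos hg) 2
  refine mul_neg_of_pos_of_neg (pow_pos ht 2) ?_
  rw [quadEnergy_eq]
  nlinarith [mul_pos (by linarith : 0 < -(lam + N)) h1]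

/-- The Euler-Lagrange equation of a minimizer on the `L^p` sphere. -/
theorem fderiv_eq_smul_of_isMinOn_lpSphere {p : ℝ} (hp : 0 < p) {E : SigmaSpace N → ℝ}
    {v : SigmaSpace N} (hv : v ∈ lpSphere N p) (hmin : IsMinOn E (lpSphere N p) v)
    {DE Dp : SigmaSpace N →L[ℝ] ℝ} (hE : HasFDerivAt E DE v) (hDp : HasFDerivAt (powInt p) Dp v) :
    DE = (DE v / p / p) • Dp := by
  -- The degree of homogeneity and the level of the constraint are both `p`, whence the two
  -- divisions.
  rw [div_div]
  exact fderiv_eq_smul_of_isMinOn hE hDp hp hp (fun t w ht => powInt_smul ht w)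
    ((mem_lpSphere_iff hp v).1 hv) fun w hw => hmin ((mem_lpSphere_iff hp w).2 hw)

section Abstract

variable {H : Type*} [NormedAddCommGroup H] [NormedSpace ℝ H]

theorem hasFDerivAt_zero_of_multiplier {E P Q : H → ℝ} {v : H} {DE DP DQ : H →L[ℝ] ℝ}
    (hE : HasFDerivAt E DE v) (hP : HasFDerivAt P DP v) (hQ : HasFDerivAt Q DQ v) {s t : ℝ}
    (h : DE + t • DQ = s • DP) :
    HasFDerivAt (fun w => E w - s * P w + t * Q w) (0 : H →L[ℝ] ℝ) v := by
  have h1 := (hE.sub (hP.const_mul s)).add (hQ.const_mul t)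
  refine HasFDerivAt.congr_fderiv h1 ?_
  rw [sub_add_eq_add_sub, h, sub_self]

/-- At `c • v` the derivatives of `E` and `P` acquire the factors `k c⁻¹` and `l c⁻¹`; `hkl` says
that the multiplier `m` at `v` becomes `s`. The coefficient 0 of `Q` keeps the shape of the action.
-/
theorem hasFDerivAt_zero_of_homogeneous {E P Q : H → ℝ} {v : H} {DE DP DQ : H →L[ℝ] ℝ} {c : ℝ}
    (hE : HasFDerivAt E DE v) (hP : HasFDerivAt P DP v) (hQ : HasFDerivAt Q DQ (c • v))
    (hc : 0 < c) {k l s m : ℝ} (hEh : ∀ w, E (c • w) = k * E w) (hPh : ∀ w, P (c • w) = l * P w)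
    (h : DE = m • DP) (hkl : k * m = s * l) :
    HasFDerivAt (fun w => E w - s * P w + 0 * Q w) (0 : H →L[ℝ] ℝ) (c • v) := by
  refine hasFDerivAt_zero_of_multiplier (hasFDerivAt_smul_of_homogeneous hE hc hEh)
    (hasFDerivAt_smul_of_homogeneous hP hc hPh) hQ ?_
  rw [h, zero_smul, add_zero, smul_smul, smul_smul]
  congr 1
  linear_combination c⁻¹ * hkl

theorem exists_pos_multiplier {DE DP DQ : H →L[ℝ] ℝ} {v : H} {p t : ℝ} (hp : 0 < p) (ht : 0 ≤ t)
    (h : DE + t • DQ = ((DE + t • DQ) v / p / p) • DP) (hE : 0 < DE v) (hQ : 0 ≤ DQ v) :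
    ∃ m : ℝ, 0 < m ∧ DE + t • DQ = (m / p) • DP := by
  refine ⟨(DE + t • DQ) v / p, div_pos ?_ hp, h⟩
  rw [add_apply, smul_apply, smul_eq_mul]
  positivity

end Abstract

/-- A multiple of a minimizer of the quadratic energy on the `L^p` sphere solves the equation with
nonlinearity `s |u|^{p-2} u`, where `s` is the sign of the minimum. -/
theorem exists_isWeakSolution_smul {p q lam s : ℝ} (hp : 2 < p) (hp' : ((N : ℝ) - 2) * p < 2 * N)
    (hq : 2 < q) (hq' : ((N : ℝ) - 2) * q < 2 * N) {v : SigmaSpace N} (hv : v ∈ lpSphere N p)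
    (hmin : IsMinOn (quadEnergy lam) (lpSphere N p) v) (hs : s * s = 1)
    (hpos : 0 < s * quadEnergy lam v) :
    ∃ c : ℝ, 0 < c ∧ ¬ (sigmaFn (c • v) =ᵐ[volume] 0) ∧ IsWeakSolution lam s p 0 q (c • v) := by
  have hp0 : 0 < p := by linarith
  have hμ : 0 < s * quadEnergy lam v * (2 / p) := by positivity
  -- The multiplier at `v` is `2F(v)/p²`, and it has to become `s/p` at `c • v`. Degrees 2 and `p`
  -- then require `c^{p-2} = 2F(v)/(ps)`, which is `2sF(v)/p` since `s² = 1`.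
  have hc : 0 < (s * quadEnergy lam v * (2 / p)) ^ (p - 2)⁻¹ := Real.rpow_pos_of_pos hμ _
  set c := (s * quadEnergy lam v * (2 / p)) ^ (p - 2)⁻¹ with hc_def
  have hcp : c ^ p = c ^ 2 * (s * quadEnergy lam v * (2 / p)) := by
    have h1 : c ^ (p - 2) = s * quadEnergy lam v * (2 / p) := by
      rw [hc_def, ← Real.rpow_mul hμ.le, inv_mul_cancel₀ (by linarith), Real.rpow_one]
    rw [← h1, ← Real.rpow_natCast c 2, ← Real.rpow_add hc]
    norm_num
  have hpow : powInt p (c • v) ≠ 0 := by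
    rw [powInt_smul hc, (mem_lpSphere_iff hp0 v).1 hv]
    positivity
  refine ⟨c, hc, not_ae_eq_zero_of_powInt_ne_zero hp0.ne' hpow, ?_⟩
  obtain ⟨Dp, hDp, -⟩ := exists_hasFDerivAt_powInt hp hp' v
  obtain ⟨Dq, hDq, -⟩ := exists_hasFDerivAt_powInt hq hq' (c • v)
  have hE := hasFDerivAt_quadEnergy lam v
  have hEL := fderiv_eq_smul_of_isMinOn_lpSphere hp0 hv hmin hE hDp
  rw [quadDeriv_self] at hEL
  have hcrit : HasFDerivAt (action lam s p 0 q) (0 : SigmaSpace N →L[ℝ] ℝ) (c • v) := by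
    have h1 := hasFDerivAt_zero_of_homogeneous (s := s / p) hE hDp hDq hc
      (quadEnergy_smul lam c) (powInt_smul hc) hEL (by
        rw [hcp]
        linear_combination (-(c ^ 2 * (2 * quadEnergy lam v / p / p))) * hs)
    refine h1.congr_of_eventuallyEq (Filter.Eventually.of_forall fun w => ?_)
    rw [action, zero_div]
  exact ⟨hcrit, solvesInDistributions_of_critical hp hp' hq hq' hcrit⟩

/-- A minimizer of `F + (1/q) ∫ |u|^q` on the `L^p` sphere solves the equation with a positive
multiplier. -/
theorem exists_multiplier_of_isMinOn {p q lam : ℝ} (hlam : -(N : ℝ) < lam) (hp : 2 < p)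
    (hp' : ((N : ℝ) - 2) * p < 2 * N) (hq : 2 < q) (hq' : ((N : ℝ) - 2) * q < 2 * N)
    {v : SigmaSpace N} (hv : v ∈ lpSphere N p)
    (hmin : IsMinOn (fun w => quadEnergy lam w + 1 / q * powInt q w) (lpSphere N p) v) :
    ∃ mu : ℝ, 0 < mu ∧ ¬ (sigmaFn v =ᵐ[volume] 0) ∧ IsWeakSolution lam mu p 1 q v := by
  have hp0 : 0 < p := by linarith
  have hv0 : ¬ (sigmaFn v =ᵐ[volume] 0) := not_ae_eq_zero_of_powInt_ne_zero hp0.ne' (by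
    rw [(mem_lpSphere_iff hp0 v).1 hv]
    exact hp0.ne')
  obtain ⟨Dp, hDp, -⟩ := exists_hasFDerivAt_powInt hp hp' v
  obtain ⟨Dq, hDq, hDq'⟩ := exists_hasFDerivAt_powInt hq hq' v
  have hE : HasFDerivAt (fun w => quadEnergy lam w + 1 / q * powInt q w)
      (quadDeriv lam v + (1 / q) • Dq) v :=
    (hasFDerivAt_quadEnergy lam v).add (hDq.const_mul (1 / q))
  have hEL := fderiv_eq_smul_of_isMinOn_lpSphere hp0 hv hmin hE hDp
  have hq_nonneg : 0 ≤ Dq v := by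
    rw [hDq']
    refine integral_nonneg fun x => ?_
    rw [Pi.zero_apply, real_inner_self_eq_norm_sq]
    positivity
  have hE_pos : 0 < quadDeriv lam v v := by
    rw [quadDeriv_self]
    exact mul_pos two_pos (quadEnergy_pos hlam hv0)
  -- Evaluated at `v` itself, the derivative is `2F(v) > 0` plus a nonnegative contribution of the
  -- `q` power, so the multiplier is positive.
  obtain ⟨mu, hmu_pos, hmu⟩ := exists_pos_multiplier hp0 (by positivity) hEL hE_pos hq_nonneg
  have hcrit : HasFDerivAt (action lam mu p 1 q) (0 : SigmaSpace N →L[ℝ] ℝ) v :=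
    hasFDerivAt_zero_of_multiplier (hasFDerivAt_quadEnergy lam v) hDp hDq hmu
  exact ⟨mu, hmu_pos, hv0, hcrit, solvesInDistributions_of_critical hp hp' hq hq' hcrit⟩

theorem exists_isMinOn_quadEnergy {p : ℝ} (hp : 2 < p) (hp' : ((N : ℝ) - 2) * p < 2 * N)
    (lam : ℝ) : ∃ v ∈ lpSphere N p, IsMinOn (quadEnergy lam) (lpSphere N p) v := by
  -- With `b = 0` the second power disappears, so `p` itself can serve as the second exponent.
  simpa using exists_isMinOn_lpSphere hp hp' hp hp' lam le_rfl

end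

end HarmonicNLS

theorem proposition1p1 (N : ℕ) (hN : 1 ≤ N) (p q : ℝ)
    (hp : 2 < p) (hp' : ENNReal.ofReal p < HarmonicNLS.critExp N)
    (hq : 2 < q) (hq' : ENNReal.ofReal q < HarmonicNLS.critExp N) (lam : ℝ) :
    -- `-Δu + |x|² u + λ u = |u|^{p-2} u`
    (-(N : ℝ) < lam → ∃ u : HarmonicNLS.SigmaSpace N,
      ¬ (HarmonicNLS.sigmaFn u =ᵐ[volume] 0) ∧
      HarmonicNLS.IsWeakSolution lam 1 p 0 q u ∧
      ∃ v ∈ HarmonicNLS.lpSphere N p,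
        IsMinOn (HarmonicNLS.quadEnergy lam) (HarmonicNLS.lpSphere N p) v ∧
        ∃ c : ℝ, 0 < c ∧ u = c • v) ∧
    -- `-Δu + |x|² u + λ u = -|u|^{p-2} u`
    (lam < -(N : ℝ) → ∃ u : HarmonicNLS.SigmaSpace N,
      ¬ (HarmonicNLS.sigmaFn u =ᵐ[volume] 0) ∧
      HarmonicNLS.IsWeakSolution lam (-1) p 0 q u ∧
      ∃ v ∈ HarmonicNLS.lpSphere N p,
        IsMinOn (HarmonicNLS.quadEnergy lam) (HarmonicNLS.lpSphere N p) v ∧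
        ∃ c : ℝ, 0 < c ∧ u = c • v) ∧
    -- `-Δu + |x|² u + λ u - μ |u|^{p-2} u + |u|^{q-2} u = 0`
    (-(N : ℝ) < lam → ∃ mu : ℝ, 0 < mu ∧ ∃ u : HarmonicNLS.SigmaSpace N,
      ¬ (HarmonicNLS.sigmaFn u =ᵐ[volume] 0) ∧
      HarmonicNLS.IsWeakSolution lam mu p 1 q u ∧
      u ∈ HarmonicNLS.lpSphere N p ∧
      IsMinOn (fun w => HarmonicNLS.quadEnergy lam w + 1 / q * HarmonicNLS.powInt q w)
        (HarmonicNLS.lpSphere N p) u) := by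
  have hp'' := HarmonicNLS.mul_lt_of_lt_critExp hN hp hp'
  have hq'' := HarmonicNLS.mul_lt_of_lt_critExp hN hq hq'
  refine ⟨fun hlam => ?_, fun hlam => ?_, fun hlam => ?_⟩
  · obtain ⟨v, hv, hmin⟩ := HarmonicNLS.exists_isMinOn_quadEnergy hp hp'' lam
    have hv0 := HarmonicNLS.not_ae_eq_zero_of_powInt_ne_zero (r := p) (by linarith) (u := v) (by
      rw [(HarmonicNLS.mem_lpSphere_iff (by linarith) v).1 hv]
      linarith)
    obtain ⟨c, hc, h1, h2⟩ := HarmonicNLS.exists_isWeakSolution_smul hp hp'' hq hq'' hv hmin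
      (one_mul 1) (by linarith [HarmonicNLS.quadEnergy_pos hlam hv0])
    exact ⟨c • v, h1, h2, v, hv, hmin, c, hc, rfl⟩
  · obtain ⟨v, hv, hmin⟩ := HarmonicNLS.exists_isMinOn_quadEnergy hp hp'' lam
    obtain ⟨c, hc, h1, h2⟩ := HarmonicNLS.exists_isWeakSolution_smul (s := -1) hp hp'' hq hq'' hv
      hmin (by norm_num) (by linarith [HarmonicNLS.quadEnergy_neg_of_isMinOn hlam hp hp'' hmin])
    exact ⟨c • v, h1, h2, v, hv, hmin, c, hc, rfl⟩
  · obtain ⟨v, hv, hmin⟩ :=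
      HarmonicNLS.exists_isMinOn_lpSphere hp hp'' hq hq'' lam zero_le_one
    obtain ⟨mu, hmu, h1, h2⟩ :=
      HarmonicNLS.exists_multiplier_of_isMinOn hlam hp hp'' hq hq'' hv hmin
    exact ⟨mu, hmu, v, h1, h2, hv, hmin⟩
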